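/- **Setting.** Let $d\in\{2,3\}$, let $\Omega\subset\mathbb R^d$ be a bounded domain with orientable $C^2$ boundary, $0<T_*\le T_0<\infty$, $\varepsilon\in(0,1)$. Let $W\in C^2(\mathbb R)$ be a double-well potential: $W>0$ on $(-1,1)$, $W(\pm1)=W'(\pm1)=0$, $W''(\pm1)>0$. Put $c_0:=\int_{-1}^1\sqrt{2W(r)}\,dr$. *Phase-field solution.* Let $(\varphi_{\varepsilon,0},v_{\varepsilon,0})\in H^1(\Omega)$ with $\varphi_{\varepsilon,0}\in[-1,1]$ a.e., $\nabla\cdot v_{\varepsilon,0}=0$ in the sense of distributions and $(\varphi_{\varepsilon,0}+1,v_{\varepsilon,0})\in H^1_0(\Omega)$, and let $(\varphi_\varepsilon,v_\varepsilon)$ be a weak solution of the Navier–Stokes/Allen–Cahn system on $\Omega\times(0,T_0)$ with these initial data. That is: - $v_\varepsilon\in L^2(0,T_0;H^1(\Omega;\mathbb R^d))\cap L^\infty(0,T_0;L^2(\Omega;\mathbb R^d))$, $\varphi_\varepsilon\in H^1(0,T_0;L^2(\Omega;[-1,1]))\cap L^2(0,T_0;H^2(\Omega))$, and $(\varphi_\varepsilon(\cdot,t)+1,v_\varepsilon(\cdot,t))\in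 H^1_0(\Omega)$ for a.e. $t$; - for a.e. $T\in(0,T_0)$ and all $\eta\in C_c^\infty([0,T_0);C_c^\infty(\Omega;\mathbb R^d))$ with $\nabla\cdot\eta=0$, $$\int_\Omega v_\varepsilon(T)\cdot\eta(T)\,dx-\int_\Omega v_{\varepsilon,0}\cdot\eta(0)\,dx=\int_0^T\!\!\int_\Omega v_\varepsilon\cdot\partial_t\eta+v_\varepsilon\otimes v_\varepsilon:\nabla\eta-\nabla v_\varepsilon:\nabla\eta+\varepsilon\nabla\varphi_\varepsilon\otimes\nabla\varphi_\varepsilon:\nabla\eta\,dx\,dt,$$ and $\nabla\cdot v_\varepsilon(\cdot,t)=0$ in the sense of distributions for a.e. $t$; - $\partial_t\varphi_\varepsilon+(v_\varepsilon\cdot\nabla)\varphi_\varepsilon=\Delta\varphi_\varepsilon-\varepsilon^{-2}W'(\varphi_\varepsilon)$ a.e. in $\Omega\times(0,T_0)$, and $\varphi_\varepsilon(\cdot,t)\to\varphi_{\varepsilon,0}$ in $L^2(\Omega)$ as $t\downarrow0$; - with $E[\varphi,v]:=\int_\Omega\frac12|v|^2+\frac\varepsilon2|\nabla\varphi|^2+\frac1\varepsilon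 W(\varphi)\,dx$, for a.e. $T\in(0,T_0)$, $$E[\varphi_\varepsilon(T),v_\varepsilon(T)]+\int_0^T\!\!\int_\Omega|\nabla v_\varepsilon|^2+\varepsilon|\partial_t\varphi_\varepsilon+(v_\varepsilon\cdot\nabla)\varphi_\varepsilon|^2\,dx\,dt\le E[\varphi_{\varepsilon,0},v_{\varepsilon,0}].$$ *Sharp interface solution.* Let $v_0\in(H^1_0\cap C^1)(\Omega;\mathbb R^d)$ with $\nabla\cdot v_0=0$ and $\chi_0\in BV(\Omega;\{0,1\})$ be such that $\Omega_+(0):=\{\chi_0=1\}$ is open with finitely many connected components, $\overline{\Omega_+(0)}\subset\Omega$, $\partial\Omega_+(0)$ is orientable and uniformly of class $C^3$, and neither $v_0$ nor the tangential part of $(\nabla^{\rm sym}v_0)\,\mathbf n$ jumps across $\partial\Omega_+(0)$, where $\mathbf n$ is its unit normal. Let $(\chi,v):\Omega\times(0,T_*)\to\{0,1\}\times\mathbb R^d$ be a strong solution of the sharp interface limit system with initial data $(\chi_0,v_0)$, extended by $\chi(\cdot,0):=\chi_0$. That is, with $\Omega_+(t):=\{\chi(\cdot,t)=1\}$ and $\mathcal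 I(t):=\partial\Omega_+(t)$: - $v\in H^1(0,T_*;L^2(\Omega;\mathbb R^d))\cap L^2(0,T_*;H^1(\Omega;\mathbb R^d))$, $v(\cdot,t)\in H^1_0(\Omega;\mathbb R^d)$ and $\nabla\cdot v(\cdot,t)=0$ for a.e. $t$, $v(\cdot,t)\to v_0$ in $L^2(\Omega)$ as $t\downarrow0$, and $v\in L^\infty(0,T;C^1(\Omega;\mathbb R^d))$ with $v$ and $\nabla v$ bounded on $\Omega\times(0,T)$ for every $T<T_*$; - for a.e. $T\in(0,T_*)$ and all $\eta\in C_c^\infty([0,T_*);C_c^\infty(\Omega;\mathbb R^d))$ with $\nabla\cdot\eta=0$, $$\begin{aligned}\int_\Omega v(T)\cdot\eta(T)\,dx-\int_\Omega v_0\cdot\eta(0)\,dx&=\int_0^T\!\!\int_\Omega v\cdot\partial_t\eta-\eta\cdot(v\cdot\nabla)v-\nabla v:\nabla\eta\,dx\,dt\\&\quad+c_0\int_0^T\!\!\int_\Omega\tfrac{\nabla\chi}{|\nabla\chi|}\otimes\tfrac{\nabla\chi}{|\nabla\chi|}:\nabla\eta\,d|\nabla\chi|\,dt;\end{aligned}$$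 - there is $\Psi:\overline\Omega\times[0,T_*)\to\overline\Omega$ with $\Psi(\cdot,0)=\mathrm{Id}$, with $\Psi(\cdot,t)$ a $C^3$ diffeomorphism of $\overline\Omega$, with $\Psi\in C^1([0,T];C^1(\overline\Omega))\cap C([0,T];C^3(\overline\Omega))$ for all $T<T_*$, and with $\Omega_+(t)=\Psi(\Omega_+(0),t)$ and $\overline{\Omega_+(t)}\subset\Omega$ for all $t\in(0,T_*)$; - $V_{\mathcal I}=\mathbf n_{\mathcal I}\cdot v+H_{\mathcal I}$ on $\mathcal I$, where $\mathbf n_{\mathcal I}$ is the unit normal of $\mathcal I(t)$ pointing into $\Omega_+(t)$ and $V_{\mathcal I}$, $H_{\mathcal I}$ are the normal speed and the scalar mean curvature with respect to $\mathbf n_{\mathcal I}$. *Fields and weight.* Suppose that for every $T\in[0,T_*)$ $$\begin{aligned}&\xi\in C^{0,1}([0,T];L^\infty(\Omega;\mathbb R^d))\cap L^\infty([0,T];C^{1,1}_c(\Omega;\mathbb R^d)),\qquad B\in L^\infty([0,T];C^{0,1}_c(\overline\Omega;\mathbb R^d)),\\&\vartheta\in C^{0,1}([0,T];L^\infty(\overline\Omega))\cap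 L^\infty([0,T];C^{0,1}(\overline\Omega)),\end{aligned}$$ and that for all $t\in[0,T_*)$, $\vartheta(\cdot,t)<0$ a.e. in the interior of $\{\chi(\cdot,t)=1\}\cap\Omega$ and $\vartheta(\cdot,t)>0$ a.e. in the interior of $\{\chi(\cdot,t)=0\}\cap\Omega$. *Notation.* $\psi_\varepsilon:=\int_{-1}^{\varphi_\varepsilon}\sqrt{2W(r)}\,dr$ and $H_\varepsilon:=-\varepsilon\Delta\varphi_\varepsilon+\frac1\varepsilon W'(\varphi_\varepsilon)$; $\mathbf n_\varepsilon:=\nabla\varphi_\varepsilon/|\nabla\varphi_\varepsilon|$ where $\nabla\varphi_\varepsilon\ne0$, and $\mathbf n_\varepsilon:=\mathrm s$ elsewhere, for a fixed but arbitrary unit vector $\mathrm s$; and $$E_{\mathrm{vol}}[\varphi_\varepsilon|\chi](t):=\int_\Omega|\psi_\varepsilon(\cdot,t)-c_0\chi(\cdot,t)|\,|\vartheta(\cdot,t)|\,dx,$$ where $\varphi_\varepsilon(\cdot,0):=\varphi_{\varepsilon,0}$. **Lemma.** It holds $\psi_\varepsilon\in L^2(0,T_0;H^1(\Omega))$, and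 for a.e. $T\in(0,T_*)$ all of the following integrals converge absolutely and $$\begin{aligned} E_{\mathrm{vol}}[\varphi_\varepsilon|\chi](T) &=E_{\mathrm{vol}}[\varphi_\varepsilon|\chi](0) +\int_0^T\!\!\int_\Omega(\psi_\varepsilon-c_0\chi)\big(\partial_t\vartheta+(B\cdot\nabla)\vartheta\big)\,dx\,dt\\ &\quad+\int_0^T\!\!\int_\Omega(\psi_\varepsilon-c_0\chi)\,\vartheta\,\nabla\cdot B\,dx\,dt\\ &\quad+\int_0^T\!\!\int_\Omega\vartheta\,\big((B-v)\cdot(\mathbf n_\varepsilon-\xi)\big)|\nabla\psi_\varepsilon|\,dx\,dt\\ &\quad-\int_0^T\!\!\int_\Omega(\psi_\varepsilon-c_0\chi)\big((v-v_\varepsilon)\cdot\nabla\big)\vartheta\,dx\,dt\\ &\quad+\int_0^T\!\!\int_\Omega\vartheta\,\big((B-v)\cdot\xi\big)\big(|\nabla\psi_\varepsilon|-\varepsilon|\nabla\varphi_\varepsilon|^2\big)\,dx\,dt\\ &\quad+\int_0^T\!\!\int_\Omega\Big(\big((B-v)\cdot\xi\big)\sqrt\varepsilon|\nabla\varphi_\varepsilon|-\tfrac{H_\varepsilon}{\sqrt\varepsilon}\Big)\vartheta\sqrt\varepsilon|\nabla\varphi_\varepsilon|\,dx\,dt\\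 &\quad+\int_0^T\!\!\int_\Omega\vartheta\Big(\tfrac{H_\varepsilon}{\sqrt\varepsilon}+\tfrac{\sqrt{2W(\varphi_\varepsilon)}}{\sqrt\varepsilon}(\nabla\cdot\xi)\Big)\Big(\sqrt\varepsilon|\nabla\varphi_\varepsilon|-\tfrac{\sqrt{2W(\varphi_\varepsilon)}}{\sqrt\varepsilon}\Big)\,dx\,dt\\ &\quad+\int_0^T\!\!\int_\Omega\vartheta(\nabla\cdot\xi)\Big|\sqrt\varepsilon|\nabla\varphi_\varepsilon|-\tfrac{\sqrt{2W(\varphi_\varepsilon)}}{\sqrt\varepsilon}\Big|^2\,dx\,dt\\ &\quad-\int_0^T\!\!\int_\Omega\vartheta(\nabla\cdot\xi)\sqrt\varepsilon|\nabla\varphi_\varepsilon|\Big(\sqrt\varepsilon|\nabla\varphi_\varepsilon|-\tfrac{\sqrt{2W(\varphi_\varepsilon)}}{\sqrt\varepsilon}\Big)\,dx\,dt. \end{aligned}$$ -/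

import Mathlib

open MeasureTheory Set Filter Topology
open scoped ContDiff NNReal ENNReal

noncomputable section

namespace NSAC

/-- Euclidean space of dimension `d`. -/
abbrev Eu (d : ℕ) : Type := EuclideanSpace ℝ (Fin d)

variable {d : ℕ} {F : Type*} [NormedAddCommGroup F] [NormedSpace ℝ F]

/-- The standard basis vector. -/
def basisVec (i : Fin d) : Eu d := EuclideanSpace.single i (1 : ℝ)

/-- Trace of a linear map, `∑ i, (L eᵢ) · eᵢ`. -/
def trL (L : Eu d →L[ℝ] Eu d) : ℝ := ∑ i, (L (basisVec i)) i

/-- The product `L : M = ∑ i j, L i j * M i j` of two matrices. -/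
def frob (L M : Eu d →L[ℝ] Eu d) : ℝ :=
  ∑ i, inner ℝ (L (basisVec i)) (M (basisVec i))

/-- The classical divergence. -/
def divg (u : Eu d → Eu d) (x : Eu d) : ℝ := trL (fderiv ℝ u x)

/-- The vector that represents a linear functional (from a differential to a gradient). -/
def toVec (L : Eu d →L[ℝ] ℝ) : Eu d := (InnerProductSpace.toDual ℝ (Eu d)).symm L

/-! ## Domains with regular boundary -/

/-- `ρ` is a `C^k` defining function, with nonvanishing gradient, of the set `U` in the open set
`V`: inside `V`, the set `U` is the sublevel set `ρ < 0`. -/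
structure IsLocalDefining (k : ℕ) (U V : Set (Eu d)) (ρ : Eu d → ℝ) : Prop where
  isOpen : IsOpen V
  contDiffOn : ContDiffOn ℝ k ρ V
  grad_ne : ∀ y ∈ V, gradient ρ y ≠ 0
  eq : U ∩ V = {y ∈ V | ρ y < 0}

/-- The boundary of `U` is of class `C^k`, with `U` locally on one side of it. (Such a boundary is
oriented by its normal; if it is compact, it is uniformly of class `C^k`.) -/
def HasCkBoundary (k : ℕ) (U : Set (Eu d)) : Prop :=
  ∀ x ∈ frontier U, ∃ V ρ, x ∈ V ∧ IsLocalDefining k U V ρ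

/-- A bounded domain with (orientable) `C²` boundary. -/
structure IsC2Domain (Ω : Set (Eu d)) : Prop where
  isOpen : IsOpen Ω
  isConnected : IsConnected Ω
  isBounded : Bornology.IsBounded Ω
  boundary : HasCkBoundary 2 Ω

/-- `n` is the unit normal of the boundary of `U` at `x`, pointing inside `U`. -/
def IsInnerNormal (U : Set (Eu d)) (x n : Eu d) : Prop :=
  ∃ V ρ, x ∈ V ∧ IsLocalDefining 1 U V ρ ∧ n = -(‖gradient ρ x‖⁻¹ • gradient ρ x)

/-- `H` is the mean curvature of the boundary of `U` at `x` with respect to the inner unit normal: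
minus the divergence of the (extended) inner unit normal; positive for a ball. -/
def IsMeanCurvature (U : Set (Eu d)) (x : Eu d) (H : ℝ) : Prop :=
  ∃ V ρ, x ∈ V ∧ IsLocalDefining 2 U V ρ ∧
    H = -divg (fun y => -(‖gradient ρ y‖⁻¹ • gradient ρ y)) x

/-! ## Sobolev spaces on the domain -/

/-- Smooth functions with compact support in the open set `Ω`. -/
structure IsTest (Ω : Set (Eu d)) (η : Eu d → F) : Prop where
  smooth : ContDiff ℝ ∞ η
  compact : HasCompactSupport η
  support : tsupport η ⊆ Ω

/-- `g` is the weak differential of `f` in `Ω`. -/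
def HasWeakFDeriv (Ω : Set (Eu d)) (f : Eu d → F) (g : Eu d → Eu d →L[ℝ] F) : Prop :=
  LocallyIntegrableOn f Ω volume ∧ LocallyIntegrableOn g Ω volume ∧
    ∀ η : Eu d → ℝ, IsTest Ω η → ∀ e : Eu d,
      ∫ x in Ω, (fderiv ℝ η x e) • f x = -∫ x in Ω, η x • g x e

/-- `H¹(Ω)`. -/
def MemH1 (Ω : Set (Eu d)) (f : Eu d → F) : Prop :=
  MemLp f 2 (volume.restrict Ω) ∧
    ∃ g, HasWeakFDeriv Ω f g ∧ MemLp g 2 (volume.restrict Ω)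

/-- `H¹₀(Ω)`: the closure of the test functions in `H¹(Ω)`. -/
def MemH10 (Ω : Set (Eu d)) (f : Eu d → F) : Prop :=
  MemLp f 2 (volume.restrict Ω) ∧
    ∃ g, HasWeakFDeriv Ω f g ∧ MemLp g 2 (volume.restrict Ω) ∧
      ∃ η : ℕ → Eu d → F, (∀ k, IsTest Ω (η k)) ∧
        Tendsto (fun k => eLpNorm (fun x => η k x - f x) 2 (volume.restrict Ω)) atTop (𝓝 0) ∧
        Tendsto (fun k => eLpNorm (fun x => fderiv ℝ (η k) x - g x) 2 (volume.restrict Ω))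
          atTop (𝓝 0)

/-- The weak differential of a function on `Ω` (zero if there is none; it is unique up to a null
set). -/
def weakFDeriv (Ω : Set (Eu d)) (f : Eu d → F) : Eu d → Eu d →L[ℝ] F :=
  open Classical in
  if h : ∃ g, HasWeakFDeriv Ω f g then h.choose else 0

/-- The vector field `u` is divergence free in `Ω` in the sense of distributions. -/
def IsWeaklyDivFree (Ω : Set (Eu d)) (u : Eu d → Eu d) : Prop :=
  ∀ η : Eu d → ℝ, IsTest Ω η → ∫ x in Ω, fderiv ℝ η x (u x) = 0

/-! ## Spaces of time dependent functions

A function on `Ω × (0,T)` is written `f t x`. -/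

/-- Lebesgue measure on the space-time cylinder (time is the first coordinate). -/
def cyl (Ω : Set (Eu d)) (T : ℝ) : Measure (ℝ × Eu d) :=
  volume.restrict (Ioo 0 T ×ˢ Ω)

/-- `f ∈ L²(0,T;H¹(Ω))`, and `g` is its differential in the space variables. -/
structure IsSpaceDeriv (Ω : Set (Eu d)) (T : ℝ) (f : ℝ → Eu d → F)
    (g : ℝ → Eu d → Eu d →L[ℝ] F) : Prop where
  memLp : MemLp (Function.uncurry f) 2 (cyl Ω T)
  memLp_deriv : MemLp (Function.uncurry g) 2 (cyl Ω T)
  weak : ∀ᵐ t ∂volume.restrict (Ioo 0 T), HasWeakFDeriv Ω (f t) (g t)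

/-- `L²(0,T;H¹(Ω))`. -/
def MemL2H1 (Ω : Set (Eu d)) (T : ℝ) (f : ℝ → Eu d → F) : Prop :=
  ∃ g, IsSpaceDeriv Ω T f g

/-- The differential in space of a function in `L²(0,T;H¹(Ω))`, unique up to a null set (zero for
other functions). -/
def spaceDeriv (Ω : Set (Eu d)) (T : ℝ) (f : ℝ → Eu d → F) : ℝ → Eu d → Eu d →L[ℝ] F :=
  open Classical in
  if h : ∃ g, IsSpaceDeriv Ω T f g then h.choose else 0

/-- `L²(0,T;H²(Ω))`. -/
def MemL2H2 (Ω : Set (Eu d)) (T : ℝ) (f : ℝ → Eu d → F) : Prop :=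
  MemL2H1 Ω T f ∧ MemL2H1 Ω T (spaceDeriv Ω T f)

/-- `f ∈ H¹(0,T;L²(Ω))`, and `g` is its time derivative: `∫ ζ' f dt = -∫ ζ g dt` in `L²(Ω)` for all
test functions `ζ` on `(0,T)`. -/
structure IsTimeDeriv (Ω : Set (Eu d)) (T : ℝ) (f g : ℝ → Eu d → F) : Prop where
  memLp : MemLp (Function.uncurry f) 2 (cyl Ω T)
  memLp_deriv : MemLp (Function.uncurry g) 2 (cyl Ω T)
  weak : ∀ ζ : ℝ → ℝ, ContDiff ℝ ∞ ζ → HasCompactSupport ζ → tsupport ζ ⊆ Ioo 0 T →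
    ∀ᵐ x ∂volume.restrict Ω,
      ∫ t in Ioo 0 T, (deriv ζ t) • f t x = -∫ t in Ioo 0 T, ζ t • g t x

/-- `H¹(0,T;L²(Ω))`. -/
def MemH1L2 (Ω : Set (Eu d)) (T : ℝ) (f : ℝ → Eu d → F) : Prop :=
  ∃ g, IsTimeDeriv Ω T f g

/-- The time derivative of a function in `H¹(0,T;L²(Ω))`, unique up to a null set (zero for other
functions). -/
def timeDeriv (Ω : Set (Eu d)) (T : ℝ) (f : ℝ → Eu d → F) : ℝ → Eu d → F :=
  open Classical in
  if h : ∃ g, IsTimeDeriv Ω T f g then h.choose else 0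

/-- `L^∞(0,T;L²(Ω))`. -/
def MemLinftyL2 (Ω : Set (Eu d)) (T : ℝ) (f : ℝ → Eu d → F) : Prop :=
  AEStronglyMeasurable (Function.uncurry f) (cyl Ω T) ∧
    ∃ C : ℝ≥0, ∀ᵐ t ∂volume.restrict (Ioo 0 T), eLpNorm (f t) 2 (volume.restrict Ω) ≤ C

/-- The gradient in space of a scalar function in `L²(0,T;H¹(Ω))`. -/
def spaceGrad (Ω : Set (Eu d)) (T : ℝ) (f : ℝ → Eu d → ℝ) (t : ℝ) (x : Eu d) : Eu d :=
  toVec (spaceDeriv Ω T f t x)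

/-- The Laplacian in space of a scalar function in `L²(0,T;H²(Ω))`. -/
def spaceLap (Ω : Set (Eu d)) (T : ℝ) (f : ℝ → Eu d → ℝ) (t : ℝ) (x : Eu d) : ℝ :=
  ∑ i, spaceDeriv Ω T (spaceDeriv Ω T f) t x (basisVec i) (basisVec i)

/-- Strong convergence `f t → f₀` in `L²(Ω)` as `t ↓ 0`, up to a null set of times. -/
def TendstoL2Zero (Ω : Set (Eu d)) (f : ℝ → Eu d → F) (f₀ : Eu d → F) : Prop :=
  Tendsto (fun t => eLpNorm (fun x => f t x - f₀ x) 2 (volume.restrict Ω))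
    (𝓝[>] (0 : ℝ) ⊓ ae (volume : Measure ℝ)) (𝓝 0)

/-- Divergence free test vector fields in `C^∞_c([0,T);C^∞_c(Ω;ℝ^d))`. -/
structure IsSolenoidalTest (Ω : Set (Eu d)) (T : ℝ) (η : ℝ → Eu d → Eu d) : Prop where
  smooth : ContDiff ℝ ∞ (Function.uncurry η)
  compact : HasCompactSupport (Function.uncurry η)
  support : tsupport (Function.uncurry η) ⊆ Iio T ×ˢ Ω
  div_eq : ∀ t ∈ Ico 0 T, ∀ x, divg (η t) x = 0

/-! ## Functions of bounded variation -/

/-- Polar decomposition `∇u = σ |∇u|` in `Ω` of the gradient measure of `u`, with `|∇u| = μ`. -/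
structure IsPolarGradient (Ω : Set (Eu d)) (u : Eu d → ℝ) (μ : Measure (Eu d))
    (σ : Eu d → Eu d) : Prop where
  finite : IsFiniteMeasure μ
  compl : μ Ωᶜ = 0
  measurable : Measurable σ
  unit : ∀ᵐ x ∂μ, ‖σ x‖ = 1
  weak : ∀ η : Eu d → Eu d, IsTest Ω η →
    ∫ x in Ω, u x * divg η x = -∫ x, inner ℝ (η x) (σ x) ∂μ

/-- `BV(Ω)`. -/
def MemBV (Ω : Set (Eu d)) (u : Eu d → ℝ) : Prop :=
  IntegrableOn u Ω ∧ ∃ μ σ, IsPolarGradient Ω u μ σ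

/-- The pair `(|∇u|, ∇u/|∇u|)` of a function of bounded variation. -/
def polarGradient (Ω : Set (Eu d)) (u : Eu d → ℝ) : Measure (Eu d) × (Eu d → Eu d) :=
  open Classical in
  if h : ∃ p : Measure (Eu d) × (Eu d → Eu d), IsPolarGradient Ω u p.1 p.2 then h.choose else 0

/-! ## The phase-field model -/

/-- Double-well potentials with wells `±1`. -/
structure IsDoubleWell (W : ℝ → ℝ) : Prop where
  contDiff : ContDiff ℝ 2 W
  pos : ∀ r ∈ Ioo (-1 : ℝ) 1, 0 < W r
  zero_neg : W (-1) = 0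
  zero_pos : W 1 = 0
  deriv_neg : deriv W (-1) = 0
  deriv_pos : deriv W 1 = 0
  convex_neg : 0 < deriv (deriv W) (-1)
  convex_pos : 0 < deriv (deriv W) 1

/-- The primitive `s ↦ ∫_{-1}^s √(2W(r)) dr`. -/
def primW (W : ℝ → ℝ) (s : ℝ) : ℝ := ∫ r in (-1 : ℝ)..s, √(2 * W r)

/-- The surface tension constant. -/
def surfTension (W : ℝ → ℝ) : ℝ := primW W 1

/-- The total energy of an order parameter with differential `Dφ` and a velocity. -/
def energy (Ω : Set (Eu d)) (W : ℝ → ℝ) (ε : ℝ) (φ : Eu d → ℝ) (Dφ : Eu d → Eu d →L[ℝ] ℝ)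
    (v : Eu d → Eu d) : ℝ :=
  (∫ x in Ω, (1 / 2 : ℝ) * ‖v x‖ ^ 2) +
    ∫ x in Ω, (ε / 2 * ‖toVec (Dφ x)‖ ^ 2 + 1 / ε * W (φ x))

/-- Weak solutions `(φ, v)` of the Navier--Stokes/Allen--Cahn system with time horizon `T₀` and
initial data `(φ₀, v₀)`. -/
structure IsWeakSolution (Ω : Set (Eu d)) (W : ℝ → ℝ) (ε T₀ : ℝ) (φ₀ : Eu d → ℝ)
    (v₀ : Eu d → Eu d) (φ : ℝ → Eu d → ℝ) (v : ℝ → Eu d → Eu d) : Prop where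
  -- the initial data
  init_v : MemH1 Ω v₀
  init_φ : MemH1 Ω φ₀
  init_range : ∀ᵐ x ∂volume.restrict Ω, φ₀ x ∈ Icc (-1 : ℝ) 1
  init_div : IsWeaklyDivFree Ω v₀
  init_bdry_φ : MemH10 Ω (fun x => φ₀ x - (-1))
  init_bdry_v : MemH10 Ω v₀
  -- regularity and boundary conditions
  v_L2H1 : MemL2H1 Ω T₀ v
  v_LinftyL2 : MemLinftyL2 Ω T₀ v
  φ_H1L2 : MemH1L2 Ω T₀ φ
  φ_L2H2 : MemL2H2 Ω T₀ φ
  φ_range : ∀ᵐ p ∂cyl Ω T₀, φ p.1 p.2 ∈ Icc (-1 : ℝ) 1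
  bdry_φ : ∀ᵐ t ∂volume.restrict (Ioo 0 T₀), MemH10 Ω (fun x => φ t x - (-1))
  bdry_v : ∀ᵐ t ∂volume.restrict (Ioo 0 T₀), MemH10 Ω (v t)
  -- the momentum balance
  momentum : ∀ᵐ T ∂volume.restrict (Ioo 0 T₀), ∀ η, IsSolenoidalTest Ω T₀ η →
    (∫ x in Ω, inner ℝ (v T x) (η T x)) - (∫ x in Ω, inner ℝ (v₀ x) (η 0 x)) =
      (∫ t in Ioo 0 T, ∫ x in Ω, inner ℝ (v t x) (deriv (fun s => η s x) t))
      + (∫ t in Ioo 0 T, ∫ x in Ω, inner ℝ (v t x) (fderiv ℝ (η t) x (v t x)))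
      - (∫ t in Ioo 0 T, ∫ x in Ω, frob (spaceDeriv Ω T₀ v t x) (fderiv ℝ (η t) x))
      + (∫ t in Ioo 0 T, ∫ x in Ω, ε *
          inner ℝ (spaceGrad Ω T₀ φ t x) (fderiv ℝ (η t) x (spaceGrad Ω T₀ φ t x)))
  div_free : ∀ᵐ t ∂volume.restrict (Ioo 0 T₀), IsWeaklyDivFree Ω (v t)
  -- the Allen--Cahn equation
  allen_cahn : ∀ᵐ p ∂cyl Ω T₀,
    timeDeriv Ω T₀ φ p.1 p.2 + spaceDeriv Ω T₀ φ p.1 p.2 (v p.1 p.2) =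
      spaceLap Ω T₀ φ p.1 p.2 - 1 / ε ^ 2 * deriv W (φ p.1 p.2)
  init_attained : TendstoL2Zero Ω φ φ₀
  -- sharp energy dissipation
  dissipation : ∀ᵐ T ∂volume.restrict (Ioo 0 T₀),
    energy Ω W ε (φ T) (spaceDeriv Ω T₀ φ T) (v T)
      + (∫ t in Ioo 0 T, ∫ x in Ω,
          (frob (spaceDeriv Ω T₀ v t x) (spaceDeriv Ω T₀ v t x)
            + ε * (timeDeriv Ω T₀ φ t x + spaceDeriv Ω T₀ φ t x (v t x)) ^ 2))
      ≤ energy Ω W ε φ₀ (weakFDeriv Ω φ₀) v₀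

/-- `ψ = ∫_{-1}^φ √(2W(r)) dr`. -/
def psi (W : ℝ → ℝ) (φ : ℝ → Eu d → ℝ) (t : ℝ) (x : Eu d) : ℝ := primW W (φ t x)

/-- The unit normal `∇φ/|∇φ|`, set to the unit vector `s` where `∇φ = 0`. -/
def normalEps (Ω : Set (Eu d)) (T₀ : ℝ) (s : Eu d) (φ : ℝ → Eu d → ℝ) (t : ℝ) (x : Eu d) : Eu d :=
  open Classical in
  if spaceGrad Ω T₀ φ t x = 0 then s
  else ‖spaceGrad Ω T₀ φ t x‖⁻¹ • spaceGrad Ω T₀ φ t x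

/-- The phase-field curvature `-ε Δφ + W'(φ)/ε`. -/
def curvEps (Ω : Set (Eu d)) (W : ℝ → ℝ) (ε T₀ : ℝ) (φ : ℝ → Eu d → ℝ) (t : ℝ) (x : Eu d) : ℝ :=
  -ε * spaceLap Ω T₀ φ t x + 1 / ε * deriv W (φ t x)

/-! ## The sharp interface model -/

/-- The phase `{χ = 1}`. -/
def phaseSet (Ω : Set (Eu d)) (χ : Eu d → ℝ) : Set (Eu d) := {x ∈ Ω | χ x = 1}

/-- The one-sided limits of `f` at `x`, from `U` and from `Ω \ closure U`, exist and agree. -/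
def HasZeroJump (Ω U : Set (Eu d)) (f : Eu d → F) (x : Eu d) : Prop :=
  ∃ L, Tendsto f (𝓝[U] x) (𝓝 L) ∧ Tendsto f (𝓝[Ω \ closure U] x) (𝓝 L)

/-- The tangential part `(Id - n ⊗ n) (sym L) n` of the symmetric part of `L` applied to `n`. -/
def tangentialSym (L : Eu d →L[ℝ] Eu d) (n : Eu d) : Eu d :=
  let w := (1 / 2 : ℝ) • (L n + ContinuousLinearMap.adjoint L n)
  w - inner ℝ n w • n

/-- Admissible initial data of the sharp interface model. -/
structure IsSharpInitialData (Ω : Set (Eu d)) (χ₀ : Eu d → ℝ) (v₀ : Eu d → Eu d) : Prop where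
  v_H10 : MemH10 Ω v₀
  v_C1 : ContDiffOn ℝ 1 v₀ Ω
  v_div : ∀ x ∈ Ω, divg v₀ x = 0
  χ_range : ∀ x ∈ Ω, χ₀ x = 0 ∨ χ₀ x = 1
  χ_BV : MemBV Ω χ₀
  phase_open : IsOpen (phaseSet Ω χ₀)
  phase_components :
    {C | ∃ x ∈ phaseSet Ω χ₀, C = connectedComponentIn (phaseSet Ω χ₀) x}.Finite
  phase_closure : closure (phaseSet Ω χ₀) ⊆ Ω
  phase_boundary : HasCkBoundary 3 (phaseSet Ω χ₀)
  jump_v : ∀ x ∈ frontier (phaseSet Ω χ₀), HasZeroJump Ω (phaseSet Ω χ₀) v₀ x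
  jump_stress : ∀ x ∈ frontier (phaseSet Ω χ₀), ∀ n, IsInnerNormal (phaseSet Ω χ₀) x n →
    HasZeroJump Ω (phaseSet Ω χ₀) (fun y => tangentialSym (fderiv ℝ v₀ y) n) x

/-- `Ψ`, with time derivative `Ψ'`, is a family of `C³` diffeomorphisms of `closure Ω` that starts
in the identity and lies in `C¹([0,T];C¹(closure Ω)) ∩ C([0,T];C³(closure Ω))` for all `T < Ts`. -/
structure IsDiffeoFlow (Ω : Set (Eu d)) (Ts : ℝ) (Ψ Ψ' : ℝ → Eu d → Eu d) : Prop where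
  start : ∀ x ∈ closure Ω, Ψ 0 x = x
  contDiffOn : ∀ t ∈ Ico 0 Ts, ContDiffOn ℝ 3 (Ψ t) (closure Ω)
  mapsTo : ∀ t ∈ Ico 0 Ts, MapsTo (Ψ t) (closure Ω) (closure Ω)
  inverse : ∀ t ∈ Ico 0 Ts, ∃ Φ : Eu d → Eu d, MapsTo Φ (closure Ω) (closure Ω) ∧
    InvOn Φ (Ψ t) (closure Ω) (closure Ω) ∧ ContDiffOn ℝ 3 Φ (closure Ω)
  continuous_C3 : ∀ t ∈ Ico 0 Ts, ∀ j : ℕ, j ≤ 3 →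
    TendstoUniformlyOn (fun s x => iteratedFDerivWithin ℝ j (Ψ s) (closure Ω) x)
      (fun x => iteratedFDerivWithin ℝ j (Ψ t) (closure Ω) x) (𝓝[Ico 0 Ts] t) (closure Ω)
  deriv_C1 : ∀ t ∈ Ico 0 Ts, ContDiffOn ℝ 1 (Ψ' t) (closure Ω)
  hasDeriv_C1 : ∀ t ∈ Ico 0 Ts, ∀ j : ℕ, j ≤ 1 →
    TendstoUniformlyOn
      (fun s x => (s - t)⁻¹ • (iteratedFDerivWithin ℝ j (Ψ s) (closure Ω) x
        - iteratedFDerivWithin ℝ j (Ψ t) (closure Ω) x))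
      (fun x => iteratedFDerivWithin ℝ j (Ψ' t) (closure Ω) x) (𝓝[Ico 0 Ts \ {t}] t) (closure Ω)
  continuous_deriv_C1 : ∀ t ∈ Ico 0 Ts, ∀ j : ℕ, j ≤ 1 →
    TendstoUniformlyOn (fun s x => iteratedFDerivWithin ℝ j (Ψ' s) (closure Ω) x)
      (fun x => iteratedFDerivWithin ℝ j (Ψ' t) (closure Ω) x) (𝓝[Ico 0 Ts] t) (closure Ω)

/-- Strong solutions `(χ, v)` of the sharp interface limit system with surface tension constant
`c₀`, time horizon `Ts` and initial data `(χ₀, v₀)`. The phase indicator is extended to the initial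
time by `χ₀`. -/
structure IsStrongSolution (Ω : Set (Eu d)) (c₀ Ts : ℝ) (χ₀ : Eu d → ℝ) (v₀ : Eu d → Eu d)
    (χ : ℝ → Eu d → ℝ) (v : ℝ → Eu d → Eu d) : Prop where
  init : IsSharpInitialData Ω χ₀ v₀
  χ_measurable : AEStronglyMeasurable (Function.uncurry χ) (cyl Ω Ts)
  χ_range : ∀ t ∈ Ico 0 Ts, ∀ x ∈ Ω, χ t x = 0 ∨ χ t x = 1
  χ_init : ∀ x ∈ Ω, χ 0 x = χ₀ x
  -- regularity, boundary and initial condition of the velocity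
  v_H1L2 : MemH1L2 Ω Ts v
  v_L2H1 : MemL2H1 Ω Ts v
  bdry_v : ∀ᵐ t ∂volume.restrict (Ioo 0 Ts), MemH10 Ω (v t)
  init_attained : TendstoL2Zero Ω v v₀
  v_C1 : ∀ T ∈ Ico 0 Ts, ∃ C : ℝ, ∀ᵐ t ∂volume.restrict (Ioo 0 T),
    ContDiffOn ℝ 1 (v t) Ω ∧ ∀ x ∈ Ω, ‖v t x‖ ≤ C ∧ ‖fderiv ℝ (v t) x‖ ≤ C
  -- the momentum balance
  momentum : ∀ᵐ T ∂volume.restrict (Ioo 0 Ts), ∀ η, IsSolenoidalTest Ω Ts η →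
    (∫ x in Ω, inner ℝ (v T x) (η T x)) - (∫ x in Ω, inner ℝ (v₀ x) (η 0 x)) =
      (∫ t in Ioo 0 T, ∫ x in Ω, inner ℝ (v t x) (deriv (fun s => η s x) t))
      - (∫ t in Ioo 0 T, ∫ x in Ω, inner ℝ (η t x) (spaceDeriv Ω Ts v t x (v t x)))
      - (∫ t in Ioo 0 T, ∫ x in Ω, frob (spaceDeriv Ω Ts v t x) (fderiv ℝ (η t) x))
      + c₀ * (∫ t in Ioo 0 T, ∫ x,
          inner ℝ ((polarGradient Ω (χ t)).2 x)
            (fderiv ℝ (η t) x ((polarGradient Ω (χ t)).2 x)) ∂(polarGradient Ω (χ t)).1)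
  div_free : ∀ᵐ t ∂volume.restrict (Ioo 0 Ts), IsWeaklyDivFree Ω (v t)
  -- no contact of the interface with the boundary
  phase_closure : ∀ t ∈ Ioo 0 Ts, closure (phaseSet Ω (χ t)) ⊆ Ω
  -- transport of the phase by a flow, and motion by `V = n · v + H`
  evolution : ∃ Ψ Ψ' : ℝ → Eu d → Eu d, IsDiffeoFlow Ω Ts Ψ Ψ' ∧
    (∀ t ∈ Ioo 0 Ts, phaseSet Ω (χ t) = Ψ t '' phaseSet Ω (χ 0)) ∧
    ∀ᵐ t ∂volume.restrict (Ioo 0 Ts), ∀ y ∈ frontier (phaseSet Ω (χ 0)), ∀ n H,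
      IsInnerNormal (phaseSet Ω (χ t)) (Ψ t y) n →
      IsMeanCurvature (phaseSet Ω (χ t)) (Ψ t y) H →
      inner ℝ n (Ψ' t y) = inner ℝ n (v t (Ψ t y)) + H

/-! ## Calibrating fields, weight and error functional -/

/-- The `C^{0,1}` norm of `f` on the set `K` is controlled by `C`. -/
def C01Bound (C : ℝ) (K : Set (Eu d)) (f : Eu d → F) : Prop :=
  (∀ x ∈ K, ‖f x‖ ≤ C) ∧ ∀ x ∈ K, ∀ y ∈ K, ‖f x - f y‖ ≤ C * ‖x - y‖

/-- `ξ ∈ C^{0,1}([0,T];L^∞(Ω)) ∩ L^∞([0,T];C^{1,1}_c(Ω))` for all `T < Ts`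
(the continuous representative). -/
def IsXiField (Ω : Set (Eu d)) (Ts : ℝ) (ξ : ℝ → Eu d → Eu d) : Prop :=
  ∀ T ∈ Ico 0 Ts, ∃ C : ℝ,
    (∀ t ∈ Icc 0 T, ∀ s ∈ Icc 0 T, ∀ x ∈ Ω, ‖ξ t x - ξ s x‖ ≤ C * |t - s|) ∧
    ∀ᵐ t ∂volume.restrict (Ioo 0 T),
      (∃ K ⊆ Ω, IsCompact K ∧ ∀ x ∈ Ω \ K, ξ t x = 0) ∧
      ContDiffOn ℝ 1 (ξ t) Ω ∧ C01Bound C Ω (ξ t) ∧ C01Bound C Ω (fderiv ℝ (ξ t))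

/-- `B ∈ L^∞([0,T];C^{0,1}(closure Ω))` for all `T < Ts`. -/
def IsBField (Ω : Set (Eu d)) (Ts : ℝ) (B : ℝ → Eu d → Eu d) : Prop :=
  AEStronglyMeasurable (Function.uncurry B) (cyl Ω Ts) ∧
    ∀ T ∈ Ico 0 Ts, ∃ C : ℝ, ∀ᵐ t ∂volume.restrict (Ioo 0 T), C01Bound C (closure Ω) (B t)

/-- Time dependent weights: `ϑ ∈ C^{0,1}([0,T];L^∞) ∩ L^∞([0,T];C^{0,1}(closure Ω))` for all
`T < Ts` (the continuous representative), negative a.e. inside the phase `{χ = 1}` and positive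
a.e. inside `{χ = 0}`. -/
structure IsWeight (Ω : Set (Eu d)) (Ts : ℝ) (χ ϑ : ℝ → Eu d → ℝ) : Prop where
  regular : ∀ T ∈ Ico 0 Ts, ∃ C : ℝ,
    (∀ t ∈ Icc 0 T, ∀ s ∈ Icc 0 T, ∀ x ∈ closure Ω, ‖ϑ t x - ϑ s x‖ ≤ C * |t - s|) ∧
    ∀ᵐ t ∂volume.restrict (Ioo 0 T), C01Bound C (closure Ω) (ϑ t)
  neg : ∀ t ∈ Ico 0 Ts, ∀ᵐ x ∂volume.restrict (interior {x ∈ Ω | χ t x = 1}), ϑ t x < 0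
  pos : ∀ t ∈ Ico 0 Ts, ∀ᵐ x ∂volume.restrict (interior {x ∈ Ω | χ t x = 0}), 0 < ϑ t x

/-- The integrand of the error in the phase indicators at a fixed time. -/
def volDensity (W : ℝ → ℝ) (φ χ ϑ : Eu d → ℝ) (x : Eu d) : ℝ :=
  |primW W (φ x) - surfTension W * χ x| * |ϑ x|

/-- The error in the phase indicators at a fixed time. -/
def Evol (Ω : Set (Eu d)) (W : ℝ → ℝ) (φ χ ϑ : Eu d → ℝ) : ℝ :=
  ∫ x in Ω, volDensity W φ χ ϑ x

/-- The space-time integral `∫_0^T ∫_Ω f dx dt`. -/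
def stInt (Ω : Set (Eu d)) (T : ℝ) (f : ℝ → Eu d → ℝ) : ℝ :=
  ∫ t in Ioo 0 T, ∫ x in Ω, f t x

end NSAC

end

namespace NSAC

/-! ## The primitive of the square root of the potential -/

/-! Write `ψ = primW W φ` and `c₀` for the surface tension. Since `φ ∈ [-1, 1]`, `0 ≤ ψ ≤ c₀`, so `ψ
- c₀χ` has the same sign as `ϑ` a.e. and the error density is simply `(ψ - c₀χ)ϑ`. Moreover `χϑ =
min(ϑ, 0)` a.e., which is Lipschitz in time and space. Hence the density equals `ψϑ - c₀ min(ϑ, 0)`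
(`volDensity_eq`), and no derivative of `χ` ever has to be taken.

Time: for a.e. `x`, `t ↦ φ(t, x)` is `φ₀(x)` plus the primitive of its weak time derivative
(`IsTimeDeriv.ae_eq_primitive`). The fundamental theorem of calculus along such lines and Fubini
give the increment of the error as the space-time integral of `(ψ - c₀χ)∂ₜϑ + ϑ√(2W)∂ₜφ`
(`integral_time_flux`).

Space: for `u = B` and `u = v - vε`, the integral over `Ω` of the divergence of `(ψ - c₀χ)ϑu`, read
as `(ψ - c₀χ)(u·∇ϑ + ϑ div u) + ϑ u·∇ψ`, vanishes (`IsStrongSolution.integral_flux`). No boundary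
term arises: `φ = -1` on the boundary makes `ψ` an `H¹₀` function, and `min(ϑ, 0)` vanishes off the
closure of the phase, which is compact in `Ω`. There is no interface term either, because `χϑ` is
Lipschitz.

Algebra: adding the flux along `B` and subtracting the flux along `v - vε` leaves `ϑ√(2W)(∂ₜφ +
vε·∇φ + (B - v)·∇φ)` from the terms with derivatives of `φ`. The Allen–Cahn equation turns the first
two summands into `-H_ε/ε`, and `√(2W)∇φ = |∇ψ| n_ε` produces the term with `n_ε`. In the remaining
integrands the contributions of `ξ` and `∇·ξ` cancel pointwise (`sum_integrands_eq`).

The rest supplies regularity: products of bounded and `L²` functions are integrable, the weight is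
extended to a global Lipschitz function, derivatives of Lipschitz families are jointly measurable,
and the interface is a null set at every time. -/

lemma hasDerivAt_primW {W : ℝ → ℝ} (hW : Continuous W) (s : ℝ) :
    HasDerivAt (primW W) (√(2 * W s)) s := by
  have hc : Continuous fun r => √(2 * W r) := by fun_prop
  exact intervalIntegral.integral_hasDerivAt_right (hc.intervalIntegrable _ _)
    (hc.stronglyMeasurableAtFilter _ _) hc.continuousAt

lemma primW_neg_one (W : ℝ → ℝ) : primW W (-1) = 0 := by simp [primW]

lemma continuous_primW {W : ℝ → ℝ} (hW : Continuous W) : Continuous (primW W) :=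
  continuous_iff_continuousAt.2 fun s => (hasDerivAt_primW hW s).continuousAt

lemma monotone_primW {W : ℝ → ℝ} (hW : Continuous W) : Monotone (primW W) :=
  monotone_of_deriv_nonneg (fun s => (hasDerivAt_primW hW s).differentiableAt)
    fun s => by rw [(hasDerivAt_primW hW s).deriv]; positivity

lemma primW_mem_Icc {W : ℝ → ℝ} (hW : Continuous W) {s : ℝ} (hs : s ∈ Icc (-1 : ℝ) 1) :
    primW W s ∈ Icc 0 (surfTension W) := by
  refine ⟨?_, monotone_primW hW hs.2⟩
  rw [← primW_neg_one W]
  exact monotone_primW hW hs.1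

/-- A globally Lipschitz `C¹` function that agrees with `primW W` on `[-1, 1]`. -/
lemma exists_lipschitz_primW {W : ℝ → ℝ} (hW : Continuous W) :
    ∃ (G G' : ℝ → ℝ) (M : ℝ), 0 ≤ M ∧ Continuous G' ∧ (∀ s, HasDerivAt G (G' s) s) ∧
      (∀ s, |G' s| ≤ M) ∧ G (-1) = 0 ∧
      ∀ s ∈ Icc (-1 : ℝ) 1, G s = primW W s ∧ G' s = √(2 * W s) := by
  -- `W` is unrestricted outside `[-1, 1]`, so its argument is clamped to that interval; the
  -- integrand of the primitive is then globally bounded.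
  set V : ℝ → ℝ := fun r => W (max (-1) (min 1 r)) with hV
  have hVc : Continuous V := by fun_prop
  have heq : ∀ s ∈ Icc (-1 : ℝ) 1, V s = W s := fun s hs => by
    simp [hV, min_eq_right hs.2, max_eq_right hs.1]
  obtain ⟨M, hM⟩ := (isCompact_Icc (a := (-1 : ℝ)) (b := 1)).exists_bound_of_continuousOn
    (f := fun r => √(2 * W r)) (by fun_prop)
  refine ⟨primW V, fun s => √(2 * V s), M, (norm_nonneg _).trans (hM 0 (by simp)), by fun_prop,
    hasDerivAt_primW hVc, fun s => hM _ ?_, primW_neg_one V, fun s hs => ⟨?_, ?_⟩⟩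
  · exact ⟨le_max_left _ _, max_le (by norm_num) (min_le_left _ _)⟩
  · refine intervalIntegral.integral_congr fun r hr => ?_
    rw [uIcc_of_le hs.1] at hr
    simp only [heq r ⟨hr.1, hr.2.trans hs.2⟩]
  · simp only [heq s hs]

lemma lipschitzWith_of_hasDerivAt {G G' : ℝ → ℝ} {M : ℝ} (hM : 0 ≤ M)
    (hG : ∀ s, HasDerivAt G (G' s) s) (hb : ∀ s, |G' s| ≤ M) : LipschitzWith M.toNNReal G := by
  refine lipschitzWith_of_nnnorm_deriv_le (fun s => (hG s).differentiableAt) fun s => ?_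
  rw [(hG s).deriv, ← NNReal.coe_le_coe, Real.coe_toNNReal _ hM]
  exact hb s

end NSAC

namespace NSAC

/-! ## Weak derivatives -/

section

variable {d : ℕ} {F : Type*} [NormedAddCommGroup F] [NormedSpace ℝ F] {Ω : Set (Eu d)}

lemma integrable_smul_of_locallyIntegrableOn {f : Eu d → F} {η : Eu d → ℝ}
    (hf : LocallyIntegrableOn f Ω volume) (hη : Continuous η) (hc : HasCompactSupport η)
    (hs : tsupport η ⊆ Ω) : Integrable (fun x => η x • f x) := by
  have h1 : IntegrableOn (fun x => η x • f x) (tsupport η) :=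
    (hf.integrableOn_compact_subset hs hc).continuousOn_smul hη.continuousOn hc
  refine (integrableOn_iff_integrable_of_support_subset fun x hx => ?_).1 h1
  by_contra hx'
  exact hx (by simp [image_eq_zero_of_notMem_tsupport hx'])

/-- Weak derivatives are unique up to null sets. -/
lemma HasWeakFDeriv.ae_eq [CompleteSpace F] (hΩ : IsOpen Ω) {f : Eu d → F}
    {g₁ g₂ : Eu d → Eu d →L[ℝ] F} (h₁ : HasWeakFDeriv Ω f g₁) (h₂ : HasWeakFDeriv Ω f g₂) :
    ∀ᵐ x ∂volume.restrict Ω, g₁ x = g₂ x := by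
  -- The fundamental lemma of the calculus of variations is applied in each basis direction, which
  -- leaves only finitely many null sets.
  have key : ∀ i : Fin d, ∀ᵐ x, x ∈ Ω → g₁ x (basisVec i) - g₂ x (basisVec i) = 0 := by
    intro i
    set T : (Eu d →L[ℝ] F) →L[ℝ] F := ContinuousLinearMap.apply ℝ F (basisVec i) with hT
    have hloc : ∀ {g : Eu d → Eu d →L[ℝ] F}, LocallyIntegrableOn g Ω volume →
        LocallyIntegrableOn (fun x => g x (basisVec i)) Ω volume := fun hg x hx => by
      obtain ⟨U, hU, hi⟩ := hg x hx
      exact ⟨U, hU, T.integrable_comp hi⟩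
    refine hΩ.ae_eq_zero_of_integral_contDiff_smul_eq_zero
      ((hloc h₁.2.1).sub (hloc h₂.2.1)) fun η hη hc hs => ?_
    have hI₁ := integrable_smul_of_locallyIntegrableOn (hloc h₁.2.1) hη.continuous hc hs
    have hI₂ := integrable_smul_of_locallyIntegrableOn (hloc h₂.2.1) hη.continuous hc hs
    have hout : ∀ g : Eu d → F, ∫ x in Ω, η x • g x = ∫ x, η x • g x := fun g =>
      setIntegral_eq_integral_of_forall_compl_eq_zero fun x hx => by
        simp [image_eq_zero_of_notMem_tsupport fun h => hx (hs h)]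
    have e₁ := h₁.2.2 η ⟨hη, hc, hs⟩ (basisVec i)
    have e₂ := h₂.2.2 η ⟨hη, hc, hs⟩ (basisVec i)
    rw [hout] at e₁ e₂
    simp only [smul_sub]
    rw [integral_sub hI₁ hI₂, sub_eq_zero]
    exact neg_injective (e₁.symm.trans e₂)
  rw [ae_restrict_iff' hΩ.measurableSet]
  filter_upwards [ae_all_iff.2 key] with x hx hxΩ
  refine ContinuousLinearMap.coe_injective
    ((EuclideanSpace.basisFun (Fin d) ℝ).toBasis.ext fun i => ?_)
  simpa [basisVec, sub_eq_zero] using hx i hxΩ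

end

/-! ## Convergence of integrals in `L²` -/

section

variable {α : Type*} [MeasurableSpace α] {μ : Measure α} {E₁ E₂ : Type*}
  [NormedAddCommGroup E₁] [NormedSpace ℝ E₁] [NormedAddCommGroup E₂] [NormedSpace ℝ E₂]

/-- Hölder with exponents 2 and 2. A general bilinear `b` covers at once products of scalars, a
differential applied to a field, and a scalar times a trace. -/
lemma integrable_bilin (b : E₁ →L[ℝ] E₂ →L[ℝ] ℝ) {u : α → E₁} {a : α → E₂}
    (hu : MemLp u 2 μ) (ha : MemLp a 2 μ) : Integrable (fun x => b (u x) (a x)) μ := by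
  rw [← memLp_one_iff_integrable]
  exact MemLp.of_bilin (r := 1) (fun x y => b x y) ‖b‖₊ hu ha
    (b.aestronglyMeasurable_comp₂ hu.1 ha.1)
    (.of_forall fun x => by
      simpa [← NNReal.coe_le_coe] using b.le_opNorm₂ (u x) (a x))

lemma tendsto_integral_bilin (b : E₁ →L[ℝ] E₂ →L[ℝ] ℝ) {u : α → E₁} {a : α → E₂} {p : ℕ → α → E₂}
    (hu : MemLp u 2 μ) (ha : MemLp a 2 μ) (hp : ∀ k, MemLp (p k) 2 μ)
    (h : Tendsto (fun k => eLpNorm (fun x => p k x - a x) 2 μ) atTop (𝓝 0)) :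
    Tendsto (fun k => ∫ x, b (u x) (p k x) ∂μ) atTop (𝓝 (∫ x, b (u x) (a x) ∂μ)) := by
  refine tendsto_integral_of_L1' _ (integrable_bilin b hu ha).1
    (.of_forall fun k => integrable_bilin b hu (hp k)) ?_
  have hle : ∀ k, eLpNorm ((fun x => b (u x) (p k x)) - fun x => b (u x) (a x)) 1 μ
      ≤ ‖b‖₊ * eLpNorm u 2 μ * eLpNorm (fun x => p k x - a x) 2 μ := fun k => by
    have := eLpNorm_le_eLpNorm_mul_eLpNorm_of_nnnorm (r := 1) (p := 2) (q := 2) hu.1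
      ((hp k).1.sub ha.1) (fun x y => b x y) ‖b‖₊
      (.of_forall fun x => by
        simpa [← NNReal.coe_le_coe] using b.le_opNorm₂ (u x) ((p k - a) x))
    refine le_trans (le_of_eq ?_) this
    congr 1
    ext x
    simp
  refine tendsto_of_tendsto_of_tendsto_of_le_of_le tendsto_const_nhds ?_ (fun _ => zero_le) hle
  have := ENNReal.Tendsto.const_mul (a := ‖b‖₊ * eLpNorm u 2 μ) h
    (.inr (ENNReal.mul_ne_top (by simp) hu.2.ne))
  simpa using this

omit [NormedSpace ℝ E₁] [NormedSpace ℝ E₂] in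
lemma tendsto_eLpNorm_of_le {a : ℕ → α → E₁} {b : ℕ → α → E₂} {M : ℝ}
    (hab : ∀ k x, ‖a k x‖ ≤ M * ‖b k x‖)
    (hb : Tendsto (fun k => eLpNorm (b k) 2 μ) atTop (𝓝 0)) :
    Tendsto (fun k => eLpNorm (a k) 2 μ) atTop (𝓝 0) := by
  have h1 := ENNReal.Tendsto.const_mul (a := ENNReal.ofReal M) hb (.inr ENNReal.ofReal_ne_top)
  rw [mul_zero] at h1
  exact tendsto_of_tendsto_of_tendsto_of_le_of_le tendsto_const_nhds h1 (fun _ => zero_le)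
    fun k => eLpNorm_le_mul_eLpNorm_of_ae_le_mul (.of_forall (hab k)) _

/-- Dominated convergence in `L²` for a bounded sequence of factors. -/
lemma tendsto_eLpNorm_smul_of_ae_tendsto {c : ℕ → α → ℝ} {u : α → E₁} {M : ℝ} (hu : MemLp u 2 μ)
    (hc : ∀ k, AEStronglyMeasurable (c k) μ) (hb : ∀ k x, |c k x| ≤ M)
    (h : ∀ᵐ x ∂μ, Tendsto (fun k => c k x) atTop (𝓝 0)) :
    Tendsto (fun k => eLpNorm (fun x => c k x • u x) 2 μ) atTop (𝓝 0) := by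
  simp only [eLpNorm_eq_lintegral_rpow_enorm_toReal (two_ne_zero) (ENNReal.ofNat_ne_top)]
  have hz : (0 : ℝ≥0∞) = (0 : ℝ≥0∞) ^ (1 / (2 : ℝ≥0∞).toReal) := by simp
  rw [hz]
  refine (ENNReal.continuous_rpow_const.tendsto 0).comp ?_
  have hlim : Tendsto (fun k => ∫⁻ x, ‖c k x • u x‖ₑ ^ (2 : ℝ≥0∞).toReal ∂μ) atTop
      (𝓝 (∫⁻ _, 0 ∂μ)) := by
    refine tendsto_lintegral_of_dominated_convergence'
      (fun x => ‖M • u x‖ₑ ^ (2 : ℝ≥0∞).toReal) (fun k => ?_) (fun k => ?_) ?_ ?_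
    · exact ((hc k).smul hu.1).enorm.pow_const _
    · refine .of_forall fun x => ?_
      dsimp only
      gcongr
      rw [enorm_smul, enorm_smul]
      gcongr
      rw [Real.enorm_eq_ofReal_abs, Real.enorm_eq_ofReal_abs]
      exact ENNReal.ofReal_le_ofReal ((hb k x).trans (le_abs_self _))
    · exact (lintegral_rpow_enorm_lt_top_of_eLpNorm_lt_top (two_ne_zero) (ENNReal.ofNat_ne_top)
        (hu.const_smul M).2).ne
    · filter_upwards [h] with x hx
      have h1 : Tendsto (fun k => c k x • u x) atTop (𝓝 0) := by
        simpa using hx.smul_const (u x)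
      have h2 := (ENNReal.continuous_rpow_const (y := (2 : ℝ≥0∞).toReal)).tendsto 0 |>.comp
        (by simpa using h1.enorm : Tendsto (fun k => ‖c k x • u x‖ₑ) atTop (𝓝 0))
      simpa [Function.comp_def] using h2
  simpa using hlim

/-- Split `cₖaₖ - c₀u = cₖ(aₖ - u) + (cₖ - c₀)u`: the first term is small by the uniform bound on
`cₖ`, the second by dominated convergence. This is the limit needed in the chain rule, where the
factors converge only a.e. -/
lemma tendsto_eLpNorm_smul_sub {c : ℕ → α → ℝ} {c₀ : α → ℝ} {a : ℕ → α → E₁} {u : α → E₁} {M : ℝ}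
    (ha : ∀ k, MemLp (a k) 2 μ) (hu : MemLp u 2 μ)
    (hc : ∀ k, AEStronglyMeasurable (c k) μ) (hc₀ : AEStronglyMeasurable c₀ μ)
    (hb : ∀ k x, |c k x| ≤ M) (hb₀ : ∀ x, |c₀ x| ≤ M)
    (h : ∀ᵐ x ∂μ, Tendsto (fun k => c k x) atTop (𝓝 (c₀ x)))
    (hau : Tendsto (fun k => eLpNorm (fun x => a k x - u x) 2 μ) atTop (𝓝 0)) :
    Tendsto (fun k => eLpNorm (fun x => c k x • a k x - c₀ x • u x) 2 μ) atTop (𝓝 0) := by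
  have h1 : Tendsto (fun k => eLpNorm (fun x => c k x • (a k x - u x)) 2 μ) atTop (𝓝 0) := by
    refine tendsto_eLpNorm_of_le (M := M) (fun k x => ?_) hau
    rw [norm_smul]
    exact mul_le_mul_of_nonneg_right (hb k x) (norm_nonneg _)
  have h2 : Tendsto (fun k => eLpNorm (fun x => (c k x - c₀ x) • u x) 2 μ) atTop (𝓝 0) := by
    refine tendsto_eLpNorm_smul_of_ae_tendsto (M := M + M) hu (fun k => (hc k).sub hc₀)
      (fun k x => (abs_sub _ _).trans (add_le_add (hb k x) (hb₀ x))) ?_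
    filter_upwards [h] with x hx
    simpa using hx.sub_const (c₀ x)
  have h3 := h1.add h2
  rw [zero_add] at h3
  refine tendsto_of_tendsto_of_tendsto_of_le_of_le tendsto_const_nhds h3 (fun _ => zero_le)
    fun k => ?_
  have hsum : (fun x => c k x • a k x - c₀ x • u x)
      = (fun x => c k x • (a k x - u x)) + fun x => (c k x - c₀ x) • u x := by
    ext1 x
    rw [Pi.add_apply, smul_sub, sub_smul]
    abel
  dsimp only
  rw [hsum]
  exact eLpNorm_add_le ((hc k).smul ((ha k).1.sub hu.1)) (((hc k).sub hc₀).smul hu.1) one_le_two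

end

/-! ## Approximation by test functions -/

section

variable {d : ℕ} {F : Type*} [NormedAddCommGroup F] [NormedSpace ℝ F] {Ω : Set (Eu d)}

/-- The `C¹` functions `p k`, with compact support in `Ω`, converge to `f` in `L²(Ω)`, and their
differentials converge to `g`. -/
structure IsC1Approx (Ω : Set (Eu d)) (f : Eu d → F) (g : Eu d → Eu d →L[ℝ] F)
    (p : ℕ → Eu d → F) : Prop where
  contDiff : ∀ k, ContDiff ℝ 1 (p k)
  compact : ∀ k, HasCompactSupport (p k)
  support : ∀ k, tsupport (p k) ⊆ Ω
  memLp : MemLp f 2 (volume.restrict Ω)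
  memLp_deriv : MemLp g 2 (volume.restrict Ω)
  tendsto : Tendsto (fun k => eLpNorm (fun x => p k x - f x) 2 (volume.restrict Ω)) atTop (𝓝 0)
  tendsto_deriv : Tendsto (fun k => eLpNorm (fun x => fderiv ℝ (p k) x - g x) 2
    (volume.restrict Ω)) atTop (𝓝 0)

/-- Smooth approximants are weakened to `C¹` ones because the class must be stable under composition
with the primitive of `√(2W)`, which is only `C¹`. -/
lemma MemH10.exists_isC1Approx {f : Eu d → F} (hf : MemH10 Ω f) :
    ∃ g p, HasWeakFDeriv Ω f g ∧ IsC1Approx Ω f g p := by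
  obtain ⟨h1, g, hg, hg2, η, hη, ht, ht'⟩ := hf
  exact ⟨g, η, hg, fun k => (hη k).smooth.of_le (by exact_mod_cast le_top), fun k => (hη k).compact,
    fun k => (hη k).support, h1, hg2, ht, ht'⟩

namespace IsC1Approx

variable {f : Eu d → F} {g : Eu d → Eu d →L[ℝ] F} {p : ℕ → Eu d → F}

lemma memLp_apply (h : IsC1Approx Ω f g p) (k : ℕ) (μ : Measure (Eu d))
    [IsFiniteMeasureOnCompacts μ] : MemLp (p k) 2 μ :=
  (h.contDiff k).continuous.memLp_of_hasCompactSupport (h.compact k)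

lemma memLp_fderiv (h : IsC1Approx Ω f g p) (k : ℕ) (μ : Measure (Eu d))
    [IsFiniteMeasureOnCompacts μ] : MemLp (fderiv ℝ (p k)) 2 μ :=
  ((h.contDiff k).continuous_fderiv one_ne_zero).memLp_of_hasCompactSupport
    ((h.compact k).fderiv ℝ)

lemma congr_deriv (h : IsC1Approx Ω f g p) {g' : Eu d → Eu d →L[ℝ] F}
    (hg : g =ᵐ[volume.restrict Ω] g') : IsC1Approx Ω f g' p where
  __ := h
  memLp_deriv := (memLp_congr_ae hg).1 h.memLp_deriv
  tendsto_deriv := by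
    refine h.tendsto_deriv.congr fun k => eLpNorm_congr_ae ?_
    filter_upwards [hg] with x hx
    rw [hx]

lemma congr (h : IsC1Approx Ω f g p) {f' : Eu d → F}
    (hf : f =ᵐ[volume.restrict Ω] f') : IsC1Approx Ω f' g p where
  __ := h
  memLp := (memLp_congr_ae hf).1 h.memLp
  tendsto := by
    refine h.tendsto.congr fun k => eLpNorm_congr_ae ?_
    filter_upwards [hf] with x hx
    rw [hx]

/-- The factor `G'` in the chain rule is merely continuous, so convergence inside it has to be
pointwise a.e.; `L²` convergence provides that along a subsequence. -/
lemma exists_subseq_ae (h : IsC1Approx Ω f g p) :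
    ∃ ns : ℕ → ℕ, StrictMono ns ∧
      ∀ᵐ x ∂volume.restrict Ω, Tendsto (fun k => p (ns k) x) atTop (𝓝 (f x)) :=
  (tendstoInMeasure_of_tendsto_eLpNorm two_ne_zero
    (fun k => (h.memLp_apply k _).1) h.memLp.1 h.tendsto).exists_seq_tendsto_ae

end IsC1Approx

/-- A Lipschitz `C¹` function that vanishes at the boundary value preserves `H¹₀`. -/
lemma IsC1Approx.comp {f : Eu d → ℝ} {g : Eu d → Eu d →L[ℝ] ℝ} {p : ℕ → Eu d → ℝ} {c M : ℝ}
    {G G' : ℝ → ℝ}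
    (h : IsC1Approx Ω (fun x => f x - c) g p) (hM : 0 ≤ M) (hG'c : Continuous G')
    (hG : ∀ s, HasDerivAt G (G' s) s) (hb : ∀ s, |G' s| ≤ M) (h0 : G c = 0) :
    ∃ q, IsC1Approx Ω (fun x => G (f x)) (fun x => G' (f x) • g x) q := by
  obtain ⟨ns, hns, hae⟩ := h.exists_subseq_ae
  have hlip := lipschitzWith_of_hasDerivAt hM hG hb
  have hGc : Continuous G := hlip.continuous
  have hderiv : deriv G = G' := funext fun s => (hG s).deriv
  have hG1 : ContDiff ℝ 1 G :=
    contDiff_one_iff_deriv.2 ⟨fun s => (hG s).differentiableAt, by rwa [hderiv]⟩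
  have hfm : AEStronglyMeasurable f (volume.restrict Ω) := by
    refine (h.memLp.1.add (aestronglyMeasurable_const (b := c))).congr (.of_forall fun x => ?_)
    simp
  have hG'm : ∀ k, AEStronglyMeasurable (fun x => G' (p (ns k) x + c)) (volume.restrict Ω) :=
    fun k => (hG'c.comp ((h.contDiff _).continuous.add continuous_const)).aestronglyMeasurable
  have hfd : ∀ k x, fderiv ℝ (fun x => G (p (ns k) x + c)) x
      = G' (p (ns k) x + c) • fderiv ℝ (p (ns k)) x := fun k x => by
    have h1 : HasFDerivAt (fun x => p (ns k) x + c) (fderiv ℝ (p (ns k)) x) x :=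
      (((h.contDiff (ns k)).differentiable one_ne_zero) x).hasFDerivAt.add_const c
    exact ((hG _).comp_hasFDerivAt x h1).fderiv
  -- Here the normalisation `G c = 0` is used: where `p` vanishes, the composition does too.
  have hsupp : ∀ k, tsupport (fun x => G (p (ns k) x + c)) ⊆ tsupport (p (ns k)) := fun k =>
    closure_mono fun x hx hx' => hx (by simp [hx', h0])
  have hmem1 : MemLp (fun x => G (f x)) 2 (volume.restrict Ω) := by
    refine MemLp.of_le_mul (c := M) h.memLp (hGc.comp_aestronglyMeasurable hfm)
      (.of_forall fun x => ?_)
    have := hlip.dist_le_mul (f x) c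
    rwa [h0, dist_zero_right, Real.coe_toNNReal _ hM, dist_eq_norm] at this
  have hmem2 : MemLp (fun x => G' (f x) • g x) 2 (volume.restrict Ω) := by
    refine MemLp.of_le_mul (c := M) h.memLp_deriv
      ((hG'c.comp_aestronglyMeasurable hfm).smul h.memLp_deriv.1) (.of_forall fun x => ?_)
    rw [norm_smul]
    exact mul_le_mul_of_nonneg_right (hb _) (norm_nonneg _)
  refine ⟨fun k x => G (p (ns k) x + c), fun k => ?_, fun k => ?_,
    fun k => (hsupp k).trans (h.support _), hmem1, hmem2, ?_, ?_⟩
  · exact hG1.comp ((h.contDiff _).add contDiff_const)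
  · exact (h.compact (ns k)).mono' (subset_closure.trans (hsupp k))
  · refine tendsto_eLpNorm_of_le (M := M) (fun k x => ?_) (h.tendsto.comp hns.tendsto_atTop)
    have := hlip.dist_le_mul (p (ns k) x + c) (f x)
    rw [Real.coe_toNNReal _ hM, dist_eq_norm, dist_eq_norm] at this
    rwa [sub_sub_eq_add_sub]
  · simp only [hfd]
    refine tendsto_eLpNorm_smul_sub (M := M) (fun k => h.memLp_fderiv _ _) h.memLp_deriv hG'm
      (hG'c.comp_aestronglyMeasurable hfm) (fun k x => hb _) (fun x => hb _) ?_
      (h.tendsto_deriv.comp hns.tendsto_atTop)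
    filter_upwards [hae] with x hx
    refine (hG'c.tendsto (f x)).comp ?_
    simpa using hx.add_const c

/-- The limit of the differentials of approximating functions is a weak differential. -/
lemma IsC1Approx.hasWeakFDeriv {f : Eu d → ℝ} {g : Eu d → Eu d →L[ℝ] ℝ}
    {p : ℕ → Eu d → ℝ} (h : IsC1Approx Ω f g p) : HasWeakFDeriv Ω f g := by
  have hloc : ∀ {X : Type} [NormedAddCommGroup X] {u : Eu d → X},
      MemLp u 2 (volume.restrict Ω) → LocallyIntegrableOn u Ω volume := fun {X} _ {u} hu =>
    locallyIntegrableOn_of_locallyIntegrable_restrict (hu.locallyIntegrable one_le_two)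
  refine ⟨hloc h.memLp, hloc h.memLp_deriv, fun η hη e => ?_⟩
  have hη1 : MemLp η 2 (volume.restrict Ω) :=
    hη.smooth.continuous.memLp_of_hasCompactSupport hη.compact
  have hfe : Continuous fun x => fderiv ℝ η x e :=
    (hη.smooth.continuous_fderiv (by simp)).clm_apply continuous_const
  have hfs : HasCompactSupport fun x => fderiv ℝ η x e := hη.compact.fderiv_apply ℝ e
  have hη2 : MemLp (fun x => fderiv ℝ η x e) 2 (volume.restrict Ω) :=
    hfe.memLp_of_hasCompactSupport hfs
  have t1 := tendsto_integral_bilin (ContinuousLinearMap.mul ℝ ℝ) hη2 h.memLp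
    (fun k => h.memLp_apply k _) h.tendsto
  have t2 := tendsto_integral_bilin
    ((ContinuousLinearMap.id ℝ ℝ).smulRight (ContinuousLinearMap.apply ℝ ℝ e)) hη1 h.memLp_deriv
    (fun k => h.memLp_fderiv k _) h.tendsto_deriv
  simp only [ContinuousLinearMap.mul_apply', ContinuousLinearMap.smulRight_apply,
    ContinuousLinearMap.id_apply, _root_.smul_apply, ContinuousLinearMap.apply_apply,
    smul_eq_mul] at t1 t2
  -- Both sides of the weak identity are limits in `k`. For each `C¹` approximant it is classical
  -- integration by parts on the whole space, as `η` has compact support in `Ω`.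
  refine tendsto_nhds_unique t1 (t2.neg.congr fun k => ?_)
  rw [neg_eq_iff_eq_neg]
  have hz : ∀ x ∉ Ω, η x = 0 := fun x hx =>
    image_eq_zero_of_notMem_tsupport fun h => hx (hη.support h)
  have hz' : ∀ x ∉ Ω, fderiv ℝ η x e = 0 := fun x hx => by
    simp [fderiv_of_notMem_tsupport ℝ fun h => hx (hη.support h)]
  rw [setIntegral_eq_integral_of_forall_compl_eq_zero fun x hx => by simp [hz x hx],
    setIntegral_eq_integral_of_forall_compl_eq_zero fun x hx => by simp [hz' x hx]]
  have hpc := (h.contDiff k).continuous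
  have hpd : Continuous fun x => fderiv ℝ (p k) x e :=
    ((h.contDiff k).continuous_fderiv one_ne_zero).clm_apply continuous_const
  exact integral_mul_fderiv_eq_neg_fderiv_mul_of_integrable
    ((hfe.mul hpc).integrable_of_hasCompactSupport hfs.mul_right)
    ((hη.smooth.continuous.mul hpd).integrable_of_hasCompactSupport hη.compact.mul_right)
    ((hη.smooth.continuous.mul hpc).integrable_of_hasCompactSupport hη.compact.mul_right)
    (fun x _ => hη.smooth.differentiable (by simp) x)
    fun x _ => (h.contDiff k).differentiable one_ne_zero x

end

end NSAC

namespace NSAC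

/-! ## Integration by parts for Lipschitz functions -/

section

variable {d : ℕ} {Ω : Set (Eu d)}

lemma clm_eq_sum (L : Eu d →L[ℝ] ℝ) (x : Eu d) : L x = ∑ i, x i * L (basisVec i) := by
  conv_lhs => rw [← (EuclideanSpace.basisFun (Fin d) ℝ).sum_repr x]
  simp [basisVec]

/-- The trace as a continuous linear map. -/
noncomputable def trCLM (d : ℕ) : (Eu d →L[ℝ] Eu d) →L[ℝ] ℝ :=
  ∑ i, (EuclideanSpace.proj i : Eu d →L[ℝ] ℝ) ∘L ContinuousLinearMap.apply ℝ (Eu d) (basisVec i)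

lemma trCLM_apply (L : Eu d →L[ℝ] Eu d) : trCLM d L = trL L := by
  simp [trCLM, trL]

lemma LipschitzWith.mul_of_bounded {α : Type*} [PseudoMetricSpace α] {f g : α → ℝ} {K L : ℝ≥0}
    {C D : ℝ} (hf : LipschitzWith K f) (hg : LipschitzWith L g) (hC : ∀ x, |f x| ≤ C)
    (hD : ∀ x, |g x| ≤ D) : ∃ M, LipschitzWith M fun x => f x * g x := by
  refine ⟨_, LipschitzWith.of_dist_le' (K := C * L + D * K) fun x y => ?_⟩
  have h1 := hf.dist_le_mul x y
  have h2 := hg.dist_le_mul x y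
  rw [Real.dist_eq] at h1 h2 ⊢
  have : f x * g x - f y * g y = f x * (g x - g y) + g y * (f x - f y) := by ring
  rw [this]
  calc _ ≤ |f x| * |g x - g y| + |g y| * |f x - f y| := by
        rw [← abs_mul, ← abs_mul]; exact abs_add_le _ _
    _ ≤ C * (L * dist x y) + D * (K * dist x y) := by
        gcongr
        · exact (abs_nonneg _).trans (hC x)
        · exact hC x
        · exact (abs_nonneg _).trans (hD y)
        · exact hD y
    _ = _ := by ring

lemma fderiv_eq_zero_of_notMem_tsupport {q : Eu d → ℝ} {x : Eu d} (hx : x ∉ tsupport q) :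
    fderiv ℝ q x = 0 := fderiv_of_notMem_tsupport ℝ hx

lemma integrable_fderiv_mul {q θ : Eu d → ℝ} {K : ℝ≥0} (hq : LipschitzWith K q)
    (hqc : HasCompactSupport q) (hθ : Continuous θ) (e : Eu d) :
    Integrable fun x => θ x * fderiv ℝ q x e := by
  have hm : Measurable fun x => fderiv ℝ q x e := measurable_fderiv_apply_const ℝ q e
  have h1 : IntegrableOn (fun x => fderiv ℝ q x e) (tsupport q) := by
    refine Measure.integrableOn_of_bounded (M := K * ‖e‖) hqc.measure_lt_top.ne
      hm.aestronglyMeasurable (.of_forall fun x => ?_)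
    exact (ContinuousLinearMap.le_opNorm _ _).trans
      (mul_le_mul_of_nonneg_right (norm_fderiv_le_of_lipschitz ℝ hq) (norm_nonneg _))
  refine (integrableOn_iff_integrable_of_support_subset fun x hx => ?_).1
    (h1.continuousOn_mul hθ.continuousOn hqc)
  by_contra hx'
  exact hx (by simp [fderiv_eq_zero_of_notMem_tsupport hx'])

lemma integrable_mul_fderiv {q θ : Eu d → ℝ} {K : ℝ≥0} (hθ : LipschitzWith K θ)
    (hqc : HasCompactSupport q) (hq : Continuous q) (e : Eu d) :
    Integrable fun x => q x * fderiv ℝ θ x e := by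
  have hm : Measurable fun x => fderiv ℝ θ x e := measurable_fderiv_apply_const ℝ θ e
  have h1 : IntegrableOn (fun x => fderiv ℝ θ x e) (tsupport q) := by
    refine Measure.integrableOn_of_bounded (M := K * ‖e‖) hqc.measure_lt_top.ne
      hm.aestronglyMeasurable (.of_forall fun x => ?_)
    exact (ContinuousLinearMap.le_opNorm _ _).trans
      (mul_le_mul_of_nonneg_right (norm_fderiv_le_of_lipschitz ℝ hθ) (norm_nonneg _))
  refine (integrableOn_iff_integrable_of_support_subset fun x hx => ?_).1
    (h1.continuousOn_mul hq.continuousOn hqc)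
  by_contra hx'
  exact hx (by simp [image_eq_zero_of_notMem_tsupport hx'])

/-- By Rademacher's theorem the differential agrees a.e. with the line derivative, for which
integration by parts of Lipschitz functions is available; one compactly supported factor is enough.
-/
lemma integral_fderiv_mul_add {q θ : Eu d → ℝ} {K L : ℝ≥0} (hq : LipschitzWith K q)
    (hqc : HasCompactSupport q) (hθ : LipschitzWith L θ) (e : Eu d) :
    ∫ x, (θ x * fderiv ℝ q x e + q x * fderiv ℝ θ x e) = 0 := by
  rw [integral_add (integrable_fderiv_mul hq hqc hθ.continuous e)
    (integrable_mul_fderiv hθ hqc hq.continuous e)]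
  have h := LipschitzWith.integral_lineDeriv_mul_eq (μ := volume) hθ hq hqc e
  have h1 : ∫ x, lineDeriv ℝ θ x e * q x = ∫ x, q x * fderiv ℝ θ x e := by
    refine integral_congr_ae ?_
    filter_upwards [hθ.ae_differentiableAt] with x hx
    rw [hx.lineDeriv_eq_fderiv, mul_comm]
  have h2 : ∫ x, lineDeriv ℝ q x (-e) * θ x = -∫ x, θ x * fderiv ℝ q x e := by
    rw [← integral_neg]
    refine integral_congr_ae ?_
    filter_upwards [hq.ae_differentiableAt] with x hx
    rw [hx.lineDeriv_eq_fderiv, map_neg, mul_comm, mul_neg]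
  rw [← h1, h, h2, add_neg_cancel]

/-- The divergence theorem for compactly supported Lipschitz functions. -/
lemma integral_fderiv_add_mul_div {q : Eu d → ℝ} {B : Eu d → Eu d} {K L : ℝ≥0}
    (hq : LipschitzWith K q) (hqc : HasCompactSupport q) (hqs : tsupport q ⊆ Ω)
    (hB : LipschitzWith L B) :
    ∫ x in Ω, (fderiv ℝ q x (B x) + q x * trL (fderiv ℝ B x)) = 0 := by
  rw [setIntegral_eq_integral_of_forall_compl_eq_zero fun x hx => by
    have : x ∉ tsupport q := fun h => hx (hqs h)
    simp [fderiv_eq_zero_of_notMem_tsupport this, image_eq_zero_of_notMem_tsupport this]]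
  have hBi : ∀ i, LipschitzWith L fun x => B x i := fun i => LipschitzWith.of_dist_le_mul fun x y =>
    ((EuclideanSpace.proj i : Eu d →L[ℝ] ℝ).lipschitz.dist_le_mul _ _).trans (by
      have h1 : ‖(EuclideanSpace.proj i : Eu d →L[ℝ] ℝ)‖ ≤ 1 :=
        ContinuousLinearMap.opNorm_le_bound _ zero_le_one fun x => by
          simpa using PiLp.norm_apply_le x i
      calc _ ≤ 1 * dist (B x) (B y) := by gcongr; exact h1
        _ ≤ _ := by rw [one_mul]; exact hB.dist_le_mul x y)
  have h : ∀ᵐ x, fderiv ℝ q x (B x) + q x * trL (fderiv ℝ B x)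
      = ∑ i, (B x i * fderiv ℝ q x (basisVec i)
        + q x * fderiv ℝ (fun y => B y i) x (basisVec i)) := by
    filter_upwards [hB.ae_differentiableAt] with x hx
    rw [Finset.sum_add_distrib, ← clm_eq_sum, trL, Finset.mul_sum]
    congr 1
    refine Finset.sum_congr rfl fun i _ => ?_
    have : HasFDerivAt (fun y => B y i) ((EuclideanSpace.proj i : Eu d →L[ℝ] ℝ) ∘L fderiv ℝ B x) x :=
      (EuclideanSpace.proj i : Eu d →L[ℝ] ℝ).hasFDerivAt.comp x hx.hasFDerivAt
    rw [this.fderiv]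
    simp
  rw [integral_congr_ae h, integral_finsetSum]
  · exact Finset.sum_eq_zero fun i _ => integral_fderiv_mul_add hq hqc (hBi i) _
  · exact fun i _ => (integrable_fderiv_mul hq hqc (hBi i).continuous _).add
      (integrable_mul_fderiv (hBi i) hqc hq.continuous _)

/-- The vector field `u ∈ L²(Ω)` has the divergence `τ ∈ L²(Ω)`, tested with Lipschitz functions. -/
structure HasLipDiv (Ω : Set (Eu d)) (u : Eu d → Eu d) (τ : Eu d → ℝ) : Prop where
  memLp : MemLp u 2 (volume.restrict Ω)
  memLp_div : MemLp τ 2 (volume.restrict Ω)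
  eq_zero : ∀ (q : Eu d → ℝ) (K : ℝ≥0), LipschitzWith K q → HasCompactSupport q → tsupport q ⊆ Ω →
    ∫ x in Ω, (fderiv ℝ q x (u x) + q x * τ x) = 0

lemma abs_trL_le (L : Eu d →L[ℝ] Eu d) : |trL L| ≤ ‖trCLM d‖ * ‖L‖ := by
  rw [← trCLM_apply]
  exact (trCLM d).le_opNorm L

/-- The boundary values of the field do not matter, since the functions it is tested with have
compact support in `Ω`. -/
lemma LipschitzWith.hasLipDiv [IsFiniteMeasure (volume.restrict Ω)] (hΩb : Bornology.IsBounded Ω)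
    (hΩm : MeasurableSet Ω)
    {B : Eu d → Eu d} {L : ℝ≥0} (hB : LipschitzWith L B) :
    HasLipDiv Ω B fun x => trL (fderiv ℝ B x) where
  memLp := by
    obtain ⟨C, hC⟩ := (hB.isBounded_image hΩb).exists_norm_le
    refine MemLp.of_bound hB.continuous.aestronglyMeasurable C ?_
    filter_upwards [ae_restrict_mem hΩm] with x hx
    exact hC _ (mem_image_of_mem B hx)
  memLp_div := by
    refine MemLp.of_bound (C := ‖trCLM d‖ * L) ?_ (.of_forall fun x => ?_)
    · simp only [← trCLM_apply]
      exact ((trCLM d).continuous.measurable.comp (measurable_fderiv ℝ B)).aestronglyMeasurable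
    · refine (abs_trL_le _).trans ?_
      gcongr
      exact norm_fderiv_le_of_lipschitz ℝ hB
  eq_zero q K hq hqc hqs := integral_fderiv_add_mul_div hq hqc hqs hB

lemma memLp_fderiv_of_lipschitz [IsFiniteMeasure (volume.restrict Ω)] {q : Eu d → ℝ} {K : ℝ≥0}
    (hq : LipschitzWith K q) (r : ℝ≥0∞) : MemLp (fderiv ℝ q) r (volume.restrict Ω) :=
  MemLp.of_bound (measurable_fderiv ℝ q).aestronglyMeasurable K
    (.of_forall fun _ => norm_fderiv_le_of_lipschitz ℝ hq)

/-- The weak differential of a weakly divergence free field is trace free. -/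
lemma IsWeaklyDivFree.trL_eq_zero (hΩ : IsOpen Ω) {u : Eu d → Eu d} {g : Eu d → Eu d →L[ℝ] Eu d}
    (hu : IsWeaklyDivFree Ω u) (hg : HasWeakFDeriv Ω u g) :
    ∀ᵐ x ∂volume.restrict Ω, trL (g x) = 0 := by
  rw [ae_restrict_iff' hΩ.measurableSet]
  have hloc : LocallyIntegrableOn (fun x => trL (g x)) Ω volume := fun x hx => by
    obtain ⟨U, hU, hi⟩ := hg.2.1 x hx
    refine ⟨U, hU, ?_⟩
    simp only [← trCLM_apply]
    exact (trCLM d).integrable_comp hi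
  refine hΩ.ae_eq_zero_of_integral_contDiff_smul_eq_zero hloc fun η hη hc hs => ?_
  rw [← setIntegral_eq_integral_of_forall_compl_eq_zero (s := Ω) fun x hx => by
    simp [image_eq_zero_of_notMem_tsupport fun h => hx (hs h)]]
  -- The `i`-th component of the weak derivative identity in direction `i`. Summed over `i`, the
  -- left sides give the distributional divergence of `u` and the right sides the trace of `g`.
  have hi : ∀ i : Fin d, ∫ x in Ω, u x i * fderiv ℝ η x (basisVec i)
      = -∫ x in Ω, η x * (g x (basisVec i)) i := fun i => by
    have h := congrArg (EuclideanSpace.proj i : Eu d →L[ℝ] ℝ)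
      (hg.2.2 η ⟨hη, hc, hs⟩ (basisVec i))
    rw [map_neg, ← ContinuousLinearMap.integral_comp_comm,
      ← ContinuousLinearMap.integral_comp_comm] at h
    · simpa [mul_comm] using h
    · have := integrable_smul_of_locallyIntegrableOn (f := fun x => g x (basisVec i)) (Ω := Ω)
        (fun x hx => by
          obtain ⟨U, hU, hi⟩ := hg.2.1 x hx
          exact ⟨U, hU, (ContinuousLinearMap.apply ℝ (Eu d) (basisVec i)).integrable_comp hi⟩)
        hη.continuous hc hs
      exact this.integrableOn
    · exact (integrable_smul_of_locallyIntegrableOn hg.1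
        ((hη.continuous_fderiv (by simp)).clm_apply continuous_const)
        (hc.fderiv_apply ℝ (basisVec i))
        ((tsupport_fderiv_apply_subset ℝ (basisVec i)).trans hs)).integrableOn
  have hI₁ : ∀ i : Fin d, IntegrableOn (fun x => u x i * fderiv ℝ η x (basisVec i)) Ω := fun i => by
    have := (EuclideanSpace.proj i : Eu d →L[ℝ] ℝ).integrable_comp
      (integrable_smul_of_locallyIntegrableOn hg.1
        ((hη.continuous_fderiv (by simp)).clm_apply continuous_const)
        (hc.fderiv_apply ℝ (basisVec i))
        ((tsupport_fderiv_apply_subset ℝ (basisVec i)).trans hs))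
    refine (this.congr (.of_forall fun x => ?_)).integrableOn
    simp [mul_comm]
  have hI₂ : ∀ i : Fin d, IntegrableOn (fun x => η x * (g x (basisVec i)) i) Ω := fun i => by
    have := ((EuclideanSpace.proj i : Eu d →L[ℝ] ℝ) ∘L
      ContinuousLinearMap.apply ℝ (Eu d) (basisVec i)).integrable_comp
      (integrable_smul_of_locallyIntegrableOn hg.2.1 hη.continuous hc hs)
    refine (this.congr (.of_forall fun x => ?_)).integrableOn
    simp
  have h0 := hu η ⟨hη, hc, hs⟩
  have hsum : ∀ x, fderiv ℝ η x (u x) = ∑ i, u x i * fderiv ℝ η x (basisVec i) :=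
    fun x => clm_eq_sum _ _
  simp only [hsum] at h0
  rw [integral_finsetSum _ fun i _ => hI₁ i, Finset.sum_congr rfl fun i _ => hi i,
    Finset.sum_neg_distrib, neg_eq_zero, ← integral_finsetSum _ fun i _ => hI₂ i] at h0
  simpa [trL, Finset.mul_sum] using h0

/-- A weakly divergence free field in `H¹₀(Ω)` has divergence zero, tested with Lipschitz
functions. -/
lemma IsWeaklyDivFree.hasLipDiv [IsFiniteMeasure (volume.restrict Ω)] (hΩ : IsOpen Ω)
    {u : Eu d → Eu d} (hu : IsWeaklyDivFree Ω u) (hu0 : MemH10 Ω u) :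
    HasLipDiv Ω u fun _ => 0 where
  memLp := hu0.1
  memLp_div := MemLp.zero
  eq_zero q K hq hqc hqs := by
    -- The distributional condition admits only smooth test functions. Moving the approximation from
    -- `q` to `u` avoids this: each `p k` is Lipschitz, so the divergence theorem holds for it with
    -- the Lipschitz `q`, and in the limit the trace term disappears.
    obtain ⟨g, p, hg, hp⟩ := hu0.exists_isC1Approx
    have htr := hu.trL_eq_zero hΩ hg
    have hq2 : MemLp q 2 (volume.restrict Ω) := hq.continuous.memLp_of_hasCompactSupport hqc
    have hDq := memLp_fderiv_of_lipschitz (Ω := Ω) hq 2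
    have t1 := tendsto_integral_bilin (ContinuousLinearMap.id ℝ (Eu d →L[ℝ] ℝ)) hDq hp.memLp
      (fun k => hp.memLp_apply k _) hp.tendsto
    have t2 := tendsto_integral_bilin ((ContinuousLinearMap.id ℝ ℝ).smulRight (trCLM d)) hq2
      hp.memLp_deriv (fun k => hp.memLp_fderiv k _) hp.tendsto_deriv
    have i1 := fun k => integrable_bilin (ContinuousLinearMap.id ℝ (Eu d →L[ℝ] ℝ)) hDq
      (hp.memLp_apply k (volume.restrict Ω))
    have i2 := fun k => integrable_bilin ((ContinuousLinearMap.id ℝ ℝ).smulRight (trCLM d)) hq2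
      (hp.memLp_fderiv k (volume.restrict Ω))
    simp only [ContinuousLinearMap.smulRight_apply, ContinuousLinearMap.id_apply,
      _root_.smul_apply, smul_eq_mul, trCLM_apply] at t1 t2 i1 i2
    have h0 : ∫ x in Ω, q x * trL (g x) = 0 := by
      rw [integral_congr_ae (g := fun _ => (0 : ℝ)) (by
        filter_upwards [htr] with x hx
        rw [hx, mul_zero]), integral_zero]
    have t3 := t1.add t2
    rw [h0, add_zero] at t3
    simp only [mul_zero, add_zero]
    refine tendsto_nhds_unique t3 (tendsto_const_nhds.congr fun k => ?_)
    rw [← integral_add (i1 k) (i2 k)]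
    obtain ⟨L, hL⟩ := (hp.contDiff k).lipschitzWith_of_hasCompactSupport (hp.compact k) one_ne_zero
    exact (integral_fderiv_add_mul_div hq hqc hqs hL).symm

end

end NSAC

/-! ### Integration by parts against weights and phase indicators -/

namespace NSAC

section

variable {d : ℕ} {Ω : Set (Eu d)}

lemma HasCompactSupport.exists_abs_le {X : Type*} [TopologicalSpace X] {p : X → ℝ}
    (hc : HasCompactSupport p) (hp : Continuous p) : ∃ C, ∀ x, |p x| ≤ C := by
  obtain ⟨C, hC⟩ := hc.exists_bound_of_continuous hp
  exact ⟨C, hC⟩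

lemma exists_cutoff (hΩ : IsOpen Ω) {K : Set (Eu d)} (hK : IsCompact K) (hKΩ : K ⊆ Ω) :
    ∃ ζ : Eu d → ℝ, ContDiff ℝ 1 ζ ∧ HasCompactSupport ζ ∧ tsupport ζ ⊆ Ω ∧ ∀ x ∈ K, ζ x = 1 := by
  obtain ⟨K', hK', hKK', hK'Ω⟩ := exists_compact_between hK hΩ hKΩ
  obtain ⟨ζ, hζ, -, hs, h1⟩ := exists_contMDiff_support_eq_eq_one_iff
    (modelWithCornersSelf ℝ (Eu d)) (n := 1) isOpen_interior hK.isClosed hKK'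
  have hsub : tsupport ζ ⊆ K' := by
    rw [tsupport, hs]
    exact closure_minimal interior_subset hK'.isClosed
  exact ⟨ζ, contMDiff_iff_contDiff.1 hζ, hK'.of_isClosed_subset (isClosed_tsupport ζ) hsub,
    hsub.trans hK'Ω, fun x hx => (h1 x).1 hx⟩

lemma memLp_fderiv_apply_lipschitz {θ : Eu d → ℝ} {L : ℝ≥0} (hθ : LipschitzWith L θ)
    {u : Eu d → Eu d} (hu : MemLp u 2 (volume.restrict Ω)) :
    MemLp (fun x => fderiv ℝ θ x (u x)) 2 (volume.restrict Ω) := by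
  have hm : AEStronglyMeasurable (fun x => fderiv ℝ θ x (u x)) (volume.restrict Ω) :=
    (ContinuousLinearMap.id ℝ (Eu d →L[ℝ] ℝ)).aestronglyMeasurable_comp₂
      (measurable_fderiv ℝ θ).aestronglyMeasurable hu.1
  refine hu.of_le_mul (c := L) hm (.of_forall fun x => ?_)
  exact (ContinuousLinearMap.le_opNorm _ _).trans
    (mul_le_mul_of_nonneg_right (norm_fderiv_le_of_lipschitz ℝ hθ) (norm_nonneg _))

lemma memLp_bounded_smul {E : Type*} [NormedAddCommGroup E] [NormedSpace ℝ E] {α : Type*}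
    [MeasurableSpace α] {μ : Measure α} {θ : α → ℝ} {u : α → E} {C : ℝ}
    (hθ : AEStronglyMeasurable θ μ) (hC : ∀ᵐ x ∂μ, |θ x| ≤ C) (hu : MemLp u 2 μ) :
    MemLp (fun x => θ x • u x) 2 μ := by
  refine hu.of_le_mul (c := C) (hθ.smul hu.1) ?_
  filter_upwards [hC] with x hx
  rw [norm_smul]
  exact mul_le_mul_of_nonneg_right hx (norm_nonneg _)

namespace HasLipDiv

variable {u : Eu d → Eu d} {τ : Eu d → ℝ}

lemma sub {u' : Eu d → Eu d} {τ' : Eu d → ℝ} [IsFiniteMeasure (volume.restrict Ω)]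
    (h : HasLipDiv Ω u τ) (h' : HasLipDiv Ω u' τ') :
    HasLipDiv Ω (fun x => u x - u' x) (fun x => τ x - τ' x) where
  memLp := h.memLp.sub h'.memLp
  memLp_div := h.memLp_div.sub h'.memLp_div
  eq_zero q K hq hqc hqs := by
    have hq2 : MemLp q 2 (volume.restrict Ω) := hq.continuous.memLp_of_hasCompactSupport hqc
    have hi : ∀ {u : Eu d → Eu d} {τ : Eu d → ℝ}, HasLipDiv Ω u τ →
        Integrable (fun x => fderiv ℝ q x (u x) + q x * τ x) (volume.restrict Ω) := fun h =>
      ((memLp_fderiv_apply_lipschitz hq h.memLp).integrable one_le_two).add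
        (integrable_bilin (ContinuousLinearMap.mul ℝ ℝ) hq2 h.memLp_div)
    have hsub := integral_sub (hi h) (hi h')
    rw [h.eq_zero q K hq hqc hqs, h'.eq_zero q K hq hqc hqs, sub_zero] at hsub
    rw [← hsub]
    refine integral_congr_ae (.of_forall fun x => ?_)
    simp only [map_sub]
    ring

/-- Integration by parts against the product of a function in `H¹₀(Ω)` and a Lipschitz function. -/
lemma integral_approx [IsFiniteMeasure (volume.restrict Ω)] (h : HasLipDiv Ω u τ) {f : Eu d → ℝ}
    {g : Eu d → Eu d →L[ℝ] ℝ} {p : ℕ → Eu d → ℝ} (hp : IsC1Approx Ω f g p) {θ : Eu d → ℝ} {L : ℝ≥0}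
    {C : ℝ} (hθ : LipschitzWith L θ) (hC : ∀ x, |θ x| ≤ C) :
    IntegrableOn (fun x => f x * (fderiv ℝ θ x (u x) + θ x * τ x)) Ω ∧
    IntegrableOn (fun x => θ x * g x (u x)) Ω ∧
    (∫ x in Ω, f x * (fderiv ℝ θ x (u x) + θ x * τ x)) + ∫ x in Ω, θ x * g x (u x) = 0 := by
  have hθm : AEStronglyMeasurable θ (volume.restrict Ω) := hθ.continuous.aestronglyMeasurable
  have m1 : MemLp (fun x => fderiv ℝ θ x (u x) + θ x * τ x) 2 (volume.restrict Ω) :=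
    (memLp_fderiv_apply_lipschitz hθ h.memLp).add
      (memLp_bounded_smul hθm (.of_forall hC) h.memLp_div)
  have m2 : MemLp (fun x => θ x • u x) 2 (volume.restrict Ω) :=
    memLp_bounded_smul hθm (.of_forall hC) h.memLp
  have t1 := tendsto_integral_bilin (ContinuousLinearMap.mul ℝ ℝ) m1 hp.memLp
    (fun k => hp.memLp_apply k _) hp.tendsto
  have t2 := tendsto_integral_bilin (ContinuousLinearMap.apply ℝ ℝ) m2
    hp.memLp_deriv (fun k => hp.memLp_fderiv k _) hp.tendsto_deriv
  have i1 := integrable_bilin (ContinuousLinearMap.mul ℝ ℝ) m1 hp.memLp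
  have i2 := integrable_bilin (ContinuousLinearMap.apply ℝ ℝ) m2 hp.memLp_deriv
  have j1 := fun k => integrable_bilin (ContinuousLinearMap.mul ℝ ℝ) m1
    (hp.memLp_apply k (volume.restrict Ω))
  have j2 := fun k => integrable_bilin (ContinuousLinearMap.apply ℝ ℝ) m2
    (hp.memLp_fderiv k (volume.restrict Ω))
  have happ : ∀ (L : Eu d →L[ℝ] ℝ) (x : Eu d),
      ContinuousLinearMap.apply ℝ ℝ (θ x • u x) L = θ x * L (u x) := fun L x => by simp
  simp only [ContinuousLinearMap.mul_apply', happ] at t1 t2 i1 i2 j1 j2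
  refine ⟨by simpa only [IntegrableOn, mul_comm] using i1, i2, ?_⟩
  have t3 := t1.add t2
  simp only [mul_comm (f _)]
  refine tendsto_nhds_unique t3 (tendsto_const_nhds.congr fun k => ?_)
  rw [← integral_add (j1 k) (j2 k)]
  have hpc := hp.compact k
  obtain ⟨M, hM⟩ := (hp.contDiff k).lipschitzWith_of_hasCompactSupport hpc one_ne_zero
  obtain ⟨D, hD⟩ := HasCompactSupport.exists_abs_le hpc hM.continuous
  -- For each approximant `p k`, the product `p k · θ` is an admissible Lipschitz test function, its
  -- support being inherited from `p k`. Its product rule holds only a.e., where `θ` is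
  -- differentiable.
  obtain ⟨N, hN⟩ := LipschitzWith.mul_of_bounded hM hθ hD hC
  rw [← h.eq_zero _ N hN hpc.mul_right (tsupport_mul_subset_left.trans (hp.support k))]
  refine integral_congr_ae ?_
  filter_upwards [ae_restrict_of_ae hθ.ae_differentiableAt] with x hx
  have hd : HasFDerivAt (fun x => p k x * θ x) _ x :=
    ((hp.contDiff k).differentiable one_ne_zero x).hasFDerivAt.mul hx.hasFDerivAt
  rw [hd.fderiv]
  simp only [_root_.add_apply, _root_.smul_apply, smul_eq_mul]
  ring

/-- Integration by parts against a Lipschitz function that vanishes near the boundary. -/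
lemma integral_of_vanish (h : HasLipDiv Ω u τ) (hΩ : IsOpen Ω) {m : Eu d → ℝ} {L : ℝ≥0}
    {C : ℝ} (hm : LipschitzWith L m) (hC : ∀ x, |m x| ≤ C) {K : Set (Eu d)} (hK : IsCompact K)
    (hKΩ : K ⊆ Ω) (h0 : ∀ x ∈ Ω \ K, m x = 0) :
    ∫ x in Ω, (fderiv ℝ m x (u x) + m x * τ x) = 0 := by
  -- Nothing is known about `m` outside `Ω`. Multiplying by a cutoff that is `1` on `K` leaves `m`
  -- unchanged in `Ω` and makes it an admissible test function.
  obtain ⟨ζ, hζ, hζc, hζΩ, hζ1⟩ := exists_cutoff hΩ hK hKΩ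
  obtain ⟨M, hM⟩ := hζ.lipschitzWith_of_hasCompactSupport hζc one_ne_zero
  obtain ⟨D, hD⟩ := HasCompactSupport.exists_abs_le hζc hM.continuous
  obtain ⟨N, hN⟩ := LipschitzWith.mul_of_bounded hM hm hD hC
  rw [← h.eq_zero _ N hN hζc.mul_right (tsupport_mul_subset_left.trans hζΩ)]
  have heq : ∀ x ∈ Ω, ζ x * m x = m x := fun x hx => by
    by_cases hxK : x ∈ K
    · rw [hζ1 x hxK, one_mul]
    · rw [h0 x ⟨hx, hxK⟩, mul_zero]
  refine setIntegral_congr_fun hΩ.measurableSet fun x hx => ?_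
  have he : (fun x => ζ x * m x) =ᶠ[𝓝 x] m := by
    filter_upwards [hΩ.mem_nhds hx] with y hy using heq y hy
  simp only [he.fderiv_eq, heq x hx]

/-- Integration by parts for the product of a Lipschitz weight `θ` and the difference of a function
in `H¹₀(Ω)` and a multiple of the indicator of `{θ < 0}`. -/
lemma integral_sub_indicator [IsFiniteMeasure (volume.restrict Ω)] (h : HasLipDiv Ω u τ)
    (hΩ : IsOpen Ω) {f : Eu d → ℝ} {g : Eu d → Eu d →L[ℝ] ℝ} {p : ℕ → Eu d → ℝ}
    (hp : IsC1Approx Ω f g p) {θ χ : Eu d → ℝ} {L : ℝ≥0} {C : ℝ} (hθ : LipschitzWith L θ)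
    (hC : ∀ x, |θ x| ≤ C)
    (hχ : ∀ᵐ x ∂volume.restrict Ω, (χ x = 1 ∧ θ x < 0) ∨ (χ x = 0 ∧ 0 < θ x))
    {K : Set (Eu d)} (hK : IsCompact K) (hKΩ : K ⊆ Ω) (h0 : ∀ x ∈ Ω \ K, 0 ≤ θ x) (c : ℝ) :
    IntegrableOn (fun x => (f x - c * χ x) * (fderiv ℝ θ x (u x) + θ x * τ x)
      + θ x * g x (u x)) Ω ∧
    ∫ x in Ω, ((f x - c * χ x) * (fderiv ℝ θ x (u x) + θ x * τ x) + θ x * g x (u x)) = 0 := by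
  obtain ⟨i1, i2, hz⟩ := h.integral_approx hp hθ hC
  -- `χθ` is replaced by the Lipschitz function `min(θ, 0)`, which vanishes on `Ω` off `K`. The
  -- discontinuity of `χ` is thereby invisible to the integration by parts.
  have hm : LipschitzWith L fun x => min (θ x) 0 := hθ.min_const 0
  have hmC : ∀ x, |min (θ x) 0| ≤ C := fun x => by
    refine le_trans ?_ (hC x)
    rcases le_total (θ x) 0 with hx | hx
    · rw [min_eq_left hx]
    · rw [min_eq_right hx, abs_zero]
      exact abs_nonneg _
  have hmi : IntegrableOn (fun x => fderiv ℝ (fun y => min (θ y) 0) x (u x)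
      + min (θ x) 0 * τ x) Ω :=
    ((memLp_fderiv_apply_lipschitz hm h.memLp).integrable one_le_two).add
      ((memLp_bounded_smul hm.continuous.aestronglyMeasurable (.of_forall hmC)
        h.memLp_div).integrable one_le_two)
  have hmz := h.integral_of_vanish hΩ hm hmC hK hKΩ fun x hx => min_eq_right (h0 x hx)
  have hae : (fun x => f x * (fderiv ℝ θ x (u x) + θ x * τ x) + θ x * g x (u x)
      - c * (fderiv ℝ (fun y => min (θ y) 0) x (u x) + min (θ x) 0 * τ x))
      =ᵐ[volume.restrict Ω]
      fun x => (f x - c * χ x) * (fderiv ℝ θ x (u x) + θ x * τ x) + θ x * g x (u x) := by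
    -- Where `θ < 0` the truncation equals `θ` near `x`, and where `θ > 0` it is `0` near `x`; `hχ`
    -- makes `{θ = 0}` a null set, so the kink is never met.
    filter_upwards [hχ] with x hx
    rcases hx with ⟨h1, hx⟩ | ⟨h1, hx⟩
    · have he : (fun y => min (θ y) 0) =ᶠ[𝓝 x] θ := by
        filter_upwards [hθ.continuous.continuousAt.eventually_lt continuousAt_const hx] with y hy
        exact min_eq_left hy.le
      rw [he.fderiv_eq, h1, min_eq_left hx.le]
      ring
    · have he : (fun y => min (θ y) 0) =ᶠ[𝓝 x] fun _ => 0 := by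
        filter_upwards [continuousAt_const.eventually_lt hθ.continuous.continuousAt hx] with y hy
        exact min_eq_right hy.le
      rw [he.fderiv_eq, h1, min_eq_right hx.le]
      simp
  have hint := (i1.add i2).sub (hmi.const_mul c)
  refine ⟨hint.congr hae, ?_⟩
  have hsub := integral_sub (i1.add i2) (hmi.const_mul c)
  rw [integral_const_mul, hmz, mul_zero, sub_zero] at hsub
  exact (integral_congr_ae hae).symm.trans (hsub.trans ((integral_add i1 i2).trans hz))

end HasLipDiv

end

end NSAC

namespace NSAC

/-! ## Measurability of differentials depending on a parameter -/

/-- For a measurable family of uniformly Lipschitz functions, the differential is jointly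
measurable. -/
lemma measurable_fderiv_of_lipschitz_family {α E F : Type*} [MeasurableSpace α]
    [NormedAddCommGroup E] [NormedSpace ℝ E] [LocallyCompactSpace E] [MeasurableSpace E]
    [OpensMeasurableSpace E] [NormedAddCommGroup F] [NormedSpace ℝ F] [CompleteSpace F]
    [SecondCountableTopology F] [MeasurableSpace F] [BorelSpace F] {b : α → E → F} {z : ℕ → E}
    {K : ℝ≥0} (hz : DenseRange z) (hb : ∀ k, Measurable fun t => b t (z k))
    (hL : ∀ t, LipschitzWith K (b t)) :
    MeasurableSet {p : α × E | DifferentiableAt ℝ (b p.1) p.2} ∧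
      Measurable fun p : α × E => fderiv ℝ (b p.1) p.2 := by
  -- The parameter space carries only a σ-algebra. It is given the topology induced by the values of
  -- `b` at the dense points: its open sets are measurable, and uniform Lipschitz continuity makes
  -- `b` jointly continuous. Measurability of differentials of continuous families then applies.
  let _ : TopologicalSpace α := TopologicalSpace.induced (fun t k => b t (z k)) inferInstance
  have hΦ : Continuous fun t k => b t (z k) := continuous_induced_dom
  have : OpensMeasurableSpace α := ⟨MeasurableSpace.generateFrom_le fun U hU => by
    obtain ⟨V, hV, rfl⟩ := hU
    exact measurable_pi_lambda _ hb hV.measurableSet⟩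
  have hcont : Continuous (Function.uncurry b) := by
    rw [continuous_iff_continuousAt]
    rintro ⟨t₀, x₀⟩
    rw [Metric.continuousAt_iff']
    intro ε hε
    -- The path passes through the dense point `z k`: two increments in space cost at most `2Kδ <
    -- ε/3` and `Kδ < ε/6`, and the change of the parameter at `z k` costs less than `ε/2`.
    obtain ⟨δ, hδ, hKδ⟩ : ∃ δ > 0, K * δ < ε / 6 := by
      refine ⟨ε / 6 / (K + 1), by positivity, ?_⟩
      rw [mul_div_assoc', div_lt_iff₀ (by positivity)]
      nlinarith [K.coe_nonneg]
    obtain ⟨k, hk⟩ := hz.exists_dist_lt x₀ hδ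
    have h1 : ∀ᶠ p : α × E in 𝓝 (t₀, x₀), dist (b p.1 (z k)) (b t₀ (z k)) < ε / 2 :=
      Metric.continuousAt_iff'.1
        (((continuous_apply k).comp (hΦ.comp continuous_fst)).continuousAt (x := (t₀, x₀)))
        _ (by positivity)
    have h2 : ∀ᶠ p : α × E in 𝓝 (t₀, x₀), dist p.2 x₀ < δ :=
      Metric.continuousAt_iff'.1 (continuous_snd.continuousAt (x := (t₀, x₀))) _ hδ
    filter_upwards [h1, h2] with p hp1 hp2
    have e1 : dist (b p.1 p.2) (b p.1 (z k)) ≤ K * (δ + δ) := by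
      refine ((hL p.1).dist_le_mul _ _).trans ?_
      gcongr
      exact (dist_triangle _ x₀ _).trans (add_le_add hp2.le hk.le)
    have e2 : dist (b t₀ (z k)) (b t₀ x₀) ≤ K * δ := by
      refine ((hL t₀).dist_le_mul _ _).trans ?_
      gcongr
      rw [dist_comm]
      exact hk.le
    calc dist (b p.1 p.2) (b t₀ x₀)
        ≤ dist (b p.1 p.2) (b p.1 (z k)) + dist (b p.1 (z k)) (b t₀ (z k))
          + dist (b t₀ (z k)) (b t₀ x₀) := dist_triangle4 _ _ _ _
      _ < ε := by linarith
  exact ⟨measurableSet_of_differentiableAt_with_param ℝ hcont,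
    measurable_fderiv_with_param ℝ hcont⟩

section

variable {d : ℕ} {Ω : Set (Eu d)}

lemma cyl_eq_prod (Ω : Set (Eu d)) (T : ℝ) :
    cyl Ω T = (volume.restrict (Ioo 0 T)).prod (volume.restrict Ω) := by
  rw [cyl, Measure.volume_eq_prod, Measure.prod_restrict]

lemma ae_cyl_of_ae_time {T : ℝ} {P : ℝ → Prop} (h : ∀ᵐ t ∂volume.restrict (Ioo 0 T), P t) :
    ∀ᵐ p ∂cyl Ω T, P p.1 := by
  rw [cyl_eq_prod]
  exact Measure.quasiMeasurePreserving_fst.ae h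

lemma ae_cyl_mem {T : ℝ} (hΩ : MeasurableSet Ω) : ∀ᵐ p ∂cyl Ω T, p.1 ∈ Ioo 0 T ∧ p.2 ∈ Ω := by
  filter_upwards [ae_restrict_mem (measurableSet_Ioo.prod hΩ)] with p hp
  exact hp

lemma C01Bound.lipschitzOnWith {F : Type*} [NormedAddCommGroup F] {C : ℝ} {K : Set (Eu d)}
    {f : Eu d → F} (h : C01Bound C K f) : LipschitzOnWith C.toNNReal f K :=
  LipschitzOnWith.of_dist_le' fun x hx y hy => by
    rw [dist_eq_norm, dist_eq_norm]
    exact h.2 x hx y hy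

lemma C01Bound.norm_fderiv_le {F : Type*} [NormedAddCommGroup F] [NormedSpace ℝ F] {C : ℝ}
    {f : Eu d → F} (hΩ : IsOpen Ω) (h : C01Bound C Ω f) {x : Eu d} (hx : x ∈ Ω) :
    ‖fderiv ℝ f x‖ ≤ C := by
  have hC : 0 ≤ C := (norm_nonneg _).trans (h.1 x hx)
  have := norm_fderiv_le_of_lipschitzOn ℝ (hΩ.mem_nhds hx) h.lipschitzOnWith
  rwa [Real.coe_toNNReal _ hC] at this

/-- A function on the cylinder that is continuous in space is measurable in time at every point. -/
lemma aestronglyMeasurable_section {F : Type*} [NormedAddCommGroup F]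
    (hΩ : IsOpen Ω) {T : ℝ} {B : ℝ → Eu d → F}
    (hB : AEStronglyMeasurable (Function.uncurry B) (cyl Ω T))
    (hc : ∀ᵐ t ∂volume.restrict (Ioo 0 T), ContinuousOn (B t) Ω) {x : Eu d} (hx : x ∈ Ω) :
    AEStronglyMeasurable (fun t => B t x) (volume.restrict (Ioo 0 T)) := by
  rw [cyl_eq_prod] at hB
  have h1 := hB.prod_swap.prodMk_left
  rw [ae_restrict_iff' hΩ.measurableSet] at h1
  -- Fubini gives measurable sections only for a.e. point; such points are dense in `Ω`, and
  -- continuity in space transfers measurability to `x`.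
  have h2 := (Measure.dense_of_ae h1).open_subset_closure_inter hΩ hx
  obtain ⟨y, hy, hyx⟩ := mem_closure_iff_seq_limit.1 h2
  refine aestronglyMeasurable_of_tendsto_ae atTop (f := fun n t => B t (y n))
    (fun n => (hy n).2 (hy n).1) ?_
  filter_upwards [hc] with t ht
  exact (ht x hx).tendsto.comp (tendsto_nhdsWithin_iff.2 ⟨hyx, .of_forall fun n => (hy n).1⟩)

/-- The differential in space of a measurable family of uniformly Lipschitz vector fields. -/
lemma aestronglyMeasurable_fderiv_of_C01 (hΩ : IsOpen Ω) (hΩb : Bornology.IsBounded Ω) {T C : ℝ}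
    {B : ℝ → Eu d → Eu d} (hB : AEStronglyMeasurable (Function.uncurry B) (cyl Ω T))
    (hC : ∀ᵐ t ∂volume.restrict (Ioo 0 T), C01Bound C Ω (B t)) :
    AEStronglyMeasurable (fun p : ℝ × Eu d => fderiv ℝ (B p.1) p.2) (cyl Ω T) := by
  -- `p` is positive exactly on `Ω`. Then `p B` extended by zero is globally Lipschitz with a
  -- constant independent of time, and in `Ω` one recovers `B` by dividing by `p`.
  obtain ⟨p, hps, hpd, hpr⟩ := hΩ.exists_contDiff_support_eq (n := 1)
  have hp1 : ∀ x, |p x| ≤ 1 := fun x => by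
    have := hpr (mem_range_self x)
    rw [abs_of_nonneg this.1]
    exact this.2
  have hp0 : ∀ x ∉ Ω, p x = 0 := fun x hx => by
    rw [← hps] at hx
    exact Function.notMem_support.1 hx
  have hpΩ : ∀ x ∈ Ω, p x ≠ 0 := fun x hx => by
    rwa [← hps] at hx
  have hpc : HasCompactSupport p := by
    rw [HasCompactSupport, tsupport, hps]
    exact hΩb.isCompact_closure
  obtain ⟨N, hN⟩ := hpd.lipschitzWith_of_hasCompactSupport hpc one_ne_zero
  set z : ℕ → Eu d := TopologicalSpace.denseSeq (Eu d)
  have hsec : ∀ k, z k ∈ Ω → AEStronglyMeasurable (fun t => B t (z k))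
      (volume.restrict (Ioo 0 T)) := fun k hk =>
    aestronglyMeasurable_section hΩ hB (hC.mono fun t ht => ht.lipschitzOnWith.continuousOn) hk
  have hex : ∀ k, ∃ β : ℝ → Eu d, Measurable β ∧
      ∀ᵐ t ∂volume.restrict (Ioo 0 T), p (z k) • B t (z k) = β t := fun k => by
    by_cases hk : z k ∈ Ω
    · exact ⟨_, ((hsec k hk).const_smul (p (z k))).stronglyMeasurable_mk.measurable,
        ((hsec k hk).const_smul (p (z k))).ae_eq_mk⟩
    · exact ⟨0, measurable_zero, .of_forall fun t => by simp [hp0 _ hk]⟩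
  choose β hβ hβeq using hex
  obtain ⟨S, hS, hSm, hSP⟩ := (hC.and (ae_all_iff.2 hβeq)).exists_measurable_mem
  classical
  -- On the exceptional null set of times the field is set to zero, so the Lipschitz bound and the
  -- measurability at the points `z k` hold with no exceptions.
  set b : ℝ → Eu d → Eu d := fun t x => if t ∈ S then p x • B t x else 0 with hb
  have hbm : ∀ k, Measurable fun t => b t (z k) := fun k => by
    have : (fun t => b t (z k)) = fun t => if t ∈ S then β k t else 0 := by
      ext1 t
      by_cases ht : t ∈ S
      · simp [hb, ht, (hSP t ht).2 k]
      · simp [hb, ht]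
    rw [this]
    exact Measurable.ite hSm (hβ k) measurable_const
  have hbL : ∀ t, LipschitzWith (Real.toNNReal (|C| + |C| * N)) (b t) := fun t => by
    by_cases ht : t ∈ S
    · have hbt : b t = fun x => p x • B t x := by ext1 x; simp [hb, ht]
      obtain ⟨h1, h2⟩ := (hSP t ht).1
      have hmain : ∀ x ∈ Ω, ∀ y, dist (b t x) (b t y) ≤ (|C| + |C| * N) * dist x y := by
        intro x hx y
        have hNxy : |p x - p y| ≤ N * ‖x - y‖ := by
          simpa [dist_eq_norm] using hN.dist_le_mul x y
        rw [hbt, dist_eq_norm, dist_eq_norm]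
        by_cases hy : y ∈ Ω
        · have : p x • B t x - p y • B t y = p y • (B t x - B t y) + (p x - p y) • B t x := by
            rw [smul_sub, sub_smul]; abel
          dsimp only
          rw [this]
          calc _ ≤ |p y| * ‖B t x - B t y‖ + |p x - p y| * ‖B t x‖ := by
                refine (norm_add_le _ _).trans (le_of_eq ?_)
                rw [norm_smul, norm_smul, Real.norm_eq_abs, Real.norm_eq_abs]
            _ ≤ 1 * (|C| * ‖x - y‖) + (N * ‖x - y‖) * |C| := by
                gcongr
                · exact hp1 y
                · exact (h2 x hx y hy).trans (by gcongr; exact le_abs_self C)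
                · exact (h1 x hx).trans (le_abs_self C)
            _ = _ := by ring
        · dsimp only
          rw [hp0 y hy, zero_smul, sub_zero, norm_smul, Real.norm_eq_abs]
          rw [hp0 y hy, sub_zero] at hNxy
          calc _ ≤ (N * ‖x - y‖) * |C| := by
                gcongr
                exact (h1 x hx).trans (le_abs_self C)
            _ ≤ _ := by nlinarith [abs_nonneg C, norm_nonneg (x - y)]
      refine LipschitzWith.of_dist_le' fun x y => ?_
      by_cases hx : x ∈ Ω
      · exact hmain x hx y
      · by_cases hy : y ∈ Ω
        · rw [dist_comm, dist_comm x]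
          exact hmain y hy x
        · rw [hbt]
          dsimp only
          rw [hp0 x hx, hp0 y hy, zero_smul, zero_smul, dist_self]
          positivity
    · have hbt : b t = fun _ => 0 := by ext1 x; simp [hb, ht]
      rw [hbt]
      exact (LipschitzWith.const 0).weaken zero_le
  obtain ⟨hD, hDm⟩ := measurable_fderiv_of_lipschitz_family
    (TopologicalSpace.denseRange_denseSeq (Eu d)) hbm hbL
  have hae : ∀ᵐ q ∂cyl Ω T, DifferentiableAt ℝ (b q.1) q.2 := by
    rw [cyl_eq_prod, Measure.ae_prod_iff_ae_ae hD]
    exact .of_forall fun t => ae_restrict_of_ae (hbL t).ae_differentiableAt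
  -- The product rule for `b = pB` solved for the differential of `B`: subtract `Dp ⊗ B` and divide
  -- by `p`.
  have hmeas : AEStronglyMeasurable (fun q : ℝ × Eu d => (p q.2)⁻¹ •
      (fderiv ℝ (b q.1) q.2 - ContinuousLinearMap.smulRightL ℝ (Eu d) (Eu d) (fderiv ℝ p q.2)
        (B q.1 q.2))) (cyl Ω T) := by
    have hinv : Measurable fun q : ℝ × Eu d => (p q.2)⁻¹ :=
      (hpd.continuous.measurable.comp measurable_snd).inv
    refine hinv.aestronglyMeasurable.smul (hDm.aestronglyMeasurable.sub ?_)
    · exact (ContinuousLinearMap.smulRightL ℝ (Eu d) (Eu d)).aestronglyMeasurable_comp₂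
        ((measurable_fderiv ℝ p).comp measurable_snd).aestronglyMeasurable hB
  refine hmeas.congr ?_
  filter_upwards [hae, ae_cyl_mem hΩ.measurableSet, ae_cyl_of_ae_time (Ω := Ω) hS]
    with q hq1 hq2 hq3
  have hx := hq2.2
  have hbt : ∀ x, b q.1 x = p x • B q.1 x := fun x => if_pos hq3
  have hpx : HasFDerivAt p (fderiv ℝ p q.2) q.2 :=
    (hpd.differentiable one_ne_zero q.2).hasFDerivAt
  have hBd : DifferentiableAt ℝ (B q.1) q.2 := by
    have h1 : DifferentiableAt ℝ (fun x => (p x)⁻¹ • b q.1 x) q.2 :=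
      (hpx.differentiableAt.inv (hpΩ _ hx)).smul hq1
    refine h1.congr_of_eventuallyEq ?_
    filter_upwards [hΩ.mem_nhds hx] with y hy
    rw [hbt, smul_smul, inv_mul_cancel₀ (hpΩ y hy), one_smul]
  have h2 : HasFDerivAt (b q.1) (p q.2 • fderiv ℝ (B q.1) q.2
      + (fderiv ℝ p q.2).smulRight (B q.1 q.2)) q.2 := by
    have h3 : HasFDerivAt (fun x => p x • B q.1 x) _ q.2 := hpx.smul hBd.hasFDerivAt
    rwa [show (fun x => p x • B q.1 x) = b q.1 from funext fun x => (hbt x).symm] at h3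
  rw [h2.fderiv]
  simp [smul_smul, inv_mul_cancel₀ (hpΩ _ hx)]

end

end NSAC

namespace NSAC

/-! ## The phase set -/

section

variable {d : ℕ} {Ω : Set (Eu d)}

/-- Regular level sets are null sets. -/
lemma volume_regular_levelSet {V : Set (Eu d)} {ρ : Eu d → ℝ} (hV : IsOpen V)
    (hρ : DifferentiableOn ℝ ρ V) (hne : ∀ y ∈ V, gradient ρ y ≠ 0) :
    volume {y ∈ V | ρ y = 0} = 0 := by
  rcases V.eq_empty_or_nonempty with rfl | ⟨y₀, hy₀⟩
  · simp
  set e := gradient ρ y₀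
  have he : e ≠ 0 := hne y₀ hy₀
  set s := {y ∈ V | ρ y = 0}
  have hs : MeasurableSet s := by
    have : s = V \ (V ∩ ρ ⁻¹' {0}ᶜ) := by ext y; simp [s]
    rw [this]
    exact hV.measurableSet.diff
      (hρ.continuousOn.isOpen_inter_preimage hV isOpen_compl_singleton).measurableSet
  -- On the level set `ρ` is constant, so zero is an exact linear approximation there. At almost
  -- every point of the set this forces the full differential to vanish, against the nonvanishing
  -- gradient. The vector `e ≠ 0` only turns `ρ` into a map of the space into itself.
  have happ : ApproximatesLinearOn (fun y => ρ y • e) (0 : Eu d →L[ℝ] Eu d) s 0 := by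
    intro x hx y hy
    simp [hx.2, hy.2]
  have h := happ.norm_fderiv_sub_le (μ := volume) hs (fun x => (fderiv ℝ ρ x).smulRight e)
    fun x hx => (((hρ x hx.1).differentiableAt (hV.mem_nhds hx.1)).hasFDerivAt.smul_const
      e).hasFDerivWithinAt
  have hfalse : ∀ᵐ x ∂volume.restrict s, False := by
    filter_upwards [h, ae_restrict_mem hs] with x hx hxs
    have h1 : fderiv ℝ ρ x = 0 := by simpa [he] using hx
    refine hne x hxs.1 ?_
    simp [gradient, h1]
  rw [ae_restrict_iff' hs] at hfalse
  exact measure_eq_zero_iff_ae_notMem.2 hfalse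

/-- In a chart, points with `ρ < 0` are interior to `U` and points with `ρ > 0` are exterior, so the
frontier lies in a regular level set, which is null. Being null is a local property. -/
lemma HasCkBoundary.volume_frontier {k : ℕ} (hk : k ≠ 0) {U : Set (Eu d)}
    (hU : HasCkBoundary k U) : volume (frontier U) = 0 := by
  refine measure_null_of_locally_null _ fun x hx => ?_
  obtain ⟨V, ρ, hxV, h⟩ := hU x hx
  have hρ : DifferentiableOn ℝ ρ V := h.contDiffOn.differentiableOn (by exact_mod_cast hk)
  refine ⟨frontier U ∩ V, inter_mem_nhdsWithin _ (h.isOpen.mem_nhds hxV), ?_⟩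
  refine measure_mono_null ?_ (volume_regular_levelSet h.isOpen hρ h.grad_ne)
  rintro y ⟨hy, hyV⟩
  refine ⟨hyV, ?_⟩
  have hc : ContinuousAt ρ y := ((hρ y hyV).differentiableAt (h.isOpen.mem_nhds hyV)).continuousAt
  have hmem : ∀ z ∈ V, z ∈ U ↔ ρ z < 0 := fun z hz => by
    have := Set.ext_iff.1 h.eq z
    simpa [hz] using this
  rcases lt_trichotomy (ρ y) 0 with hlt | heq | hgt
  · exfalso
    refine hy.2 (mem_interior_iff_mem_nhds.2 ?_)
    filter_upwards [hc.eventually_lt continuousAt_const hlt, h.isOpen.mem_nhds hyV] with z hz hzV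
    exact (hmem z hzV).2 hz
  · exact heq
  · exfalso
    have h1 : Uᶜ ∈ 𝓝 y := by
      filter_upwards [continuousAt_const.eventually_lt hc hgt, h.isOpen.mem_nhds hyV] with z hz hzV
      exact fun hzU => lt_asymm hz ((hmem z hzV).1 hzU)
    rw [← mem_interior_iff_mem_nhds, interior_compl] at h1
    exact h1 hy.1

/-- The inverse is differentiable only within `closure Ω`, but this suffices: its derivative is a
left inverse of the derivative of `Ψ t` at points of `Ω`. In finite dimension the latter is then
onto, so `Ψ t` is open there. -/
lemma IsDiffeoFlow.isOpen_image (hΩ : IsOpen Ω) {Ts : ℝ} {Ψ Ψ' : ℝ → Eu d → Eu d}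
    (h : IsDiffeoFlow Ω Ts Ψ Ψ') {t : ℝ} (ht : t ∈ Ico 0 Ts) {U : Set (Eu d)} (hU : IsOpen U)
    (hUΩ : U ⊆ Ω) : IsOpen (Ψ t '' U) := by
  obtain ⟨Φ, hΦm, hinv, hΦ⟩ := h.inverse t ht
  rw [isOpen_iff_mem_nhds]
  rintro _ ⟨x, hx, rfl⟩
  have hxΩ := hUΩ hx
  have hxc := subset_closure hxΩ
  have hcd : ContDiffAt ℝ 3 (Ψ t) x :=
    (h.contDiffOn t ht).contDiffAt (mem_of_superset (hΩ.mem_nhds hxΩ) subset_closure)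
  have hstr : HasStrictFDerivAt (Ψ t) (fderiv ℝ (Ψ t) x) x :=
    hcd.hasStrictFDerivAt (by norm_num)
  have hΦd : HasFDerivWithinAt Φ (fderivWithin ℝ Φ (closure Ω) (Ψ t x)) (closure Ω) (Ψ t x) :=
    ((hΦ.differentiableOn (by norm_num)) _ (h.mapsTo t ht hxc)).hasFDerivWithinAt
  have hcomp := (hΦd.comp x (hstr.hasFDerivAt.hasFDerivWithinAt (s := Ω))
    fun y hy => h.mapsTo t ht (subset_closure hy)).hasFDerivAt (hΩ.mem_nhds hxΩ)
  have hid : HasFDerivAt (Φ ∘ Ψ t) (ContinuousLinearMap.id ℝ (Eu d)) x := by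
    refine (hasFDerivAt_id x).congr_of_eventuallyEq ?_
    filter_upwards [hΩ.mem_nhds hxΩ] with y hy
    exact hinv.1 (subset_closure hy)
  have hLA := hcomp.unique hid
  have hinj : Function.Injective (fderiv ℝ (Ψ t) x) := fun y z hyz => by
    have e1 := congrArg (fun L : Eu d →L[ℝ] Eu d => L y) hLA
    have e2 := congrArg (fun L : Eu d →L[ℝ] Eu d => L z) hLA
    simp only [ContinuousLinearMap.comp_apply, ContinuousLinearMap.id_apply] at e1 e2
    rw [← e1, ← e2, hyz]
  have hsurj : Function.Surjective (fderiv ℝ (Ψ t) x) :=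
    (LinearMap.injective_iff_surjective (f := (fderiv ℝ (Ψ t) x : Eu d →ₗ[ℝ] Eu d))).1 hinj
  rw [← hstr.map_nhds_eq_of_surj (LinearMap.range_eq_top.2 hsurj)]
  exact image_mem_map (hU.mem_nhds hx)

/-- The image of `closure U` is compact and the image of `U` is open, so the frontier of the image
lies in the image of the frontier; differentiable maps send null sets to null sets. -/
lemma IsDiffeoFlow.volume_frontier_image (hΩ : IsOpen Ω) {Ts : ℝ}
    {Ψ Ψ' : ℝ → Eu d → Eu d} (h : IsDiffeoFlow Ω Ts Ψ Ψ') {t : ℝ} (ht : t ∈ Ico 0 Ts)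
    {U : Set (Eu d)} (hU : IsOpen U) (hUc : IsCompact (closure U)) (hUΩ : closure U ⊆ Ω)
    (h0 : volume (frontier U) = 0) : volume (frontier (Ψ t '' U)) = 0 := by
  have hdiff : DifferentiableOn ℝ (Ψ t) (closure Ω) :=
    (h.contDiffOn t ht).differentiableOn (by norm_num)
  have hsub : closure U ⊆ closure Ω := hUΩ.trans subset_closure
  have hcl : IsClosed (Ψ t '' closure U) :=
    (hUc.image_of_continuousOn (hdiff.continuousOn.mono hsub)).isClosed
  refine measure_mono_null ?_ (addHaar_image_eq_zero_of_differentiableOn_of_addHaar_eq_zero volume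
    (hdiff.mono (frontier_subset_closure.trans hsub)) h0)
  rw [(h.isOpen_image hΩ ht hU (subset_closure.trans hUΩ)).frontier_eq]
  rintro y ⟨hy, hyU⟩
  obtain ⟨x, hx, rfl⟩ := closure_minimal (image_mono subset_closure) hcl hy
  refine ⟨x, ?_, rfl⟩
  rw [hU.frontier_eq]
  exact ⟨hx, fun hxU => hyU (mem_image_of_mem _ hxU)⟩

lemma IsStrongSolution.phaseSet_regular (hΩ : IsOpen Ω) (hΩb : Bornology.IsBounded Ω)
    {c₀ Ts : ℝ} {χ₀ : Eu d → ℝ} {v₀ : Eu d → Eu d} {χ : ℝ → Eu d → ℝ} {v : ℝ → Eu d → Eu d}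
    (h : IsStrongSolution Ω c₀ Ts χ₀ v₀ χ v) {t : ℝ} (ht : t ∈ Ico 0 Ts) :
    IsOpen (phaseSet Ω (χ t)) ∧ IsCompact (closure (phaseSet Ω (χ t))) ∧
      closure (phaseSet Ω (χ t)) ⊆ Ω ∧ volume (frontier (phaseSet Ω (χ t))) = 0 := by
  have h0 : phaseSet Ω (χ 0) = phaseSet Ω χ₀ := by
    ext x
    exact and_congr_right fun hx => by rw [h.χ_init x hx]
  have hcomp : ∀ s, IsCompact (closure (phaseSet Ω (χ s))) := fun s =>
    (hΩb.subset fun x hx => hx.1).isCompact_closure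
  have hz : IsOpen (phaseSet Ω (χ 0)) ∧ closure (phaseSet Ω (χ 0)) ⊆ Ω ∧
      volume (frontier (phaseSet Ω (χ 0))) = 0 := by
    rw [h0]
    exact ⟨h.init.phase_open, h.init.phase_closure, h.init.phase_boundary.volume_frontier (by simp)⟩
  rcases ht.1.eq_or_lt with rfl | hpos
  · exact ⟨hz.1, hcomp 0, hz.2⟩
  · obtain ⟨Ψ, Ψ', hΨ, him, -⟩ := h.evolution
    rw [him t ⟨hpos, ht.2⟩]
    refine ⟨hΨ.isOpen_image hΩ ht hz.1 (subset_closure.trans hz.2.1), ?_, ?_,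
      hΨ.volume_frontier_image hΩ ht hz.1 (hcomp 0) hz.2.1 hz.2.2⟩
    · rw [← him t ⟨hpos, ht.2⟩]
      exact hcomp t
    · rw [← him t ⟨hpos, ht.2⟩]
      exact h.phase_closure t ⟨hpos, ht.2⟩

/-- Up to null sets, the phases are the sets where the weight is negative and positive. -/
lemma ae_phase_iff_weight {χ ϑ : Eu d → ℝ} (hΩ : IsOpen Ω)
    (hχ : ∀ x ∈ Ω, χ x = 0 ∨ χ x = 1) (ho : IsOpen (phaseSet Ω χ))
    (hf : volume (frontier (phaseSet Ω χ)) = 0)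
    (hneg : ∀ᵐ x ∂volume.restrict (interior {x ∈ Ω | χ x = 1}), ϑ x < 0)
    (hpos : ∀ᵐ x ∂volume.restrict (interior {x ∈ Ω | χ x = 0}), 0 < ϑ x) :
    ∀ᵐ x ∂volume.restrict Ω, (χ x = 1 ∧ ϑ x < 0) ∨ (χ x = 0 ∧ 0 < ϑ x) := by
  rw [ae_restrict_iff' isOpen_interior.measurableSet] at hneg hpos
  rw [ae_restrict_iff' hΩ.measurableSet]
  filter_upwards [hneg, hpos, measure_eq_zero_iff_ae_notMem.1 hf] with x h1 h2 h3 hx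
  rcases hχ x hx with h | h
  · refine .inr ⟨h, h2 ?_⟩
    have hxc : x ∉ closure (phaseSet Ω χ) := fun hxc => by
      rw [ho.frontier_eq] at h3
      exact h3 ⟨hxc, fun hp => by simp [hp.2] at h⟩
    refine mem_interior_iff_mem_nhds.2 ?_
    filter_upwards [hΩ.mem_nhds hx, isClosed_closure.isOpen_compl.mem_nhds hxc] with y hy hyc
    exact ⟨hy, (hχ y hy).resolve_right fun h1 => hyc (subset_closure ⟨hy, h1⟩)⟩
  · refine .inl ⟨h, h1 ?_⟩
    have : interior {x ∈ Ω | χ x = 1} = phaseSet Ω χ := ho.interior_eq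
    rw [this]
    exact ⟨hx, h⟩

/-- Continuity turns the a.e. sign into a sign at every point. It is needed pointwise so that
`min(ϑ, 0)` vanishes identically outside a compact subset of `Ω`. -/
lemma weight_nonneg_off_phase {χ ϑ : Eu d → ℝ} (hΩ : IsOpen Ω)
    (hχ : ∀ x ∈ Ω, χ x = 0 ∨ χ x = 1) (hc : ContinuousOn ϑ Ω)
    (hpos : ∀ᵐ x ∂volume.restrict (interior {x ∈ Ω | χ x = 0}), 0 < ϑ x) :
    ∀ x ∈ Ω \ closure (phaseSet Ω χ), 0 ≤ ϑ x := by
  rintro x ⟨hx, hxc⟩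
  rw [ae_restrict_iff' isOpen_interior.measurableSet] at hpos
  set U := Ω \ closure (phaseSet Ω χ) with hUdef
  have hU : IsOpen U := hΩ.sdiff isClosed_closure
  have hUsub : U ⊆ interior {x ∈ Ω | χ x = 0} := interior_maximal (fun y hy =>
    ⟨hy.1, (hχ y hy.1).resolve_right fun h1 => hy.2 (subset_closure ⟨hy.1, h1⟩)⟩) hU
  obtain ⟨y, hy, hyx⟩ := mem_closure_iff_seq_limit.1
    ((Measure.dense_of_ae hpos).open_subset_closure_inter hU (⟨hx, hxc⟩ : x ∈ U))
  exact ge_of_tendsto' ((hc x hx).tendsto.comp (tendsto_nhdsWithin_iff.2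
    ⟨hyx, .of_forall fun n => (hy n).1.1⟩)) fun n => ((hy n).2 (hUsub (hy n).1)).le

end

end NSAC

namespace NSAC

/-! ## Weakly differentiable functions of time -/

lemma setIntegral_Ioo_eq_interval {E : Type*} [NormedAddCommGroup E] [NormedSpace ℝ E] {T : ℝ}
    (hT : 0 ≤ T) (f : ℝ → E) : ∫ t in Ioo 0 T, f t = ∫ t in (0 : ℝ)..T, f t := by
  rw [intervalIntegral.integral_of_le hT, integral_Ioc_eq_integral_Ioo]

lemma intervalIntegrable_of_integrableOn_Ioo {E : Type*} [NormedAddCommGroup E] {T : ℝ}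
    (hT : 0 ≤ T) {f : ℝ → E} (hf : IntegrableOn f (Ioo 0 T)) :
    IntervalIntegrable f volume 0 T := by
  rwa [intervalIntegrable_iff_integrableOn_Ioo_of_le hT]

/-- The primitive of a smooth function with vanishing integral is a test function. -/
lemma primitive_isTest {T α β : ℝ} (hα : 0 < α) (hβ : β < T) {w : ℝ → ℝ}
    (hw : ContDiff ℝ ∞ w) (hs : ∀ t ∉ Ioo α β, w t = 0) (h0 : ∫ t in (0 : ℝ)..T, w t = 0) :
    ContDiff ℝ ∞ (fun t => ∫ r in (0 : ℝ)..t, w r) ∧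
      (∀ t, HasDerivAt (fun t => ∫ r in (0 : ℝ)..t, w r) (w t) t) ∧
      tsupport (fun t => ∫ r in (0 : ℝ)..t, w r) ⊆ Icc α β := by
  have hc := hw.continuous
  have hd : ∀ t, HasDerivAt (fun t => ∫ r in (0 : ℝ)..t, w r) (w t) t := fun t =>
    intervalIntegral.integral_hasDerivAt_right (hc.intervalIntegrable _ _)
      (hc.stronglyMeasurableAtFilter _ _) hc.continuousAt
  refine ⟨?_, hd, closure_minimal (fun t ht => ?_) isClosed_Icc⟩
  · rw [contDiff_infty_iff_deriv]
    exact ⟨fun t => (hd t).differentiableAt, by rwa [funext fun t => (hd t).deriv]⟩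
  · by_contra htn
    refine ht ?_
    rw [mem_Icc, not_and_or, not_le, not_le] at htn
    rcases htn with h | h
    · refine intervalIntegral.integral_zero_ae (.of_forall fun r hr => hs r fun hr' => ?_)
      have := hr.2
      rcases le_max_iff.1 this with h1 | h1 <;> linarith [hr'.1]
    · change ∫ r in (0 : ℝ)..t, w r = 0
      -- To the right of the support the primitive equals the full integral over `(0, T)`, which is
      -- zero.
      rw [← intervalIntegral.integral_add_adjacent_intervals (hc.intervalIntegrable 0 T)
        (hc.intervalIntegrable T t), h0, zero_add]
      refine intervalIntegral.integral_zero_ae (.of_forall fun r hr => hs r fun hr' => ?_)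
      have := hr.1
      rcases min_lt_iff.1 this with h1 | h1 <;> linarith [hr'.2]

/-- Integration by parts of a test function against a primitive. -/
lemma integral_test_mul_primitive {T : ℝ} (hT : 0 < T) {Z w g : ℝ → ℝ} (hZ : ContDiff ℝ ∞ Z)
    (hd : ∀ t, HasDerivAt Z (w t) t) (hs : tsupport Z ⊆ Ioo 0 T) (hg : IntegrableOn g (Ioo 0 T)) :
    ∫ t in Ioo 0 T, w t * ∫ r in (0 : ℝ)..t, g r = -∫ t in Ioo 0 T, Z t * g t := by
  have hgi := intervalIntegrable_of_integrableOn_Ioo hT.le hg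
  have hF := hgi.absolutelyContinuousOnInterval_intervalIntegral (c := 0) (by simp)
  have hZac : AbsolutelyContinuousOnInterval Z 0 T :=
    (hZ.of_le (by exact_mod_cast le_top) : ContDiff ℝ 1 Z).contDiffOn.absolutelyContinuousOnInterval
  have hz0 : Z 0 = 0 := image_eq_zero_of_notMem_tsupport fun h => lt_irrefl _ (hs h).1
  have hzT : Z T = 0 := image_eq_zero_of_notMem_tsupport fun h => lt_irrefl _ (hs h).2
  have h := hZac.integral_mul_deriv_eq_deriv_mul hF
  rw [hz0, hzT, zero_mul, zero_mul, sub_zero, zero_sub] at h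
  rw [setIntegral_Ioo_eq_interval hT.le, setIntegral_Ioo_eq_interval hT.le]
  have e1 : ∫ x in (0 : ℝ)..T, Z x * deriv (fun x => ∫ r in (0 : ℝ)..x, g r) x
      = ∫ x in (0 : ℝ)..T, Z x * g x := by
    refine intervalIntegral.integral_congr_ae ?_
    filter_upwards [hgi.ae_hasDerivAt_integral] with x hx hx'
    rw [(hx (uIoc_subset_uIcc hx') 0 (by simp)).deriv]
  rw [← e1, h, neg_neg]
  simp only [fun t => (hd t).deriv]

/-- An integrable function on `(0, T)` whose means over all rational intervals agree is constant. -/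
lemma ae_eq_const_of_forall_rat {T κ : ℝ} (hT : 0 < T) {h : ℝ → ℝ} (hh : IntegrableOn h (Ioo 0 T))
    (hab : ∀ a b : ℚ, (0 : ℝ) < a → (a : ℝ) < b → (b : ℝ) < T →
      ∫ t in Ioo (a : ℝ) b, h t = (b - a) * κ) :
    ∀ᵐ t ∂volume.restrict (Ioo 0 T), h t = κ := by
  set k : ℝ → ℝ := fun t => h t - κ with hk
  have hki : IntegrableOn k (Ioo 0 T) := hh.sub (integrableOn_const (by simp) (by simp))
  have hkI := intervalIntegrable_of_integrableOn_Ioo hT.le hki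
  have hsub : ∀ {a b : ℝ}, a ∈ Icc 0 T → b ∈ Icc 0 T → IntervalIntegrable k volume a b :=
    fun ha hb => hkI.mono_set (by
      rw [uIcc_of_le hT.le]
      exact uIcc_subset_Icc ha hb)
  -- The primitive of `h - κ` takes one value at all rationals of `(0, T)`, hence is constant there
  -- by continuity; its a.e. derivative `h - κ` is zero.
  set P : ℝ → ℝ := fun t => ∫ r in (0 : ℝ)..t, k r with hP
  have hPc : ContinuousOn P (Icc 0 T) := by
    have := (hkI.absolutelyContinuousOnInterval_intervalIntegral (c := 0) (by simp)).continuousOn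
    rwa [uIcc_of_le hT.le] at this
  obtain ⟨q₀, hq₀, hq₀'⟩ := exists_rat_btwn hT
  have hzero : ∀ a b : ℚ, (0 : ℝ) < a → (a : ℝ) < b → (b : ℝ) < T → P b = P a := by
    intro a b ha hlt hb
    have h1 : P b - P a = ∫ t in (a : ℝ)..b, k t :=
      intervalIntegral.integral_interval_sub_left
        (hsub ⟨le_rfl, hT.le⟩ ⟨(ha.trans hlt).le, hb.le⟩)
        (hsub ⟨le_rfl, hT.le⟩ ⟨ha.le, (hlt.trans hb).le⟩)
    rw [← sub_eq_zero, h1, intervalIntegral.integral_of_le hlt.le, integral_Ioc_eq_integral_Ioo,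
      hk, integral_sub (hh.mono_set (Ioo_subset_Ioo ha.le hb.le))
        (integrableOn_const (by simp) (by simp)), hab a b ha hlt hb]
    simp [hlt.le]
  have hzero' : ∀ a : ℚ, (0 : ℝ) < a → (a : ℝ) < T → P a = P q₀ := by
    intro a ha haT
    rcases lt_trichotomy (a : ℝ) q₀ with hlt | heq | hgt
    · exact (hzero a q₀ ha hlt hq₀').symm
    · rw [heq]
    · exact hzero q₀ a hq₀ hgt haT
  have hconst : ∀ t ∈ Ioo 0 T, P t = P q₀ := by
    intro t ht
    have hd : Dense {x : ℝ | ∃ q : ℚ, (q : ℝ) = x} := Rat.denseRange_cast (𝕜 := ℝ)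
    obtain ⟨y, hy, hyt⟩ := mem_closure_iff_seq_limit.1
      (hd.open_subset_closure_inter isOpen_Ioo ht)
    have hlim : Tendsto (fun n => P (y n)) atTop (𝓝 (P t)) :=
      (hPc t (Ioo_subset_Icc_self ht)).tendsto.comp (tendsto_nhdsWithin_iff.2
        ⟨hyt, .of_forall fun n => Ioo_subset_Icc_self (hy n).1⟩)
    refine tendsto_nhds_unique hlim (tendsto_const_nhds.congr fun n => ?_)
    obtain ⟨q, hq⟩ := (hy n).2
    have := (hy n).1
    rw [← hq] at this ⊢
    exact (hzero' q this.1 this.2).symm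
  rw [ae_restrict_iff' measurableSet_Ioo]
  filter_upwards [hkI.ae_hasDerivAt_integral] with t ht htT
  rw [uIcc_of_le hT.le] at ht
  have h1 := ht (Ioo_subset_Icc_self htT) 0 ⟨le_rfl, hT.le⟩
  have h2 : HasDerivAt P 0 t := by
    refine (hasDerivAt_const t (P q₀)).congr_of_eventuallyEq ?_
    filter_upwards [isOpen_Ioo.mem_nhds htT] with r hr using hconst r hr
  exact sub_eq_zero.1 (h1.unique h2)

/-- Smooth functions between `0` and `1` increasing to the indicator of an interval. -/
lemma exists_smooth_indicator_seq (a b : ℝ) : ∃ u : ℕ → ℝ → ℝ, (∀ n, ContDiff ℝ ∞ (u n)) ∧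
    (∀ n t, u n t ∈ Icc (0 : ℝ) 1) ∧ (∀ n, ∀ t ∉ Ioo a b, u n t = 0) ∧
    ∀ t ∈ Ioo a b, Tendsto (fun n => u n t) atTop (𝓝 1) := by
  obtain ⟨f, hfs, hfd, hfr⟩ := (isOpen_Ioo (a := a) (b := b)).exists_contDiff_support_eq (n := ⊤)
  refine ⟨fun n t => Real.smoothTransition (n * f t), fun n => ?_, fun n t => ?_,
    fun n t ht => ?_, fun t ht => ?_⟩
  · exact Real.smoothTransition.contDiff.comp (contDiff_const.mul hfd)
  · exact ⟨Real.smoothTransition.nonneg _, Real.smoothTransition.le_one _⟩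
  · rw [← hfs] at ht
    simp [Function.notMem_support.1 ht]
  · rw [← hfs] at ht
    have hpos : 0 < f t := lt_of_le_of_ne (hfr (mem_range_self t)).1 (Ne.symm ht)
    refine tendsto_const_nhds.congr' ?_
    filter_upwards [(tendsto_natCast_atTop_atTop (R := ℝ)).eventually_ge_atTop (1 / f t)] with n hn
    refine (Real.smoothTransition.one_of_one_le ?_).symm
    rwa [div_le_iff₀ hpos] at hn

lemma tendsto_integral_indicator_seq {T a b : ℝ} (ha : 0 ≤ a) (hb : b ≤ T) {u : ℕ → ℝ → ℝ}
    (hu : ∀ n, ContDiff ℝ ∞ (u n)) (hr : ∀ n t, u n t ∈ Icc (0 : ℝ) 1)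
    (hz : ∀ n, ∀ t ∉ Ioo a b, u n t = 0)
    (hl : ∀ t ∈ Ioo a b, Tendsto (fun n => u n t) atTop (𝓝 1)) {h : ℝ → ℝ}
    (hh : IntegrableOn h (Ioo 0 T)) :
    Tendsto (fun n => ∫ t in Ioo 0 T, u n t * h t) atTop (𝓝 (∫ t in Ioo a b, h t)) := by
  have hlim : ∫ t in Ioo a b, h t = ∫ t in Ioo 0 T, (Ioo a b).indicator h t := by
    rw [setIntegral_indicator measurableSet_Ioo, inter_eq_right.2 (Ioo_subset_Ioo ha hb)]
  rw [hlim]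
  refine tendsto_integral_of_dominated_convergence (fun t => ‖h t‖)
    (fun n => (hu n).continuous.aestronglyMeasurable.mul hh.1) hh.norm (fun n => ?_) ?_
  · refine .of_forall fun t => ?_
    rw [norm_mul, Real.norm_of_nonneg (hr n t).1]
    exact mul_le_of_le_one_left (norm_nonneg _) (hr n t).2
  · refine .of_forall fun t => ?_
    by_cases ht : t ∈ Ioo a b
    · rw [indicator_of_mem ht]
      simpa using (hl t ht).mul_const (h t)
    · rw [indicator_of_notMem ht]
      refine tendsto_const_nhds.congr fun n => ?_
      rw [hz n t ht, zero_mul]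

/-- Countably many test functions detect weak differentiability on `(0, T)`. -/
lemma exists_countable_tests {T : ℝ} (hT : 0 < T) : ∃ Z : ℚ × ℚ × ℕ → ℝ → ℝ,
    (∀ i, ContDiff ℝ ∞ (Z i) ∧ HasCompactSupport (Z i) ∧ tsupport (Z i) ⊆ Ioo 0 T) ∧
    ∀ f g : ℝ → ℝ, IntegrableOn f (Ioo 0 T) → IntegrableOn g (Ioo 0 T) →
      (∀ i, ∫ t in Ioo 0 T, deriv (Z i) t * f t = -∫ t in Ioo 0 T, Z i t * g t) →
      ∃ c, ∀ᵐ t ∂volume.restrict (Ioo 0 T), f t = c + ∫ r in (0 : ℝ)..t, g r := by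
  obtain ⟨u₀, hu₀, hr₀, hz₀, hl₀⟩ := exists_smooth_indicator_seq (T / 3) (2 * T / 3)
  obtain ⟨N, hN⟩ : ∃ N, ∫ t in Ioo 0 T, u₀ N t ≠ 0 := by
    have h1 := tendsto_integral_indicator_seq (T := T) (h := fun _ => 1) (by linarith)
      (by linarith) hu₀ hr₀ hz₀ hl₀ (integrableOn_const (by simp) (by simp))
    have h2 : ∫ t in Ioo (T / 3) (2 * T / 3), (1 : ℝ) = T / 3 := by
      rw [setIntegral_const, smul_eq_mul, mul_one, Real.volume_real_Ioo_of_le (by linarith)]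
      ring
    rw [h2] at h1
    obtain ⟨N, hN⟩ := (h1.eventually_ne (by positivity : T / 3 ≠ 0)).exists
    exact ⟨N, by simpa using hN⟩
  -- The argument of du Bois-Reymond: a fixed bump of integral one corrects other functions to mean
  -- zero, so that their primitives have compact support in `(0, T)`.
  set ζ : ℝ → ℝ := fun t => (∫ t in Ioo 0 T, u₀ N t)⁻¹ * u₀ N t with hζ
  have hζd : ContDiff ℝ ∞ ζ := contDiff_const.mul (hu₀ N)
  have hζ1 : ∫ t in Ioo 0 T, ζ t = 1 := by rw [integral_const_mul, inv_mul_cancel₀ hN]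
  have hζz : ∀ t ∉ Ioo (T / 3) (2 * T / 3), ζ t = 0 := fun t ht => by simp [hζ, hz₀ N t ht]
  choose u hu hr hz hl using fun ab : ℚ × ℚ => exists_smooth_indicator_seq (ab.1 : ℝ) ab.2
  set w : ℚ × ℚ × ℕ → ℝ → ℝ := fun i t =>
    u (i.1, i.2.1) i.2.2 t - (∫ t in Ioo 0 T, u (i.1, i.2.1) i.2.2 t) * ζ t with hw
  have hcI : ∀ {v : ℝ → ℝ}, Continuous v → IntegrableOn v (Ioo 0 T) := fun hv =>
    (hv.integrableOn_Icc (a := 0) (b := T)).mono_set Ioo_subset_Icc_self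
  have hwd : ∀ i, ContDiff ℝ ∞ (w i) := fun i => (hu _ _).sub (contDiff_const.mul hζd)
  have hw0 : ∀ i, ∫ t in (0 : ℝ)..T, w i t = 0 := fun i => by
    have hi2 : IntegrableOn (fun t => (∫ t in Ioo 0 T, u (i.1, i.2.1) i.2.2 t) * ζ t)
        (Ioo 0 T) := hcI (continuous_const.mul hζd.continuous)
    have h := integral_sub (hcI (hu (i.1, i.2.1) i.2.2).continuous) hi2
    rw [integral_const_mul, hζ1, mul_one, sub_self] at h
    rw [← setIntegral_Ioo_eq_interval hT.le]
    exact h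
  classical
  set adm : ℚ × ℚ × ℕ → Prop := fun i => (0 : ℝ) < i.1 ∧ (i.1 : ℝ) < i.2.1 ∧ (i.2.1 : ℝ) < T
  have hprim : ∀ i, adm i → ContDiff ℝ ∞ (fun t => ∫ r in (0 : ℝ)..t, w i r) ∧
      (∀ t, HasDerivAt (fun t => ∫ r in (0 : ℝ)..t, w i r) (w i t) t) ∧
      tsupport (fun t => ∫ r in (0 : ℝ)..t, w i r) ⊆
        Icc (min (i.1 : ℝ) (T / 3)) (max (i.2.1 : ℝ) (2 * T / 3)) := fun i hi => by
    refine primitive_isTest (T := T) (lt_min hi.1 (by linarith)) (max_lt hi.2.2 (by linarith)) (hwd i) (fun t ht => ?_)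
      (hw0 i)
    have h1 : t ∉ Ioo (i.1 : ℝ) i.2.1 := fun h => ht
      ⟨(min_le_left _ _).trans_lt h.1, h.2.trans_le (le_max_left _ _)⟩
    have h2 : t ∉ Ioo (T / 3) (2 * T / 3) := fun h => ht
      ⟨(min_le_right _ _).trans_lt h.1, h.2.trans_le (le_max_right _ _)⟩
    simp only [hw, hz (i.1, i.2.1) i.2.2 t h1, hζz t h2, mul_zero, sub_zero]
  have hsuppI : ∀ i, adm i → Icc (min (i.1 : ℝ) (T / 3)) (max (i.2.1 : ℝ) (2 * T / 3))
      ⊆ Ioo 0 T := fun i hi =>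
    Icc_subset_Ioo (lt_min hi.1 (by linarith)) (max_lt hi.2.2 (by linarith))
  refine ⟨fun i => if adm i then fun t => ∫ r in (0 : ℝ)..t, w i r else 0, fun i => ?_,
    fun f g hf hg hfg => ?_⟩
  · by_cases hi : adm i
    · simp only [if_pos hi]
      obtain ⟨h1, -, h3⟩ := hprim i hi
      exact ⟨h1, isCompact_Icc.of_isClosed_subset (isClosed_tsupport _) h3,
        h3.trans (hsuppI i hi)⟩
    · simp only [if_neg hi]
      refine ⟨contDiff_const, HasCompactSupport.zero, ?_⟩
      simp [tsupport]
  · set F : ℝ → ℝ := fun t => ∫ r in (0 : ℝ)..t, g r with hF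
    have hgi := intervalIntegrable_of_integrableOn_Ioo hT.le hg
    have hFc : ContinuousOn F (Icc 0 T) := by
      have := (hgi.absolutelyContinuousOnInterval_intervalIntegral (c := 0)
        (by simp)).continuousOn
      rwa [uIcc_of_le hT.le] at this
    have hFi : IntegrableOn F (Ioo 0 T) :=
      (hFc.integrableOn_Icc).mono_set Ioo_subset_Icc_self
    set h : ℝ → ℝ := fun t => f t - F t with hh
    have hhi : IntegrableOn h (Ioo 0 T) := hf.sub hFi
    have hbm : ∀ {v k : ℝ → ℝ}, Continuous v → IntegrableOn k (Ioo 0 T) →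
        IntegrableOn (fun t => v t * k t) (Ioo 0 T) := fun {v k} hv hk => by
      obtain ⟨C, hC⟩ := (isCompact_Icc (a := (0 : ℝ)) (b := T)).exists_bound_of_continuousOn
        hv.continuousOn
      refine Integrable.bdd_mul (c := C) hk hv.aestronglyMeasurable ?_
      filter_upwards [ae_restrict_mem measurableSet_Ioo] with t ht
      exact hC t (Ioo_subset_Icc_self ht)
    have hwh : ∀ i, adm i → ∫ t in Ioo 0 T, w i t * h t = 0 := fun i hi => by
      obtain ⟨h1, h2, h3⟩ := hprim i hi
      have e1 := hfg i
      simp only [if_pos hi] at e1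
      rw [← integral_test_mul_primitive hT h1 h2 (h3.trans (hsuppI i hi)) hg] at e1
      simp only [fun t => (h2 t).deriv] at e1
      have e2 := integral_sub (hbm (hwd i).continuous hf) (hbm (hwd i).continuous hFi)
      simp only [hh, mul_sub]
      rw [e2, e1, sub_self]
    refine ⟨∫ t in Ioo 0 T, ζ t * h t, ?_⟩
    have hfin := ae_eq_const_of_forall_rat (κ := ∫ t in Ioo 0 T, ζ t * h t) hT hhi ?_
    · filter_upwards [hfin] with t ht
      rw [← ht, hh]
      ring
    -- Orthogonality of `h = f - F` to `u - (∫u)ζ`, with `u` increasing to the indicator of `(a,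
    -- b)`, yields `∫ₐᵇ h = (b - a)∫ζh`.
    intro a b ha hab hb
    have t1 := tendsto_integral_indicator_seq (T := T) ha.le hb.le (hu (a, b)) (hr (a, b))
      (hz (a, b)) (hl (a, b)) hhi
    have t2 := tendsto_integral_indicator_seq (T := T) (h := fun _ => 1) ha.le hb.le (hu (a, b))
      (hr (a, b)) (hz (a, b)) (hl (a, b)) (integrableOn_const (by simp) (by simp))
    rw [setIntegral_const, smul_eq_mul, mul_one, Real.volume_real_Ioo_of_le hab.le] at t2
    refine tendsto_nhds_unique t1 ((t2.mul_const _).congr fun n => ?_)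
    have e := hwh (a, b, n) ⟨ha, hab, hb⟩
    have e2 := integral_sub (hbm (hu (a, b) n).continuous hhi)
      ((hbm hζd.continuous hhi).const_mul (∫ t in Ioo 0 T, u (a, b) n t))
    rw [integral_const_mul] at e2
    simp only [hw, sub_mul, mul_assoc] at e
    simp only [mul_one]
    rw [e2] at e
    linarith

end NSAC

namespace NSAC

/-! ## The fundamental theorem of calculus in time -/

lemma LipschitzWith.comp_absolutelyContinuousOnInterval {G : ℝ → ℝ} {K : ℝ≥0}
    (hG : LipschitzWith K G) {f : ℝ → ℝ} {a b : ℝ} (hf : AbsolutelyContinuousOnInterval f a b) :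
    AbsolutelyContinuousOnInterval (fun t => G (f t)) a b := by
  rw [absolutelyContinuousOnInterval_iff] at hf ⊢
  intro ε hε
  -- `K + 1` rather than `K`, since the Lipschitz constant may be zero.
  obtain ⟨δ, hδ, h⟩ := hf (ε / (K + 1)) (by positivity)
  refine ⟨δ, hδ, fun E hE hE' => ?_⟩
  calc _ ≤ ∑ i ∈ Finset.range E.1, K * dist (f (E.2 i).1) (f (E.2 i).2) :=
        Finset.sum_le_sum fun i _ => hG.dist_le_mul _ _
    _ = K * ∑ i ∈ Finset.range E.1, dist (f (E.2 i).1) (f (E.2 i).2) := by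
        rw [Finset.mul_sum]
    _ ≤ K * (ε / (K + 1)) := by
        gcongr
        exact (h E hE hE').le
    _ < (K + 1) * (ε / (K + 1)) := by gcongr; linarith
    _ = ε := by field

lemma deriv_min_zero_of_neg {θ : ℝ → ℝ} (hθ : Continuous θ) {t : ℝ} (h : θ t < 0) :
    deriv (fun r => min (θ r) 0) t = deriv θ t := by
  refine Filter.EventuallyEq.deriv_eq ?_
  filter_upwards [hθ.continuousAt.eventually_lt continuousAt_const h] with r hr
  exact min_eq_left hr.le

lemma deriv_min_zero_of_pos {θ : ℝ → ℝ} (hθ : Continuous θ) {t : ℝ} (h : 0 < θ t) :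
    deriv (fun r => min (θ r) 0) t = 0 := by
  have : (fun r => min (θ r) 0) =ᶠ[𝓝 t] fun _ => 0 := by
    filter_upwards [continuousAt_const.eventually_lt hθ.continuousAt h] with r hr
    exact min_eq_right hr.le
  rw [this.deriv_eq, deriv_const]

/-- The fundamental theorem of calculus for `(G(φ) - κ χ) θ`, where `φ` is a primitive of `g`, and
`χ` is the indicator of `{θ < 0}`. -/
lemma integral_time_deriv {T c κ M : ℝ} (hT : 0 < T) {φ g χ θ G G' : ℝ → ℝ} {L : ℝ≥0}
    (hg : IntegrableOn g (Ioo 0 T))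
    (hφ : ∀ᵐ t ∂volume.restrict (Ioo 0 T), φ t = c + ∫ r in (0 : ℝ)..t, g r)
    (hθ : LipschitzWith L θ) (hM : 0 ≤ M) (hG : ∀ s, HasDerivAt G (G' s) s) (hb : ∀ s, |G' s| ≤ M)
    (hχ : ∀ᵐ t ∂volume.restrict (Ioo 0 T), (χ t = 1 ∧ θ t < 0) ∨ (χ t = 0 ∧ 0 < θ t)) :
    ∫ t in Ioo 0 T, ((G (φ t) - κ * χ t) * deriv θ t + θ t * (G' (φ t) * g t))
      = (G (c + ∫ r in (0 : ℝ)..T, g r) * θ T - κ * min (θ T) 0)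
        - (G c * θ 0 - κ * min (θ 0) 0) := by
  have hgi := intervalIntegrable_of_integrableOn_Ioo hT.le hg
  have hFac := hgi.absolutelyContinuousOnInterval_intervalIntegral (c := 0) (by simp)
  have hcac : AbsolutelyContinuousOnInterval (fun _ : ℝ => c) 0 T :=
    ((LipschitzWith.const c).lipschitzOnWith (s := uIcc 0 T)).absolutelyContinuousOnInterval
  have hΦ : AbsolutelyContinuousOnInterval (fun t => c + ∫ r in (0 : ℝ)..t, g r) 0 T :=
    hcac.fun_add hFac
  have hΨ := LipschitzWith.comp_absolutelyContinuousOnInterval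
    (lipschitzWith_of_hasDerivAt hM hG hb) hΦ
  have hθac : AbsolutelyContinuousOnInterval θ 0 T :=
    (hθ.lipschitzOnWith (s := uIcc 0 T)).absolutelyContinuousOnInterval
  have hm : AbsolutelyContinuousOnInterval (fun t => min (θ t) 0) 0 T :=
    ((hθ.min_const 0).lipschitzOnWith (s := uIcc 0 T)).absolutelyContinuousOnInterval
  have hκ : AbsolutelyContinuousOnInterval (fun t => κ * min (θ t) 0) 0 T := hm.const_mul κ
  -- `χθ` is represented by `min(θ, 0)`, so the whole expression is absolutely continuous although
  -- `χ` may jump in time.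
  have hA := (hΨ.fun_mul hθac).fun_sub hκ
  have h := hA.integral_deriv_eq_sub
  rw [intervalIntegral.integral_same, add_zero] at h
  rw [← h, setIntegral_Ioo_eq_interval hT.le]
  refine intervalIntegral.integral_congr_ae ?_
  have hTne : ∀ᵐ t : ℝ, t ≠ T := by simp [ae_iff, measure_singleton]
  rw [ae_restrict_iff' measurableSet_Ioo] at hφ hχ
  filter_upwards [hφ, hχ, hgi.ae_hasDerivAt_integral, hθac.ae_differentiableAt,
    hm.ae_differentiableAt, hTne] with t h1 h2 h3 h4 h5 h6 ht
  have htI : t ∈ uIcc 0 T := uIoc_subset_uIcc ht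
  rw [uIoc_of_le hT.le] at ht
  have ht' : t ∈ Ioo 0 T := ⟨ht.1, lt_of_le_of_ne ht.2 h6⟩
  have d1 : HasDerivAt (fun t => c + ∫ r in (0 : ℝ)..t, g r) (g t) t :=
    (h3 htI 0 (by simp)).const_add c
  have d2 : HasDerivAt (fun t => G (c + ∫ r in (0 : ℝ)..t, g r)) (G' (φ t) * g t) t := by
    rw [h1 ht']
    exact (hG _).comp t d1
  have d3 : HasDerivAt (fun t => G (c + ∫ r in (0 : ℝ)..t, g r) * θ t - κ * min (θ t) 0) _ t :=
    (d2.fun_mul (h4 htI).hasDerivAt).fun_sub ((h5 htI).hasDerivAt.const_mul κ)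
  rw [d3.deriv, ← h1 ht']
  rcases h2 ht' with ⟨h7, h8⟩ | ⟨h7, h8⟩
  · rw [deriv_min_zero_of_neg hθ.continuous h8, h7]
    ring
  · rw [deriv_min_zero_of_pos hθ.continuous h8, h7]
    ring

section

variable {d : ℕ} {Ω : Set (Eu d)}

instance isFiniteMeasure_cyl [IsFiniteMeasure (volume.restrict Ω)] (T : ℝ) :
    IsFiniteMeasure (cyl Ω T) := by
  rw [cyl_eq_prod]
  infer_instance

/-- In the weak formulation the exceptional set of points `x` depends on the test function. Since
countably many tests suffice, one null set serves for all of them. -/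
lemma IsTimeDeriv.ae_exists_const [IsFiniteMeasure (volume.restrict Ω)] {T : ℝ} (hT : 0 < T)
    {f g : ℝ → Eu d → ℝ} (h : IsTimeDeriv Ω T f g) :
    ∀ᵐ x ∂volume.restrict Ω, IntegrableOn (fun t => g t x) (Ioo 0 T) ∧
      ∃ c, ∀ᵐ t ∂volume.restrict (Ioo 0 T), f t x = c + ∫ r in (0 : ℝ)..t, g r x := by
  obtain ⟨Z, hZ, hZc⟩ := exists_countable_tests hT
  have hf := h.memLp.integrable one_le_two
  have hg := h.memLp_deriv.integrable one_le_two
  rw [cyl_eq_prod] at hf hg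
  have hw : ∀ i, _ := fun i => h.weak (Z i) (hZ i).1 (hZ i).2.1 (hZ i).2.2
  filter_upwards [hf.prod_left_ae, hg.prod_left_ae, ae_all_iff.2 hw] with x h1 h2 h3
  exact ⟨h2, hZc _ _ h1 h2 fun i => by simpa using h3 i⟩

/-- There are arbitrarily small times in a set of full measure at which a function is close to its
initial value in `L²`. -/
lemma TendstoL2Zero.exists_seq {f : ℝ → Eu d → ℝ} {f₀ : Eu d → ℝ} {T : ℝ} (hT : 0 < T)
    (h : TendstoL2Zero Ω f f₀) {P : ℝ → Prop} (hP : ∀ᵐ t ∂volume.restrict (Ioo 0 T), P t) :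
    ∃ τ : ℕ → ℝ, (∀ n, τ n ∈ Ioo 0 T ∧ P (τ n)) ∧ Tendsto τ atTop (𝓝 0) ∧
      Tendsto (fun n => eLpNorm (fun x => f (τ n) x - f₀ x) 2 (volume.restrict Ω)) atTop (𝓝 0) := by
  rw [ae_restrict_iff' measurableSet_Ioo] at hP
  have hex : ∀ n : ℕ, ∃ t, (t ∈ Ioo 0 T ∧ P t) ∧ t < 1 / ((n : ℝ) + 1) ∧
      eLpNorm (fun x => f t x - f₀ x) 2 (volume.restrict Ω) < ((n : ℝ≥0∞) + 1)⁻¹ := by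
    intro n
    have e1 := (tendsto_order.1 h).2 (((n : ℝ≥0∞) + 1)⁻¹)
      (ENNReal.inv_pos.2 (ENNReal.add_ne_top.2 ⟨ENNReal.natCast_ne_top n, ENNReal.one_ne_top⟩))
    rw [eventually_inf] at e1
    obtain ⟨s, hs, s', hs', hss⟩ := e1
    obtain ⟨ε, hε, hεs⟩ := mem_nhdsGT_iff_exists_Ioo_subset.1 hs
    have hε : 0 < ε := hε
    -- The interval `(0, r)` has positive measure, so it contains a time outside the null sets
    -- excluded by the convergence and by `P`.
    set r := min ε (min T (1 / ((n : ℝ) + 1))) with hr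
    have hrpos : 0 < r := lt_min hε (lt_min hT (by positivity))
    have hne : (volume.restrict (Ioo 0 r)) ≠ 0 := by
      rw [Ne, Measure.restrict_eq_zero]
      simp [hrpos]
    have : NeBot (ae (volume.restrict (Ioo (0 : ℝ) r))) := ae_neBot.2 hne
    have hall : ∀ᵐ t ∂volume.restrict (Ioo 0 r), t ∈ Ioo 0 r ∧ t ∈ s' ∧ (t ∈ Ioo 0 T → P t) := by
      filter_upwards [ae_restrict_mem measurableSet_Ioo, ae_restrict_of_ae hs',
        ae_restrict_of_ae hP] with t h1 h2 h3 using ⟨h1, h2, h3⟩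
    obtain ⟨t, h1, h2, h3⟩ := hall.exists
    have htT : t ∈ Ioo 0 T := ⟨h1.1, h1.2.trans_le ((min_le_right _ _).trans (min_le_left _ _))⟩
    exact ⟨t, ⟨htT, h3 htT⟩,
      h1.2.trans_le ((min_le_right _ _).trans (min_le_right _ _)),
      hss t ⟨hεs ⟨h1.1, h1.2.trans_le (min_le_left _ _)⟩, h2⟩⟩
  choose τ hτ hτ1 hτ2 using hex
  refine ⟨τ, hτ, ?_, ?_⟩
  · exact tendsto_of_tendsto_of_tendsto_of_le_of_le tendsto_const_nhds
      tendsto_one_div_add_atTop_nhds_zero_nat (fun n => (hτ n).1.1.le) fun n => (hτ1 n).le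
  · refine tendsto_of_tendsto_of_tendsto_of_le_of_le tendsto_const_nhds ?_ (fun _ => zero_le)
      fun n => (hτ2 n).le
    have := (tendsto_add_atTop_iff_nat 1).2 ENNReal.tendsto_inv_nat_nhds_zero
    simpa using this

/-- A function in `H¹(0,T;L²(Ω))` is the sum of its initial value and the primitive of its time
derivative. -/
lemma IsTimeDeriv.ae_eq_primitive [IsFiniteMeasure (volume.restrict Ω)] {T : ℝ} (hT : 0 < T)
    {f g : ℝ → Eu d → ℝ} (h : IsTimeDeriv Ω T f g) {f₀ : Eu d → ℝ}
    (hf₀ : AEStronglyMeasurable f₀ (volume.restrict Ω)) (hinit : TendstoL2Zero Ω f f₀) :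
    (∀ᵐ x ∂volume.restrict Ω, ∀ᵐ t ∂volume.restrict (Ioo 0 T),
      f t x = f₀ x + ∫ r in (0 : ℝ)..t, g r x) ∧
    ∀ᵐ t ∂volume.restrict (Ioo 0 T), ∀ᵐ x ∂volume.restrict Ω,
      f t x = f₀ x + ∫ r in (0 : ℝ)..t, g r x := by
  set μ := (volume : Measure ℝ).restrict (Ioo 0 T) with hμ
  set ν := (volume : Measure (Eu d)).restrict Ω with hν
  have hfm := h.memLp.1
  have hgm := h.memLp_deriv.1
  rw [cyl_eq_prod] at hfm hgm
  set f' := hfm.mk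
  set g' := hgm.mk
  have hf' : StronglyMeasurable f' := hfm.stronglyMeasurable_mk
  have hg' : StronglyMeasurable g' := hgm.stronglyMeasurable_mk
  have hff' : ∀ᵐ p ∂μ.prod ν, f p.1 p.2 = f' p := hfm.ae_eq_mk
  have hgg' : ∀ᵐ p ∂μ.prod ν, g p.1 p.2 = g' p := hgm.ae_eq_mk
  have swap_ae : ∀ {P : ℝ × Eu d → Prop}, (∀ᵐ p ∂μ.prod ν, P p) →
      ∀ᵐ x ∂ν, ∀ᵐ t ∂μ, P (t, x) := fun hP =>
    Measure.ae_ae_of_ae_prod (Measure.measurePreserving_swap.quasiMeasurePreserving.ae hP)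
  -- a measurable version of the primitive
  set F : ℝ × Eu d → ℝ := fun p => ∫ r, (Iio p.1).indicator (fun r => g' (r, p.2)) r ∂μ with hF
  have hFm : StronglyMeasurable F := by
    have h1 : StronglyMeasurable fun q : (ℝ × Eu d) × ℝ =>
        {q : (ℝ × Eu d) × ℝ | q.2 < q.1.1}.indicator (fun q => g' (q.2, q.1.2)) q :=
      (hg'.comp_measurable (measurable_snd.prodMk (measurable_snd.comp measurable_fst))).indicator
        (measurableSet_lt measurable_snd (measurable_fst.comp measurable_fst))
    exact h1.integral_prod_right
  have hFeq : ∀ᵐ x ∂ν, ∀ t ∈ Ioo 0 T, F (t, x) = ∫ r in (0 : ℝ)..t, g r x := by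
    filter_upwards [swap_ae hgg'] with x hx t ht
    have e1 : F (t, x) = ∫ r, (Iio t).indicator (fun r => g r x) r ∂μ := by
      refine integral_congr_ae ?_
      filter_upwards [hx] with r hr
      by_cases hrt : r ∈ Iio t
      · simp only [indicator_of_mem hrt, hr]
      · simp only [indicator_of_notMem hrt]
    rw [e1, hμ, setIntegral_indicator measurableSet_Iio, ← setIntegral_Ioo_eq_interval ht.1.le]
    congr 2
    ext r
    simp only [mem_inter_iff, mem_Ioo, mem_Iio]
    constructor
    · exact fun hr => ⟨hr.1.1, hr.2⟩
    · exact fun hr => ⟨⟨hr.1, hr.2.trans ht.2⟩, hr.2⟩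
  -- a measurable version of the constant
  set c : Eu d → ℝ := fun x => T⁻¹ * ∫ t, (f' (t, x) - F (t, x)) ∂μ with hc
  have hcm : StronglyMeasurable c := (hf'.sub hFm).integral_prod_left.const_mul _
  have hTμ : μ.real univ = T := by simp [hμ, hT.le]
  have hmain : ∀ᵐ x ∂ν, ∀ᵐ t ∂μ, f' (t, x) = c x + F (t, x) := by
    filter_upwards [h.ae_exists_const hT, hFeq, swap_ae hff'] with x ⟨_, a, ha⟩ h2 h3
    have h4 : ∀ᵐ t ∂μ, f' (t, x) - F (t, x) = a := by
      filter_upwards [ha, h3, ae_restrict_mem measurableSet_Ioo] with t h5 h6 h7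
      rw [← h6, h5, h2 t h7]
      ring
    have hca : c x = a := by
      simp only [hc]
      rw [integral_congr_ae h4, integral_const, hTμ, smul_eq_mul, ← mul_assoc,
        inv_mul_cancel₀ hT.ne', one_mul]
    filter_upwards [h4] with t ht
    rw [hca, ← ht]
    ring
  -- Exchanging the two a.e. quantifiers requires a measurable set; this is the purpose of the
  -- measurable versions `f'`, `c` and `F`.
  have hmain' : ∀ᵐ t ∂μ, ∀ᵐ x ∂ν, f' (t, x) = c x + F (t, x) := by
    refine (Measure.ae_ae_comm ?_).1 hmain
    exact measurableSet_eq_fun (hf'.measurable.comp measurable_swap)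
      ((hcm.measurable.comp measurable_fst).add (hFm.measurable.comp measurable_swap))
  have hft : ∀ᵐ t ∂μ, ∀ᵐ x ∂ν, f t x = c x + ∫ r in (0 : ℝ)..t, g r x := by
    filter_upwards [hmain', Measure.ae_ae_of_ae_prod hff', ae_restrict_mem measurableSet_Ioo]
      with t h1 h2 h3
    filter_upwards [h1, h2, hFeq] with x h4 h5 h6
    rw [h5, h4, h6 t h3]
  -- identification of the constant
  have hc₀ : ∀ᵐ x ∂ν, c x = f₀ x := by
    have hsec : ∀ᵐ t ∂μ, AEStronglyMeasurable (f t) ν := hfm.prodMk_left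
    obtain ⟨τ, hτ, hτ0, hτL⟩ := hinit.exists_seq hT (hft.and hsec)
    obtain ⟨ns, hns, hae⟩ := (tendstoInMeasure_of_tendsto_eLpNorm two_ne_zero
      (fun n => (hτ n).2.2) hf₀ hτL).exists_seq_tendsto_ae
    filter_upwards [hae, ae_all_iff.2 fun n => (hτ n).2.1, h.ae_exists_const hT]
      with x h1 h2 ⟨h3, _⟩
    have hgi := intervalIntegrable_of_integrableOn_Ioo hT.le h3
    have hcont := (hgi.absolutelyContinuousOnInterval_intervalIntegral (c := 0)
      (by simp)).continuousOn
    rw [uIcc_of_le hT.le] at hcont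
    have hlim : Tendsto (fun n => ∫ r in (0 : ℝ)..τ n, g r x) atTop (𝓝 0) := by
      have := (hcont 0 ⟨le_rfl, hT.le⟩).tendsto.comp (tendsto_nhdsWithin_iff.2
        ⟨hτ0, .of_forall fun n => Ioo_subset_Icc_self (hτ n).1⟩)
      simpa [Function.comp_def] using this
    -- Along times tending to zero, `f` converges a.e. both to `c`, by the formula, and to `f₀`, by
    -- a subsequence of the `L²` convergence.
    have h4 := (hlim.comp hns.tendsto_atTop).const_add (c x)
    rw [add_zero] at h4
    exact tendsto_nhds_unique (h4.congr fun n => (h2 (ns n)).symm) h1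
  constructor
  · filter_upwards [hmain, swap_ae hff', hFeq, hc₀] with x h1 h2 h3 h4
    filter_upwards [h1, h2, ae_restrict_mem measurableSet_Ioo] with t h5 h6 h7
    rw [h6, h5, h3 t h7, h4]
  · filter_upwards [hft] with t ht
    filter_upwards [ht, hc₀] with x h1 h2
    rw [h1, h2]

end

end NSAC

namespace NSAC

/-! ## The integrands -/

section

variable {d : ℕ} {Ω : Set (Eu d)}

lemma inner_toVec (L : Eu d →L[ℝ] ℝ) (u : Eu d) : inner ℝ u (toVec L) = L u := by
  rw [real_inner_comm]
  exact InnerProductSpace.toDual_symm_apply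

lemma norm_toVec (L : Eu d →L[ℝ] ℝ) : ‖toVec L‖ = ‖L‖ := by
  simp [toVec]

lemma toVec_smul (c : ℝ) (L : Eu d →L[ℝ] ℝ) : toVec (c • L) = c • toVec L := by
  simp [toVec]

lemma inner_gradient (f : Eu d → ℝ) (x u : Eu d) : inner ℝ u (gradient f x) = fderiv ℝ f x u :=
  inner_toVec (fderiv ℝ f x) u

/-- The algebraic identity between the sum of all integrands and the flux terms. -/
lemma sum_integrands_eq {s a dϑ gB gV ϑ divB divξ q r L_v L_B L_vε w gφ gψ H dtφ I₃ : ℝ}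
    (hs : 0 < s) (h₃ : I₃ = ϑ * (r - q * gψ)) (hr : r = w * (L_B - L_v))
    (hAC : dtφ + L_vε = -(H / s ^ 2)) :
    a * (dϑ + gB) + a * ϑ * divB + I₃ - a * gV + ϑ * q * (gψ - s ^ 2 * gφ ^ 2)
      + (q * (s * gφ) - H / s) * ϑ * (s * gφ)
      + ϑ * (H / s + w / s * divξ) * (s * gφ - w / s)
      + ϑ * divξ * |s * gφ - w / s| ^ 2
      - ϑ * divξ * (s * gφ) * (s * gφ - w / s)
    = (a * dϑ + ϑ * (w * dtφ)) + (a * (gB + ϑ * divB) + ϑ * (w * L_B))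
      - (a * (gV + ϑ * (0 - 0)) + ϑ * (w * (L_v - L_vε))) := by
  have hdt : dtφ = -(H / s ^ 2) - L_vε := by linarith
  rw [sq_abs, h₃, hr, hdt]
  field_simp
  ring

lemma memLp_inner {α E : Type*} [MeasurableSpace α] {μ : Measure α} [NormedAddCommGroup E]
    [InnerProductSpace ℝ E] {p q r : ℝ≥0∞} [p.HolderTriple q r] {f g : α → E}
    (hf : MemLp f p μ) (hg : MemLp g q μ) : MemLp (fun x => inner ℝ (f x) (g x)) r μ :=
  MemLp.of_bilin (r := r) (fun x y => inner ℝ x y) 1 hf hg (hf.1.inner hg.1)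
    (.of_forall fun x => by
      simpa [← NNReal.coe_le_coe] using abs_real_inner_le_norm (f x) (g x))

lemma memLp_mul {α : Type*} [MeasurableSpace α] {μ : Measure α} {p q r : ℝ≥0∞}
    [p.HolderTriple q r] {f g : α → ℝ} (hf : MemLp f p μ) (hg : MemLp g q μ) :
    MemLp (fun x => f x * g x) r μ :=
  MemLp.of_bilin (r := r) (fun x y => x * y) 1 hf hg (hf.1.mul hg.1)
    (.of_forall fun x => by simp)

lemma MemLp.two_of_top {α E : Type*} [MeasurableSpace α] {μ : Measure α} [IsFiniteMeasure μ]
    [NormedAddCommGroup E] {f : α → E} (hf : MemLp f ⊤ μ) : MemLp f 2 μ :=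
  hf.mono_exponent le_top

lemma MemLp.integrable_of_top {α E : Type*} [MeasurableSpace α] {μ : Measure α} [IsFiniteMeasure μ]
    [NormedAddCommGroup E] {f : α → E} (hf : MemLp f ⊤ μ) : Integrable f μ :=
  hf.integrable le_top

/-- All integrands are absolutely integrable. -/
lemma integrable_integrands {α E : Type*} [MeasurableSpace α] {μ : Measure α} [IsFiniteMeasure μ]
    [NormedAddCommGroup E] [InnerProductSpace ℝ E] {a dϑ ϑ divB divξ w gφ gψ H : α → ℝ}
    {B v vε gradϑ n ξ : α → E} (s ε : ℝ)
    (ha : MemLp a ⊤ μ) (hdϑ : MemLp dϑ ⊤ μ) (hϑ : MemLp ϑ ⊤ μ) (hdivB : MemLp divB ⊤ μ)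
    (hdivξ : MemLp divξ ⊤ μ) (hw : MemLp w ⊤ μ) (hgφ : MemLp gφ 2 μ) (hgψ : MemLp gψ 2 μ)
    (hH : MemLp H 2 μ) (hB : MemLp B ⊤ μ) (hv : MemLp v ⊤ μ) (hvε : MemLp vε 2 μ)
    (hgradϑ : MemLp gradϑ ⊤ μ) (hn : MemLp n ⊤ μ) (hξ : MemLp ξ ⊤ μ) :
    Integrable (fun p => a p * (dϑ p + inner ℝ (B p) (gradϑ p))) μ ∧
    Integrable (fun p => a p * ϑ p * divB p) μ ∧
    Integrable (fun p => ϑ p * inner ℝ (B p - v p) (n p - ξ p) * gψ p) μ ∧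
    Integrable (fun p => a p * inner ℝ (v p - vε p) (gradϑ p)) μ ∧
    Integrable (fun p => ϑ p * inner ℝ (B p - v p) (ξ p) * (gψ p - ε * gφ p ^ 2)) μ ∧
    Integrable (fun p => (inner ℝ (B p - v p) (ξ p) * (s * gφ p) - H p / s) * ϑ p * (s * gφ p)) μ ∧
    Integrable (fun p => ϑ p * (H p / s + w p / s * divξ p) * (s * gφ p - w p / s)) μ ∧
    Integrable (fun p => ϑ p * divξ p * |s * gφ p - w p / s| ^ 2) μ ∧
    Integrable (fun p => ϑ p * divξ p * (s * gφ p) * (s * gφ p - w p / s)) μ := by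
  have hq : MemLp (fun p => inner ℝ (B p - v p) (ξ p)) ⊤ μ := memLp_inner (hB.sub hv) hξ
  have hws : MemLp (fun p => w p / s) ⊤ μ := by
    simpa only [div_eq_inv_mul] using hw.const_mul s⁻¹
  have hHs : MemLp (fun p => H p / s) 2 μ := by
    simpa only [div_eq_inv_mul] using hH.const_mul s⁻¹
  have hsg : MemLp (fun p => s * gφ p) 2 μ := hgφ.const_mul s
  have hdif : MemLp (fun p => s * gφ p - w p / s) 2 μ := hsg.sub (MemLp.two_of_top hws)
  have hgφ2 : Integrable (fun p => gφ p ^ 2) μ := hgφ.integrable_sq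
  have hϑξ : MemLp (fun p => ϑ p * divξ p) ⊤ μ := memLp_mul hϑ hdivξ
  have one : ∀ {f : α → ℝ}, MemLp f 1 μ → Integrable f μ := fun h => memLp_one_iff_integrable.1 h
  refine ⟨?_, ?_, ?_, ?_, ?_, ?_, ?_, ?_, ?_⟩
  · have h : MemLp (fun p => dϑ p + inner ℝ (B p) (gradϑ p)) ⊤ μ :=
      hdϑ.add (memLp_inner hB hgradϑ)
    exact MemLp.integrable_of_top (memLp_mul ha h)
  · have h : MemLp (fun p => a p * ϑ p) ⊤ μ := memLp_mul ha hϑ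
    exact MemLp.integrable_of_top (memLp_mul h hdivB)
  · have h : MemLp (fun p => inner ℝ (B p - v p) (n p - ξ p)) ⊤ μ :=
      memLp_inner (hB.sub hv) (hn.sub hξ)
    have h' : MemLp (fun p => ϑ p * inner ℝ (B p - v p) (n p - ξ p)) ⊤ μ := memLp_mul hϑ h
    have h'' : MemLp (fun p => ϑ p * inner ℝ (B p - v p) (n p - ξ p) * gψ p) 2 μ := memLp_mul h' hgψ
    exact h''.integrable one_le_two
  · have h : MemLp (fun p => inner ℝ (v p - vε p) (gradϑ p)) 2 μ :=
      memLp_inner ((MemLp.two_of_top hv).sub hvε) hgradϑ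
    have h' : MemLp (fun p => a p * inner ℝ (v p - vε p) (gradϑ p)) 2 μ := memLp_mul ha h
    exact h'.integrable one_le_two
  · have h : MemLp (fun p => ϑ p * inner ℝ (B p - v p) (ξ p)) ⊤ μ := memLp_mul hϑ hq
    have h' : MemLp (fun p => gψ p - ε * gφ p ^ 2) 1 μ :=
      memLp_one_iff_integrable.2 ((hgψ.integrable one_le_two).sub (hgφ2.const_mul ε))
    exact one (memLp_mul h h')
  · have h : MemLp (fun p => inner ℝ (B p - v p) (ξ p) * (s * gφ p)) 2 μ := memLp_mul hq hsg
    have h' : MemLp (fun p => (inner ℝ (B p - v p) (ξ p) * (s * gφ p) - H p / s) * ϑ p) 2 μ :=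
      memLp_mul (h.sub hHs) hϑ
    exact one (memLp_mul h' hsg)
  · have h : MemLp (fun p => w p / s * divξ p) 2 μ :=
      MemLp.two_of_top (memLp_mul (r := ⊤) hws hdivξ)
    have h' : MemLp (fun p => ϑ p * (H p / s + w p / s * divξ p)) 2 μ := memLp_mul hϑ (hHs.add h)
    exact one (memLp_mul h' hdif)
  · have h : MemLp (fun p => |s * gφ p - w p / s| ^ 2) 1 μ := by
      simp only [sq_abs]
      exact memLp_one_iff_integrable.2 hdif.integrable_sq
    exact one (memLp_mul hϑξ h)
  · have h : MemLp (fun p => ϑ p * divξ p * (s * gφ p)) 2 μ := memLp_mul hϑξ hsg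
    exact one (memLp_mul h hdif)

lemma integral_sum_nine {α : Type*} [MeasurableSpace α] {μ : Measure α}
    {f₁ f₂ f₃ f₄ f₅ f₆ f₇ f₈ f₉ : α → ℝ} (h₁ : Integrable f₁ μ) (h₂ : Integrable f₂ μ)
    (h₃ : Integrable f₃ μ) (h₄ : Integrable f₄ μ) (h₅ : Integrable f₅ μ) (h₆ : Integrable f₆ μ)
    (h₇ : Integrable f₇ μ) (h₈ : Integrable f₈ μ) (h₉ : Integrable f₉ μ) :
    Integrable (fun x => f₁ x + f₂ x + f₃ x - f₄ x + f₅ x + f₆ x + f₇ x + f₈ x - f₉ x) μ ∧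
    ∫ x, (f₁ x + f₂ x + f₃ x - f₄ x + f₅ x + f₆ x + f₇ x + f₈ x - f₉ x) ∂μ
      = (∫ x, f₁ x ∂μ) + (∫ x, f₂ x ∂μ) + (∫ x, f₃ x ∂μ) - (∫ x, f₄ x ∂μ) + (∫ x, f₅ x ∂μ)
        + (∫ x, f₆ x ∂μ) + (∫ x, f₇ x ∂μ) + (∫ x, f₈ x ∂μ) - (∫ x, f₉ x ∂μ) := by
  refine ⟨by fun_prop, ?_⟩
  rw [integral_sub (by fun_prop) h₉, integral_add (by fun_prop) h₈, integral_add (by fun_prop) h₇,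
    integral_add (by fun_prop) h₆, integral_add (by fun_prop) h₅, integral_sub (by fun_prop) h₄,
    integral_add (by fun_prop) h₃, integral_add h₁ h₂]

lemma stInt_eq_integral [IsFiniteMeasure (volume.restrict Ω)] {T : ℝ} {f : ℝ → Eu d → ℝ}
    (hf : Integrable (Function.uncurry f) (cyl Ω T)) :
    stInt Ω T f = ∫ p, Function.uncurry f p ∂cyl Ω T := by
  rw [cyl_eq_prod] at hf ⊢
  rw [integral_prod _ hf]
  rfl

/-! ## Chosen derivatives -/

lemma MemL2H1.isSpaceDeriv {F : Type*} [NormedAddCommGroup F] [NormedSpace ℝ F] {T : ℝ}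
    {f : ℝ → Eu d → F} (h : MemL2H1 Ω T f) : IsSpaceDeriv Ω T f (spaceDeriv Ω T f) := by
  have h' : ∃ g, IsSpaceDeriv Ω T f g := h
  rw [spaceDeriv, dif_pos h']
  exact h'.choose_spec

lemma MemH1L2.isTimeDeriv {F : Type*} [NormedAddCommGroup F] [NormedSpace ℝ F] {T : ℝ}
    {f : ℝ → Eu d → F} (h : MemH1L2 Ω T f) : IsTimeDeriv Ω T f (timeDeriv Ω T f) := by
  have h' : ∃ g, IsTimeDeriv Ω T f g := h
  rw [timeDeriv, dif_pos h']
  exact h'.choose_spec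

lemma cyl_mono {S T : ℝ} (h : S ≤ T) : cyl Ω S ≤ cyl Ω T :=
  Measure.restrict_mono (prod_mono (Ioo_subset_Ioo_right h) Subset.rfl) le_rfl

/-! ## Extension of the weight -/

/-- Good times are dense and `f` is Lipschitz in time, so the spatial bounds pass to the limit. The
endpoints `0` and `T`, at which the error functional is evaluated, are included. -/
lemma C01Bound.of_ae {F : Type*} [NormedAddCommGroup F] {S : Set (Eu d)} {T C : ℝ} (hT : 0 < T)
    {f : ℝ → Eu d → F}
    (h1 : ∀ t ∈ Icc 0 T, ∀ s ∈ Icc 0 T, ∀ x ∈ S, ‖f t x - f s x‖ ≤ C * |t - s|)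
    (h2 : ∀ᵐ t ∂volume.restrict (Ioo 0 T), C01Bound C S (f t)) :
    ∀ t ∈ Icc 0 T, C01Bound C S (f t) := by
  intro t ht
  rw [ae_restrict_iff' measurableSet_Ioo] at h2
  have hsub : Icc 0 T ⊆ closure (Ioo 0 T ∩ {t | t ∈ Ioo 0 T → C01Bound C S (f t)}) := by
    rw [← closure_Ioo hT.ne]
    exact closure_minimal ((Measure.dense_of_ae h2).open_subset_closure_inter isOpen_Ioo)
      isClosed_closure
  obtain ⟨τ, hτ, hτt⟩ := mem_closure_iff_seq_limit.1 (hsub ht)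
  have hlim : ∀ x ∈ S, Tendsto (fun n => f (τ n) x) atTop (𝓝 (f t x)) := fun x hx => by
    rw [tendsto_iff_norm_sub_tendsto_zero]
    have h3 : Tendsto (fun n => C * |τ n - t|) atTop (𝓝 0) := by
      have := ((tendsto_iff_norm_sub_tendsto_zero.1 hτt).const_mul C)
      simpa using this
    exact squeeze_zero (fun _ => norm_nonneg _)
      (fun n => h1 _ (Ioo_subset_Icc_self (hτ n).1) _ ht x hx) h3
  have hb : ∀ n, C01Bound C S (f (τ n)) := fun n => (hτ n).2 (hτ n).1
  exact ⟨fun x hx => le_of_tendsto' (hlim x hx).norm fun n => (hb n).1 x hx,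
    fun x hx y hy => le_of_tendsto' ((hlim x hx).sub (hlim y hy)).norm
      fun n => (hb n).2 x hx y hy⟩

lemma lipschitzOnWith_uncurry {F : Type*} [NormedAddCommGroup F] {S : Set (Eu d)} {T C : ℝ}
    {f : ℝ → Eu d → F}
    (h1 : ∀ t ∈ Icc 0 T, ∀ s ∈ Icc 0 T, ∀ x ∈ S, ‖f t x - f s x‖ ≤ C * |t - s|)
    (h2 : ∀ t ∈ Icc 0 T, C01Bound C S (f t)) :
    LipschitzOnWith (|C| + |C|).toNNReal (Function.uncurry f) (Icc 0 T ×ˢ S) := by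
  refine LipschitzOnWith.of_dist_le' ?_
  rintro ⟨t, x⟩ ⟨ht, hx⟩ ⟨s, y⟩ ⟨hs, hy⟩
  simp only [Function.uncurry]
  have e1 : |t - s| ≤ dist (t, x) (s, y) := le_max_left _ _
  have e2 : ‖x - y‖ ≤ dist (t, x) (s, y) := by
    rw [← dist_eq_norm]; exact le_max_right _ _
  calc dist (f t x) (f s y) ≤ dist (f t x) (f s x) + dist (f s x) (f s y) := dist_triangle _ _ _
    _ ≤ |C| * |t - s| + |C| * ‖x - y‖ := by
        rw [dist_eq_norm, dist_eq_norm]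
        gcongr
        · exact (h1 t ht s hs x hx).trans (by gcongr; exact le_abs_self C)
        · exact ((h2 s hs).2 x hx y hy).trans (by gcongr; exact le_abs_self C)
    _ ≤ |C| * dist (t, x) (s, y) + |C| * dist (t, x) (s, y) := by gcongr
    _ = _ := by ring

/-- A bounded Lipschitz function of time and space extends to all times and points. -/
lemma exists_lipschitz_extension {S : Set (Eu d)} {T C : ℝ} {f : ℝ → Eu d → ℝ}
    (h1 : ∀ t ∈ Icc 0 T, ∀ s ∈ Icc 0 T, ∀ x ∈ S, ‖f t x - f s x‖ ≤ C * |t - s|)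
    (h2 : ∀ t ∈ Icc 0 T, C01Bound C S (f t)) :
    ∃ (g : ℝ → Eu d → ℝ) (K : ℝ≥0), LipschitzWith K (Function.uncurry g) ∧
      (∀ t x, |g t x| ≤ |C|) ∧ ∀ t ∈ Icc 0 T, ∀ x ∈ S, g t x = f t x := by
  obtain ⟨g, hg, hfg⟩ := (lipschitzOnWith_uncurry h1 h2).extend_real
  refine ⟨fun t x => max (-|C|) (min (g (t, x)) |C|), _, (hg.min_const |C|).const_max (-|C|),
    fun t x => abs_le.2 ⟨le_max_left _ _, max_le (by linarith [abs_nonneg C]) (min_le_right _ _)⟩,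
    fun t ht x hx => ?_⟩
  have h3 : g (t, x) = f t x := (hfg ⟨ht, hx⟩).symm
  have h4 : |f t x| ≤ |C| := ((h2 t ht).1 x hx).trans (le_abs_self C)
  dsimp only
  rw [h3, min_eq_left (abs_le.1 h4).2, max_eq_right (abs_le.1 h4).1]

lemma LipschitzWith.uncurry_left {K : ℝ≥0} {g : ℝ → Eu d → ℝ}
    (hg : LipschitzWith K (Function.uncurry g)) (t : ℝ) : LipschitzWith K (g t) :=
  LipschitzWith.of_dist_le_mul fun x y => by
    simpa [Function.uncurry, Prod.dist_eq] using hg.dist_le_mul (t, x) (t, y)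

lemma LipschitzWith.uncurry_right {K : ℝ≥0} {g : ℝ → Eu d → ℝ}
    (hg : LipschitzWith K (Function.uncurry g)) (x : Eu d) : LipschitzWith K fun t => g t x :=
  LipschitzWith.of_dist_le_mul fun s t => by
    simpa [Function.uncurry, Prod.dist_eq] using hg.dist_le_mul (s, x) (t, x)

/-- A Lipschitz field on the closed domain has its classical divergence also weakly. -/
lemma C01Bound.hasLipDiv [IsFiniteMeasure (volume.restrict Ω)] (hΩ : IsOpen Ω)
    (hΩb : Bornology.IsBounded Ω) {C : ℝ} {B : Eu d → Eu d} (h : C01Bound C (closure Ω) B) :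
    HasLipDiv Ω B (divg B) := by
  -- The field is extended to the whole space component by component, in the sup norm, and carried
  -- back to the Euclidean norm. On the open set `Ω` values and differentials are unchanged.
  have hpi : LipschitzOnWith C.toNNReal (fun x i => B x i) (closure Ω) :=
    LipschitzOnWith.of_dist_le_mul fun x hx y hy => by
      refine le_trans ?_ (h.lipschitzOnWith.dist_le_mul x hx y hy)
      refine (dist_pi_le_iff dist_nonneg).2 fun i => ?_
      rw [dist_eq_norm, dist_eq_norm]
      exact PiLp.norm_apply_le (B x - B y) i
  obtain ⟨g, hg, hgB⟩ := hpi.extend_pi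
  have hto : LipschitzWith _ fun x => (WithLp.toLp 2 (g x) : Eu d) :=
    (PiLp.lipschitzWith_toLp 2 fun _ : Fin d => ℝ).comp hg
  have heq : ∀ x ∈ Ω, (WithLp.toLp 2 (g x) : Eu d) = B x := fun x hx => by
    rw [← hgB (subset_closure hx)]
  have hfd : ∀ x ∈ Ω, fderiv ℝ (fun x => (WithLp.toLp 2 (g x) : Eu d)) x = fderiv ℝ B x :=
    fun x hx => Filter.EventuallyEq.fderiv_eq (by
      filter_upwards [hΩ.mem_nhds hx] with y hy using heq y hy)
  have hL := LipschitzWith.hasLipDiv hΩb hΩ.measurableSet hto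
  refine ⟨(memLp_congr_ae ?_).1 hL.memLp, (memLp_congr_ae ?_).1 hL.memLp_div,
    fun q K hq hqc hqs => ?_⟩
  · filter_upwards [ae_restrict_mem hΩ.measurableSet] with x hx using heq x hx
  · filter_upwards [ae_restrict_mem hΩ.measurableSet] with x hx
    rw [hfd x hx, divg]
  · rw [← hL.eq_zero q K hq hqc hqs]
    refine setIntegral_congr_fun hΩ.measurableSet fun x hx => ?_
    simp only [divg, hfd x hx, heq x hx]

end

end NSAC

namespace NSAC

/-! ## The phase field -/

/-- The converse of Fubini for null sets fails without measurability; it is applied to the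
measurable representative of `f`, whose sections agree with those of `f` for a.e. `x`. -/
lemma ae_prod_of_ae_ae {α β E : Type*} [MeasurableSpace α] [MeasurableSpace β] [MeasurableSpace E]
    {μ : Measure α} {ν : Measure β} [SFinite μ] [SFinite ν] {f : α × β → E}
    (hf : AEMeasurable f (μ.prod ν)) {S : Set E} (hS : MeasurableSet S)
    (h : ∀ᵐ x ∂μ, ∀ᵐ y ∂ν, f (x, y) ∈ S) : ∀ᵐ p ∂μ.prod ν, f p ∈ S := by
  have h1 : ∀ᵐ p ∂μ.prod ν, hf.mk f p ∈ S := by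
    refine (Measure.ae_prod_iff_ae_ae (hf.measurable_mk hS)).2 ?_
    filter_upwards [h, Measure.ae_ae_of_ae_prod hf.ae_eq_mk] with x hx hx'
    filter_upwards [hx, hx'] with y hy hy'
    rwa [← hy']
  filter_upwards [h1, hf.ae_eq_mk] with p hp hp'
  rwa [hp']

section

variable {d : ℕ} {Ω : Set (Eu d)}

lemma IsSpaceDeriv.ae_eq {F : Type*} [NormedAddCommGroup F] [NormedSpace ℝ F] [CompleteSpace F]
    (hΩ : IsOpen Ω) {T : ℝ} {f : ℝ → Eu d → F} {g g' : ℝ → Eu d → Eu d →L[ℝ] F}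
    (h : IsSpaceDeriv Ω T f g) (h' : IsSpaceDeriv Ω T f g') :
    Function.uncurry g =ᵐ[cyl Ω T] Function.uncurry g' := by
  have hm := (h.memLp_deriv.1.sub h'.memLp_deriv.1).aemeasurable
  rw [cyl_eq_prod] at hm ⊢
  have := ae_prod_of_ae_ae hm (measurableSet_singleton 0) (by
    filter_upwards [h.weak, h'.weak] with t ht ht'
    filter_upwards [ht.ae_eq hΩ ht'] with x hx
    simp [Function.uncurry, hx])
  filter_upwards [this] with p hp
  exact sub_eq_zero.1 hp

lemma IsTest.integral_fderiv_eq_zero {η : Eu d → ℝ} (hη : IsTest Ω η) (e : Eu d) :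
    ∫ x in Ω, fderiv ℝ η x e = 0 := by
  rw [setIntegral_eq_integral_of_forall_compl_eq_zero fun x hx => by
    rw [fderiv_eq_zero_of_notMem_tsupport fun h => hx (hη.support h)]; rfl]
  obtain ⟨K, hK⟩ := ContDiff.lipschitzWith_of_hasCompactSupport hη.compact
    hη.smooth (by simp)
  simpa using integral_fderiv_mul_add hK hη.compact (LipschitzWith.const (1 : ℝ)) e

/-- The boundary condition concerns `φ + 1`, the chosen differential concerns `φ`; this identifies
the two differentials. -/
lemma HasWeakFDeriv.sub_const [IsFiniteMeasure (volume.restrict Ω)] {f : Eu d → ℝ}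
    {g : Eu d → Eu d →L[ℝ] ℝ} (h : HasWeakFDeriv Ω f g) (c : ℝ) :
    HasWeakFDeriv Ω (fun x => f x - c) g := by
  refine ⟨h.1.sub (IntegrableOn.locallyIntegrableOn (integrable_const c)), h.2.1,
    fun η hη e => ?_⟩
  rw [← h.2.2 η hη e]
  have hc : Continuous fun x => fderiv ℝ η x e :=
    (hη.smooth.continuous_fderiv (by simp)).clm_apply continuous_const
  have hs : HasCompactSupport fun x => fderiv ℝ η x e := hη.compact.fderiv_apply ℝ e
  have hs' : tsupport (fun x => fderiv ℝ η x e) ⊆ Ω :=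
    (tsupport_fderiv_apply_subset ℝ e).trans hη.support
  have h1 : IntegrableOn (fun x => fderiv ℝ η x e • f x) Ω :=
    (integrable_smul_of_locallyIntegrableOn h.1 hc hs hs').integrableOn
  have h2 : IntegrableOn (fun x => fderiv ℝ η x e) Ω :=
    (hc.integrable_of_hasCompactSupport hs).integrableOn
  have h3 : ∫ x in Ω, fderiv ℝ η x e * c = 0 := by
    rw [integral_mul_const, hη.integral_fderiv_eq_zero e, zero_mul]
  simp only [smul_eq_mul, mul_sub] at h1 ⊢
  rw [integral_sub h1 (h2.mul_const c), h3, sub_zero]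

section

variable {W : ℝ → ℝ} {ε T₀ : ℝ} {φ₀ : Eu d → ℝ}
  {vε₀ : Eu d → Eu d} {φ : ℝ → Eu d → ℝ} {vε : ℝ → Eu d → Eu d}

lemma IsWeakSolution.ae_range (h : IsWeakSolution Ω W ε T₀ φ₀ vε₀ φ vε) :
    ∀ᵐ t ∂volume.restrict (Ioo 0 T₀), ∀ᵐ x ∂volume.restrict Ω, φ t x ∈ Icc (-1 : ℝ) 1 := by
  have := h.φ_range
  rw [cyl_eq_prod] at this
  exact Measure.ae_ae_of_ae_prod this

/-- The primitive vanishes at the boundary value `-1`, so composition keeps zero trace and the chain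
rule survives in the limit. The range `[-1, 1]` of `φ` permits the globally Lipschitz substitute for
`primW W`. -/
lemma IsWeakSolution.isC1Approx_psi [IsFiniteMeasure (volume.restrict Ω)] (hΩ : IsOpen Ω)
    (hW : Continuous W) (h : IsWeakSolution Ω W ε T₀ φ₀ vε₀ φ vε) :
    ∀ᵐ t ∂volume.restrict (Ioo 0 T₀), ∃ q, IsC1Approx Ω (psi W φ t)
      (fun x => √(2 * W (φ t x)) • spaceDeriv Ω T₀ φ t x) q := by
  obtain ⟨G, G', M, hM, hG'c, hG, hb, h0, hGW⟩ := exists_lipschitz_primW hW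
  filter_upwards [h.bdry_φ, h.φ_L2H2.1.isSpaceDeriv.weak, h.ae_range] with t ht hD hr
  obtain ⟨g, p, hg, hp⟩ := ht.exists_isC1Approx
  have hgD := hg.ae_eq hΩ (hD.sub_const (-1))
  obtain ⟨q, hq⟩ := (hp.congr_deriv hgD).comp hM hG'c hG hb h0
  refine ⟨q, (hq.congr ?_).congr_deriv ?_⟩
  · filter_upwards [hr] with x hx using (hGW _ hx).1
  · filter_upwards [hr] with x hx
    rw [(hGW _ hx).2]

lemma IsWeakSolution.memLp_comp (h : IsWeakSolution Ω W ε T₀ φ₀ vε₀ φ vε)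
    {f : ℝ → ℝ} (hf : Continuous f) : MemLp (fun p : ℝ × Eu d => f (φ p.1 p.2)) ⊤ (cyl Ω T₀) := by
  obtain ⟨C, hC⟩ := isCompact_Icc.exists_bound_of_continuousOn (s := Icc (-1 : ℝ) 1) hf.continuousOn
  refine memLp_top_of_bound (hf.comp_aestronglyMeasurable h.φ_L2H2.1.isSpaceDeriv.memLp.1) C ?_
  filter_upwards [h.φ_range] with p hp using hC _ hp

lemma IsWeakSolution.isSpaceDeriv_psi [IsFiniteMeasure (volume.restrict Ω)] (hΩ : IsOpen Ω)
    (hW : Continuous W) (h : IsWeakSolution Ω W ε T₀ φ₀ vε₀ φ vε) :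
    IsSpaceDeriv Ω T₀ (psi W φ) fun t x => √(2 * W (φ t x)) • spaceDeriv Ω T₀ φ t x where
  memLp := MemLp.two_of_top (h.memLp_comp (continuous_primW hW))
  memLp_deriv := by
    have h1 : MemLp (fun p : ℝ × Eu d => √(2 * W (φ p.1 p.2))) ⊤ (cyl Ω T₀) :=
      h.memLp_comp (f := fun s => √(2 * W s)) (by fun_prop)
    have h2 := h.φ_L2H2.1.isSpaceDeriv.memLp_deriv
    exact h2.smul h1
  weak := by
    filter_upwards [h.isC1Approx_psi hΩ hW] with t ⟨q, hq⟩ using hq.hasWeakFDeriv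

lemma IsWeakSolution.spaceDeriv_psi [IsFiniteMeasure (volume.restrict Ω)] (hΩ : IsOpen Ω)
    (hW : Continuous W) (h : IsWeakSolution Ω W ε T₀ φ₀ vε₀ φ vε) :
    ∀ᵐ p ∂cyl Ω T₀, spaceDeriv Ω T₀ (psi W φ) p.1 p.2
      = √(2 * W (φ p.1 p.2)) • spaceDeriv Ω T₀ φ p.1 p.2 := by
  have h' : MemL2H1 Ω T₀ (psi W φ) := ⟨_, h.isSpaceDeriv_psi hΩ hW⟩
  exact h'.isSpaceDeriv.ae_eq hΩ (h.isSpaceDeriv_psi hΩ hW)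

lemma MemL2H1.memLp_norm_spaceGrad {T : ℝ} {f : ℝ → Eu d → ℝ} (h : MemL2H1 Ω T f) :
    MemLp (fun p : ℝ × Eu d => ‖spaceGrad Ω T f p.1 p.2‖) 2 (cyl Ω T) := by
  simp only [spaceGrad, norm_toVec]
  exact h.isSpaceDeriv.memLp_deriv.norm

lemma IsWeakSolution.memLp_curvEps [IsFiniteMeasure (volume.restrict Ω)] (hW : ContDiff ℝ 2 W)
    (h : IsWeakSolution Ω W ε T₀ φ₀ vε₀ φ vε) :
    MemLp (fun p : ℝ × Eu d => curvEps Ω W ε T₀ φ p.1 p.2) 2 (cyl Ω T₀) := by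
  have h1 : MemLp (fun p : ℝ × Eu d => deriv W (φ p.1 p.2)) 2 (cyl Ω T₀) :=
    MemLp.two_of_top (h.memLp_comp (hW.continuous_deriv (by simp)))
  have h2 : MemLp (fun p : ℝ × Eu d => spaceLap Ω T₀ φ p.1 p.2) 2 (cyl Ω T₀) := by
    refine memLp_finsetSum _ fun i _ => ?_
    exact ((ContinuousLinearMap.apply ℝ ℝ (basisVec i)).comp
      (ContinuousLinearMap.apply ℝ (Eu d →L[ℝ] ℝ) (basisVec i))).comp_memLp'
        h.φ_L2H2.2.isSpaceDeriv.memLp_deriv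
  exact (h2.const_mul (-ε)).add (h1.const_mul (1 / ε))

lemma MemL2H1.memLp_normalEps {T : ℝ} {f : ℝ → Eu d → ℝ} (h : MemL2H1 Ω T f) {s : Eu d}
    (hs : ‖s‖ = 1) : MemLp (fun p : ℝ × Eu d => normalEps Ω T s f p.1 p.2) ⊤ (cyl Ω T) := by
  have hg : AEStronglyMeasurable (fun p : ℝ × Eu d => spaceGrad Ω T f p.1 p.2) (cyl Ω T) :=
    (InnerProductSpace.toDual ℝ (Eu d)).symm.continuous.comp_aestronglyMeasurable
      h.isSpaceDeriv.memLp_deriv.1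
  have hm : Measurable fun z : Eu d =>
      (open Classical in if z = 0 then s else ‖z‖⁻¹ • z : Eu d) := by
    classical
    exact Measurable.ite (measurableSet_singleton 0) measurable_const
      (measurable_norm.inv.smul measurable_id)
  refine memLp_top_of_bound (hm.comp_aemeasurable hg.aemeasurable).aestronglyMeasurable 1
    (.of_forall fun p => ?_)
  simp only [normalEps]
  split_ifs with h0
  · exact hs.le
  · rw [norm_smul, norm_inv, norm_norm, inv_mul_cancel₀ (norm_ne_zero_iff.2 h0)]

lemma norm_smul_normalEps {T : ℝ} {f : ℝ → Eu d → ℝ} {s : Eu d} (t : ℝ) (x : Eu d) :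
    ‖spaceGrad Ω T f t x‖ • normalEps Ω T s f t x = spaceGrad Ω T f t x := by
  simp only [normalEps]
  split_ifs with h0
  · simp [h0]
  · rw [smul_smul, mul_inv_cancel₀ (norm_ne_zero_iff.2 h0), one_smul]

end

end

end NSAC

namespace NSAC

/-! ## The calibrating fields, the weight, and the velocity of the sharp interface model -/

section

variable {d : ℕ} {Ω : Set (Eu d)} {Ts T : ℝ}

lemma memLp_divg_of_C01 (hΩ : IsOpen Ω) (hΩb : Bornology.IsBounded Ω) {C : ℝ}
    {B : ℝ → Eu d → Eu d} (hB : AEStronglyMeasurable (Function.uncurry B) (cyl Ω T))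
    (hC : ∀ᵐ t ∂volume.restrict (Ioo 0 T), C01Bound C Ω (B t)) :
    MemLp (fun p : ℝ × Eu d => B p.1 p.2) ⊤ (cyl Ω T) ∧
      MemLp (fun p : ℝ × Eu d => divg (B p.1) p.2) ⊤ (cyl Ω T) := by
  have hb : ∀ᵐ p ∂cyl Ω T, C01Bound C Ω (B p.1) := ae_cyl_of_ae_time hC
  refine ⟨memLp_top_of_bound hB C ?_, memLp_top_of_bound ?_ (‖trCLM d‖ * C) ?_⟩
  · filter_upwards [hb, ae_cyl_mem hΩ.measurableSet] with p hp hx using hp.1 _ hx.2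
  · simp only [divg, ← trCLM_apply]
    exact (trCLM d).continuous.comp_aestronglyMeasurable
      (aestronglyMeasurable_fderiv_of_C01 hΩ hΩb hB hC)
  · filter_upwards [hb, ae_cyl_mem hΩ.measurableSet] with p hp hx
    refine (abs_trL_le _).trans ?_
    gcongr
    exact hp.norm_fderiv_le hΩ hx.2

lemma C01Bound.mono {F : Type*} [NormedAddCommGroup F] {C : ℝ} {S S' : Set (Eu d)}
    {f : Eu d → F} (h : C01Bound C S' f) (hS : S ⊆ S') : C01Bound C S f :=
  ⟨fun x hx => h.1 x (hS hx), fun x hx y hy => h.2 x (hS hx) y (hS hy)⟩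

lemma IsBField.memLp (hΩ : IsOpen Ω) (hΩb : Bornology.IsBounded Ω) {B : ℝ → Eu d → Eu d}
    (h : IsBField Ω Ts B) (hT : T ∈ Ico 0 Ts) :
    MemLp (fun p : ℝ × Eu d => B p.1 p.2) ⊤ (cyl Ω T) ∧
      MemLp (fun p : ℝ × Eu d => divg (B p.1) p.2) ⊤ (cyl Ω T) := by
  obtain ⟨C, hC⟩ := h.2 T hT
  exact memLp_divg_of_C01 hΩ hΩb (h.1.mono_measure (cyl_mono hT.2.le))
    (hC.mono fun t ht => ht.mono subset_closure)

lemma IsBField.hasLipDiv [IsFiniteMeasure (volume.restrict Ω)] (hΩ : IsOpen Ω)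
    (hΩb : Bornology.IsBounded Ω) {B : ℝ → Eu d → Eu d}
    (h : IsBField Ω Ts B) (hT : T ∈ Ico 0 Ts) :
    ∀ᵐ t ∂volume.restrict (Ioo 0 T), HasLipDiv Ω (B t) (divg (B t)) := by
  obtain ⟨C, hC⟩ := h.2 T hT
  exact hC.mono fun t ht => ht.hasLipDiv hΩ hΩb

lemma IsXiField.memLp (hΩ : IsOpen Ω) (hΩb : Bornology.IsBounded Ω) {ξ : ℝ → Eu d → Eu d}
    (h : IsXiField Ω Ts ξ) (hT0 : 0 < T) (hT : T < Ts) :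
    MemLp (fun p : ℝ × Eu d => ξ p.1 p.2) ⊤ (cyl Ω T) ∧
      MemLp (fun p : ℝ × Eu d => divg (ξ p.1) p.2) ⊤ (cyl Ω T) := by
  obtain ⟨C, h1, h2⟩ := h T ⟨hT0.le, hT⟩
  have h3 : ∀ᵐ t ∂volume.restrict (Ioo 0 T), C01Bound C Ω (ξ t) := h2.mono fun t ht => ht.2.2.1
  -- Joint measurability of `ξ` comes from its Lipschitz continuity in time and space together.
  have hc := (lipschitzOnWith_uncurry h1 (C01Bound.of_ae hT0 h1 h3)).continuousOn
  refine memLp_divg_of_C01 hΩ hΩb ?_ h3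
  exact (hc.mono (prod_mono Ioo_subset_Icc_self Subset.rfl)).aestronglyMeasurable
    (measurableSet_Ioo.prod hΩ.measurableSet)

lemma IsStrongSolution.memLp_v (hΩ : IsOpen Ω) {c₀ : ℝ} {χ₀ : Eu d → ℝ} {v₀ : Eu d → Eu d}
    {χ : ℝ → Eu d → ℝ} {v : ℝ → Eu d → Eu d} (h : IsStrongSolution Ω c₀ Ts χ₀ v₀ χ v)
    (hT : T ∈ Ico 0 Ts) : MemLp (fun p : ℝ × Eu d => v p.1 p.2) ⊤ (cyl Ω T) := by
  obtain ⟨C, hC⟩ := h.v_C1 T hT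
  refine memLp_top_of_bound (h.v_L2H1.isSpaceDeriv.memLp.1.mono_measure (cyl_mono hT.2.le)) C ?_
  filter_upwards [ae_cyl_of_ae_time hC, ae_cyl_mem hΩ.measurableSet] with p hp hx
  exact (hp.2 _ hx.2).1

lemma IsStrongSolution.memLp_χ (hΩ : IsOpen Ω) {c₀ : ℝ} {χ₀ : Eu d → ℝ} {v₀ : Eu d → Eu d}
    {χ : ℝ → Eu d → ℝ} {v : ℝ → Eu d → Eu d} (h : IsStrongSolution Ω c₀ Ts χ₀ v₀ χ v)
    (hT : T ∈ Ico 0 Ts) : MemLp (fun p : ℝ × Eu d => χ p.1 p.2) ⊤ (cyl Ω T) := by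
  refine memLp_top_of_bound (h.χ_measurable.mono_measure (cyl_mono hT.2.le)) 1 ?_
  filter_upwards [ae_cyl_mem hΩ.measurableSet] with p hx
  rcases h.χ_range p.1 ⟨hx.1.1.le, hx.1.2.trans hT.2⟩ p.2 hx.2 with h0 | h0 <;> simp [h0]

/-- A globally Lipschitz weight that agrees with `ϑ` on `Ω × [0,T]`. -/
structure IsWeightExtension (Ω : Set (Eu d)) (T : ℝ) (ϑ Θ : ℝ → Eu d → ℝ) (K : ℝ≥0) (C : ℝ) :
    Prop where
  lipschitz : LipschitzWith K (Function.uncurry Θ)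
  bound : ∀ t x, |Θ t x| ≤ C
  eq : ∀ t ∈ Icc 0 T, ∀ x ∈ Ω, Θ t x = ϑ t x

lemma IsWeight.exists_extension {χ ϑ : ℝ → Eu d → ℝ} (h : IsWeight Ω Ts χ ϑ) (hT0 : 0 < T)
    (hT : T < Ts) : ∃ Θ K C, IsWeightExtension Ω T ϑ Θ K C := by
  obtain ⟨C, h1, h2⟩ := h.regular T ⟨hT0.le, hT⟩
  obtain ⟨Θ, K, hK, hb, he⟩ := exists_lipschitz_extension h1 (C01Bound.of_ae hT0 h1 h2)
  exact ⟨Θ, K, |C|, hK, hb, fun t ht x hx => he t ht x (subset_closure hx)⟩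

lemma LipschitzWith.memLp_derivs {μ : Measure (ℝ × Eu d)} {K : ℝ≥0} {Θ : ℝ → Eu d → ℝ}
    (h : LipschitzWith K (Function.uncurry Θ)) :
    MemLp (fun p : ℝ × Eu d => deriv (fun r => Θ r p.2) p.1) ⊤ μ ∧
      MemLp (fun p : ℝ × Eu d => gradient (Θ p.1) p.2) ⊤ μ := by
  constructor
  · refine memLp_top_of_bound (Measurable.aestronglyMeasurable ?_) K (.of_forall fun p =>
      norm_deriv_le_of_lipschitz (LipschitzWith.uncurry_right h p.2))
    have h1 : Continuous (Function.uncurry fun (x : Eu d) (r : ℝ) => Θ r x) :=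
      h.continuous.comp continuous_swap
    exact (measurable_deriv_with_param h1).comp measurable_swap
  · have h1 : StronglyMeasurable fun p : ℝ × Eu d => fderiv ℝ (Θ p.1) p.2 :=
      (measurable_fderiv_with_param ℝ h.continuous).stronglyMeasurable
    refine memLp_top_of_bound ((InnerProductSpace.toDual ℝ (Eu d)).symm.continuous.comp_stronglyMeasurable
      h1).aestronglyMeasurable K (.of_forall fun p => ?_)
    rw [gradient, LinearIsometryEquiv.norm_map]
    exact norm_fderiv_le_of_lipschitz ℝ (LipschitzWith.uncurry_left h p.1)

namespace IsWeightExtension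

variable {ϑ Θ : ℝ → Eu d → ℝ} {K : ℝ≥0} {C : ℝ}

lemma fderiv_eq (h : IsWeightExtension Ω T ϑ Θ K C) (hΩ : IsOpen Ω) {t : ℝ} (ht : t ∈ Icc 0 T)
    {x : Eu d} (hx : x ∈ Ω) : fderiv ℝ (ϑ t) x = fderiv ℝ (Θ t) x :=
  Filter.EventuallyEq.fderiv_eq (by
    filter_upwards [hΩ.mem_nhds hx] with y hy using (h.eq t ht y hy).symm)

lemma deriv_eq (h : IsWeightExtension Ω T ϑ Θ K C) {t : ℝ} (ht : t ∈ Ioo 0 T)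
    {x : Eu d} (hx : x ∈ Ω) : deriv (fun r => ϑ r x) t = deriv (fun r => Θ r x) t :=
  Filter.EventuallyEq.deriv_eq (by
    filter_upwards [Ioo_mem_nhds ht.1 ht.2] with r hr
    exact (h.eq r (Ioo_subset_Icc_self hr) x hx).symm)

lemma memLp (h : IsWeightExtension Ω T ϑ Θ K C) (hΩ : IsOpen Ω) :
    MemLp (fun p : ℝ × Eu d => ϑ p.1 p.2) ⊤ (cyl Ω T) ∧
      MemLp (fun p : ℝ × Eu d => deriv (fun r => ϑ r p.2) p.1) ⊤ (cyl Ω T) ∧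
      MemLp (fun p : ℝ × Eu d => gradient (ϑ p.1) p.2) ⊤ (cyl Ω T) := by
  have hd := LipschitzWith.memLp_derivs (μ := cyl Ω T) h.lipschitz
  refine ⟨(memLp_congr_ae ?_).1 (memLp_top_of_bound (μ := cyl Ω T)
    h.lipschitz.continuous.aestronglyMeasurable C (.of_forall fun p => h.bound p.1 p.2)),
    (memLp_congr_ae ?_).1 hd.1, (memLp_congr_ae ?_).1 hd.2⟩
  · filter_upwards [ae_cyl_mem hΩ.measurableSet] with p hp
    exact h.eq _ (Ioo_subset_Icc_self hp.1) _ hp.2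
  · filter_upwards [ae_cyl_mem hΩ.measurableSet] with p hp using (h.deriv_eq hp.1 hp.2).symm
  · filter_upwards [ae_cyl_mem hΩ.measurableSet] with p hp
    rw [gradient, gradient, h.fderiv_eq hΩ (Ioo_subset_Icc_self hp.1) hp.2]

end IsWeightExtension

end

end NSAC

namespace NSAC

/-! ## The balance of the volume error -/

lemma ae_ae_swap_of_ae_prod {α β : Type*} [MeasurableSpace α] [MeasurableSpace β]
    {μ : Measure α} {ν : Measure β} [SFinite μ] [SFinite ν] {P : α × β → Prop}
    (h : ∀ᵐ p ∂μ.prod ν, P p) : ∀ᵐ y ∂ν, ∀ᵐ x ∂μ, P (x, y) :=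
  Measure.ae_ae_of_ae_prod
    ((Measure.measurePreserving_swap (μ := ν) (ν := μ)).quasiMeasurePreserving.ae h)

section

variable {d : ℕ} {Ω : Set (Eu d)} {Ts T : ℝ}

/-- As `0 ≤ primW W φ ≤ surfTension W`, the two factors inside the absolute values are both
nonpositive where `χ = 1` and both nonnegative where `χ = 0`. -/
lemma volDensity_eq {W : ℝ → ℝ} (hW : Continuous W) {φ χ ϑ : Eu d → ℝ} {x : Eu d}
    (hφ : φ x ∈ Icc (-1 : ℝ) 1) (h : (χ x = 1 ∧ ϑ x < 0) ∨ (χ x = 0 ∧ 0 < ϑ x)) :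
    volDensity W φ χ ϑ x = primW W (φ x) * ϑ x - surfTension W * min (ϑ x) 0 := by
  have hp := primW_mem_Icc hW hφ
  rcases h with ⟨h1, h2⟩ | ⟨h1, h2⟩
  · rw [volDensity, h1, abs_of_neg h2, abs_of_nonpos (by linarith [hp.2]), min_eq_left h2.le]
    ring
  · rw [volDensity, h1, abs_of_pos h2, abs_of_nonneg (by linarith [hp.1]), min_eq_right h2.le]
    ring

/-- The form with `min(ϑ, 0)` is free of `χ`, so measurability of `χ` at the single given time is
not needed. -/
lemma integrableOn_volDensity [IsFiniteMeasure (volume.restrict Ω)] (hΩ : MeasurableSet Ω)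
    {W : ℝ → ℝ} (hW : Continuous W) {φ χ ϑ Θ : Eu d → ℝ} {C : ℝ}
    (hφm : AEStronglyMeasurable φ (volume.restrict Ω))
    (hφ : ∀ᵐ x ∂volume.restrict Ω, φ x ∈ Icc (-1 : ℝ) 1)
    (h : ∀ᵐ x ∂volume.restrict Ω, (χ x = 1 ∧ ϑ x < 0) ∨ (χ x = 0 ∧ 0 < ϑ x))
    (hΘ : Continuous Θ) (hb : ∀ x, |Θ x| ≤ C) (he : ∀ x ∈ Ω, Θ x = ϑ x) :
    IntegrableOn (volDensity W φ χ ϑ) Ω := by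
  have h1 : MemLp (fun x => primW W (φ x)) ⊤ (volume.restrict Ω) := by
    refine memLp_top_of_bound ((continuous_primW hW).comp_aestronglyMeasurable hφm)
      (surfTension W) ?_
    filter_upwards [hφ] with x hx
    have hp := primW_mem_Icc hW hx
    rw [Real.norm_eq_abs, abs_of_nonneg hp.1]
    exact hp.2
  have h2 : MemLp Θ ⊤ (volume.restrict Ω) :=
    memLp_top_of_bound hΘ.aestronglyMeasurable C (.of_forall hb)
  have h3 : MemLp (fun x => min (Θ x) 0) ⊤ (volume.restrict Ω) :=
    memLp_top_of_bound (hΘ.min continuous_const).aestronglyMeasurable C (.of_forall fun x => by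
      refine le_trans ?_ (hb x)
      rw [Real.norm_eq_abs, abs_le]
      exact ⟨le_min (neg_abs_le _) (by simp), (min_le_left _ _).trans (le_abs_self _)⟩)
  have h4 : MemLp (fun x => primW W (φ x) * Θ x) ⊤ (volume.restrict Ω) := memLp_mul h1 h2
  refine (MemLp.integrable_of_top (h4.sub (h3.const_mul (surfTension W)))).congr ?_
  filter_upwards [hφ, h, ae_restrict_mem hΩ] with x hx hx' hxΩ
  rw [volDensity_eq hW hx hx', ← he x hxΩ]
  rfl

lemma IsStrongSolution.ae_phase (hΩ : IsOpen Ω) (hΩb : Bornology.IsBounded Ω)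
    {c₀ : ℝ} {χ₀ : Eu d → ℝ} {v₀ : Eu d → Eu d} {χ : ℝ → Eu d → ℝ} {v : ℝ → Eu d → Eu d}
    (h : IsStrongSolution Ω c₀ Ts χ₀ v₀ χ v) {ϑ : ℝ → Eu d → ℝ} (hϑ : IsWeight Ω Ts χ ϑ) {t : ℝ}
    (ht : t ∈ Ico 0 Ts) :
    ∀ᵐ x ∂volume.restrict Ω, (χ t x = 1 ∧ ϑ t x < 0) ∨ (χ t x = 0 ∧ 0 < ϑ t x) := by
  obtain ⟨ho, -, -, hf⟩ := h.phaseSet_regular hΩ hΩb ht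
  exact ae_phase_iff_weight hΩ (h.χ_range t ht) ho hf (hϑ.neg t ht) (hϑ.pos t ht)

/-- The flux of `(f - c χ) ϑ` along a vector field vanishes. -/
lemma IsStrongSolution.integral_flux [IsFiniteMeasure (volume.restrict Ω)] (hΩ : IsOpen Ω)
    (hΩb : Bornology.IsBounded Ω)
    {c₀ : ℝ} {χ₀ : Eu d → ℝ} {v₀ : Eu d → Eu d} {χ : ℝ → Eu d → ℝ} {v : ℝ → Eu d → Eu d}
    (h : IsStrongSolution Ω c₀ Ts χ₀ v₀ χ v) {ϑ Θ : ℝ → Eu d → ℝ} (hϑ : IsWeight Ω Ts χ ϑ)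
    {K : ℝ≥0} {C : ℝ} (hΘ : IsWeightExtension Ω T ϑ Θ K C) {t : ℝ} (ht : t ∈ Ioo 0 T) (hT : T < Ts)
    {f : Eu d → ℝ} {g : Eu d → Eu d →L[ℝ] ℝ} {p : ℕ → Eu d → ℝ} (hp : IsC1Approx Ω f g p)
    {u : Eu d → Eu d} {τ : Eu d → ℝ} (hu : HasLipDiv Ω u τ) (c : ℝ) :
    IntegrableOn (fun x => (f x - c * χ t x) * (fderiv ℝ (ϑ t) x (u x) + ϑ t x * τ x)
      + ϑ t x * g x (u x)) Ω ∧
    ∫ x in Ω, ((f x - c * χ t x) * (fderiv ℝ (ϑ t) x (u x) + ϑ t x * τ x)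
      + ϑ t x * g x (u x)) = 0 := by
  have htT : t ∈ Icc 0 T := Ioo_subset_Icc_self ht
  have hts : t ∈ Ico 0 Ts := ⟨ht.1.le, ht.2.trans hT⟩
  have hL := LipschitzWith.uncurry_left hΘ.lipschitz t
  obtain ⟨-, hKc, hKΩ, -⟩ := h.phaseSet_regular hΩ hΩb hts
  have hϑc : ContinuousOn (ϑ t) Ω := hL.continuous.continuousOn.congr fun x hx =>
    (hΘ.eq t htT x hx).symm
  have hw := weight_nonneg_off_phase hΩ (h.χ_range t hts) hϑc (hϑ.pos t hts)
  have key := hu.integral_sub_indicator hΩ hp hL (hΘ.bound t) (χ := χ t) (by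
    filter_upwards [h.ae_phase hΩ hΩb hϑ hts, ae_restrict_mem hΩ.measurableSet] with x hx hxΩ
    rwa [hΘ.eq t htT x hxΩ]) hKc hKΩ (fun x hx => by rw [hΘ.eq t htT x hx.1]; exact hw x hx) c
  have he : ∀ᵐ x ∂volume.restrict Ω,
      (f x - c * χ t x) * (fderiv ℝ (Θ t) x (u x) + Θ t x * τ x) + Θ t x * g x (u x)
      = (f x - c * χ t x) * (fderiv ℝ (ϑ t) x (u x) + ϑ t x * τ x) + ϑ t x * g x (u x) := by
    filter_upwards [ae_restrict_mem hΩ.measurableSet] with x hx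
    rw [hΘ.eq t htT x hx, hΘ.fderiv_eq hΩ htT hx]
  exact ⟨key.1.congr he, (integral_congr_ae he).symm.trans key.2⟩

/-- The change of the volume error in terms of the time derivatives. -/
lemma integral_time_flux [IsFiniteMeasure (volume.restrict Ω)] (hΩ : IsOpen Ω)
    (hΩb : Bornology.IsBounded Ω) {W : ℝ → ℝ} (hW : Continuous W)
    {ε T₀ : ℝ} {φ₀ : Eu d → ℝ} {vε₀ : Eu d → Eu d} {φ : ℝ → Eu d → ℝ} {vε : ℝ → Eu d → Eu d}
    (hweak : IsWeakSolution Ω W ε T₀ φ₀ vε₀ φ vε)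
    {c₀ : ℝ} {χ₀ : Eu d → ℝ} {v₀ : Eu d → Eu d} {χ : ℝ → Eu d → ℝ} {v : ℝ → Eu d → Eu d}
    (h : IsStrongSolution Ω c₀ Ts χ₀ v₀ χ v) {ϑ Θ : ℝ → Eu d → ℝ} (hϑ : IsWeight Ω Ts χ ϑ)
    {K : ℝ≥0} {C : ℝ} (hΘ : IsWeightExtension Ω T ϑ Θ K C) (hT0 : 0 < T) (hT : T < Ts)
    (hTs : Ts ≤ T₀)
    (hφm : AEStronglyMeasurable (φ T) (volume.restrict Ω))
    (hφr : ∀ᵐ x ∂volume.restrict Ω, φ T x ∈ Icc (-1 : ℝ) 1)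
    (hφT : ∀ᵐ x ∂volume.restrict Ω, φ T x = φ₀ x + ∫ r in (0 : ℝ)..T, timeDeriv Ω T₀ φ r x)
    (hint : Integrable (fun p : ℝ × Eu d => (psi W φ p.1 p.2 - surfTension W * χ p.1 p.2)
      * deriv (fun r => ϑ r p.2) p.1
      + ϑ p.1 p.2 * (√(2 * W (φ p.1 p.2)) * timeDeriv Ω T₀ φ p.1 p.2)) (cyl Ω T)) :
    ∫ p, ((psi W φ p.1 p.2 - surfTension W * χ p.1 p.2) * deriv (fun r => ϑ r p.2) p.1
      + ϑ p.1 p.2 * (√(2 * W (φ p.1 p.2)) * timeDeriv Ω T₀ φ p.1 p.2)) ∂cyl Ω T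
    = Evol Ω W (φ T) (χ T) (ϑ T) - Evol Ω W φ₀ (χ 0) (ϑ 0) := by
  obtain ⟨G, G', M, hM, -, hG, hb, -, hGW⟩ := exists_lipschitz_primW hW
  have hT₀ : 0 < T₀ := hT0.trans (hT.trans_le hTs)
  have hsub : Ioo 0 T ⊆ Ioo 0 T₀ := Ioo_subset_Ioo_right (hT.le.trans hTs)
  have hz : (0 : ℝ) ∈ Icc 0 T := ⟨le_rfl, hT0.le⟩
  have hTm : T ∈ Icc 0 T := ⟨hT0.le, le_rfl⟩
  have htd := hweak.φ_H1L2.isTimeDeriv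
  have hφ₀m := hweak.init_φ.1.1
  have hprim := (htd.ae_eq_primitive hT₀ hφ₀m hweak.init_attained).1
  have hgi := htd.ae_exists_const hT₀
  have hrange : ∀ᵐ x ∂volume.restrict Ω, ∀ᵐ t ∂volume.restrict (Ioo 0 T),
      φ t x ∈ Icc (-1 : ℝ) 1 := by
    have := hweak.φ_range
    rw [cyl_eq_prod] at this
    filter_upwards [ae_ae_swap_of_ae_prod this] with x hx
    exact ae_restrict_of_ae_restrict_of_subset hsub hx
  -- The sign relation is known at each time for a.e. `x`. The argument along time lines needs it at
  -- a.e. `x` for a.e. time, which takes joint measurability of `χ` and of the extended weight.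
  have hphase : ∀ᵐ x ∂volume.restrict Ω, ∀ᵐ t ∂volume.restrict (Ioo 0 T),
      (χ t x = 1 ∧ Θ t x < 0) ∨ (χ t x = 0 ∧ 0 < Θ t x) := by
    have hm : AEMeasurable (fun p : ℝ × Eu d => (χ p.1 p.2, Θ p.1 p.2))
        ((volume.restrict (Ioo 0 T)).prod (volume.restrict Ω)) := by
      rw [← cyl_eq_prod]
      exact ((h.χ_measurable.mono_measure (cyl_mono hT.le)).aemeasurable).prodMk
        hΘ.lipschitz.continuous.measurable.aemeasurable
    have hS : MeasurableSet {z : ℝ × ℝ | (z.1 = 1 ∧ z.2 < 0) ∨ (z.1 = 0 ∧ 0 < z.2)} := by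
      measurability
    refine ae_ae_swap_of_ae_prod (ae_prod_of_ae_ae hm hS ?_)
    filter_upwards [ae_restrict_mem measurableSet_Ioo] with t ht
    filter_upwards [h.ae_phase hΩ hΩb hϑ ⟨ht.1.le, ht.2.trans hT⟩,
      ae_restrict_mem hΩ.measurableSet] with x hx hxΩ
    simpa only [hΘ.eq t (Ioo_subset_Icc_self ht) x hxΩ] using hx
  have h0 := h.ae_phase hΩ hΩb hϑ (t := 0) ⟨le_rfl, hT0.trans hT⟩
  have h1 := h.ae_phase hΩ hΩb hϑ (t := T) ⟨hT0.le, hT⟩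
  have hi0 : IntegrableOn (volDensity W φ₀ (χ 0) (ϑ 0)) Ω :=
    integrableOn_volDensity hΩ.measurableSet hW hφ₀m hweak.init_range h0
      (LipschitzWith.uncurry_left hΘ.lipschitz 0).continuous (hΘ.bound 0) (hΘ.eq 0 hz)
  have hi1 : IntegrableOn (volDensity W (φ T) (χ T) (ϑ T)) Ω :=
    integrableOn_volDensity hΩ.measurableSet hW hφm hφr h1
      (LipschitzWith.uncurry_left hΘ.lipschitz T).continuous (hΘ.bound T) (hΘ.eq T hTm)
  rw [cyl_eq_prod] at hint ⊢
  rw [integral_prod_symm _ hint, Evol, Evol, ← integral_sub hi1 hi0]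
  refine integral_congr_ae ?_
  filter_upwards [hprim, hgi, hrange, hphase, h0, h1, hφr, hφT, hweak.init_range,
    ae_restrict_mem hΩ.measurableSet] with x hx1 hx2 hx3 hx4 hx5 hx6 hx7 hx8 hx9 hxΩ
  have key := integral_time_deriv (κ := surfTension W) hT0 (hx2.1.mono_set hsub)
    (ae_restrict_of_ae_restrict_of_subset hsub hx1)
    (LipschitzWith.uncurry_right hΘ.lipschitz x) hM hG hb hx4
  rw [← hx8, (hGW _ hx7).1, (hGW _ hx9).1, hΘ.eq T hTm x hxΩ, hΘ.eq 0 hz x hxΩ,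
    ← volDensity_eq hW hx7 hx6, ← volDensity_eq hW hx9 hx5] at key
  rw [← key]
  refine integral_congr_ae ?_
  filter_upwards [hx3, ae_restrict_mem measurableSet_Ioo] with t ht htT
  rw [(hGW _ ht).1, (hGW _ ht).2, ← hΘ.deriv_eq htT hxΩ, hΘ.eq t (Ioo_subset_Icc_self htT) x hxΩ,
    psi]

end

end NSAC

/-! ### Assembly of the identity for the volume error -/

namespace NSAC

section

variable {d : ℕ} {Ω : Set (Eu d)}

/-- With `c = √(2W(φ))` this is `|∇ψ| n_ε = √(2W(φ))∇φ`. The default value `s` is harmless, since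
both sides vanish where `∇φ = 0`. -/
lemma norm_smul_normalEps_of_eq {T₀ c : ℝ} {φ ψ : ℝ → Eu d → ℝ} {s : Eu d} {t : ℝ} {x : Eu d}
    (hc : 0 ≤ c) (h : spaceDeriv Ω T₀ ψ t x = c • spaceDeriv Ω T₀ φ t x) :
    ‖spaceGrad Ω T₀ ψ t x‖ • normalEps Ω T₀ s φ t x = c • spaceGrad Ω T₀ φ t x := by
  have h1 : spaceGrad Ω T₀ ψ t x = c • spaceGrad Ω T₀ φ t x := by
    rw [spaceGrad, spaceGrad, h, toVec_smul]
  rw [h1, norm_smul, Real.norm_of_nonneg hc, mul_smul, norm_smul_normalEps]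

end

end NSAC

theorem lemma5p1 {d : ℕ} (hd : d = 2 ∨ d = 3)
    (Ω : Set (NSAC.Eu d)) (hΩ : NSAC.IsC2Domain Ω)
    (W : ℝ → ℝ) (hW : NSAC.IsDoubleWell W)
    (Ts T₀ ε : ℝ) (hTs : 0 < Ts) (hT₀ : Ts ≤ T₀) (hε : ε ∈ Set.Ioo (0 : ℝ) 1)
    -- the phase-field solution and its initial data
    (φ₀ : NSAC.Eu d → ℝ) (vε₀ : NSAC.Eu d → NSAC.Eu d)
    (φ : ℝ → NSAC.Eu d → ℝ) (vε : ℝ → NSAC.Eu d → NSAC.Eu d)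
    (hweak : NSAC.IsWeakSolution Ω W ε T₀ φ₀ vε₀ φ vε)
    -- the sharp interface solution and its initial data
    (χ₀ : NSAC.Eu d → ℝ) (v₀ : NSAC.Eu d → NSAC.Eu d)
    (χ : ℝ → NSAC.Eu d → ℝ) (v : ℝ → NSAC.Eu d → NSAC.Eu d)
    (hstrong : NSAC.IsStrongSolution Ω (NSAC.surfTension W) Ts χ₀ v₀ χ v)
    -- the vector fields, the weight, and the default value of the phase-field normal
    (ξ B : ℝ → NSAC.Eu d → NSAC.Eu d) (ϑ : ℝ → NSAC.Eu d → ℝ)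
    (hξ : NSAC.IsXiField Ω Ts ξ) (hB : NSAC.IsBField Ω Ts B) (hϑ : NSAC.IsWeight Ω Ts χ ϑ)
    (s : NSAC.Eu d) (hs : ‖s‖ = 1) :
    let c₀ : ℝ := NSAC.surfTension W
    let ψ : ℝ → NSAC.Eu d → ℝ := NSAC.psi W φ
    let n : ℝ → NSAC.Eu d → NSAC.Eu d := NSAC.normalEps Ω T₀ s φ
    let H : ℝ → NSAC.Eu d → ℝ := NSAC.curvEps Ω W ε T₀ φ
    -- `|∇φ|`, `|∇ψ|` and `√(2W(φ))`
    let gφ : ℝ → NSAC.Eu d → ℝ := fun t x => ‖NSAC.spaceGrad Ω T₀ φ t x‖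
    let gψ : ℝ → NSAC.Eu d → ℝ := fun t x => ‖NSAC.spaceGrad Ω T₀ ψ t x‖
    let w : ℝ → NSAC.Eu d → ℝ := fun t x => √(2 * W (φ t x))
    let I₁ : ℝ → NSAC.Eu d → ℝ := fun t x =>
      (ψ t x - c₀ * χ t x) * (deriv (fun r => ϑ r x) t + inner ℝ (B t x) (gradient (ϑ t) x))
    let I₂ : ℝ → NSAC.Eu d → ℝ := fun t x =>
      (ψ t x - c₀ * χ t x) * ϑ t x * NSAC.divg (B t) x
    let I₃ : ℝ → NSAC.Eu d → ℝ := fun t x =>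
      ϑ t x * inner ℝ (B t x - v t x) (n t x - ξ t x) * gψ t x
    let I₄ : ℝ → NSAC.Eu d → ℝ := fun t x =>
      (ψ t x - c₀ * χ t x) * inner ℝ (v t x - vε t x) (gradient (ϑ t) x)
    let I₅ : ℝ → NSAC.Eu d → ℝ := fun t x =>
      ϑ t x * inner ℝ (B t x - v t x) (ξ t x) * (gψ t x - ε * gφ t x ^ 2)
    let I₆ : ℝ → NSAC.Eu d → ℝ := fun t x =>
      (inner ℝ (B t x - v t x) (ξ t x) * (√ε * gφ t x) - H t x / √ε) * ϑ t x * (√ε * gφ t x)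
    let I₇ : ℝ → NSAC.Eu d → ℝ := fun t x =>
      ϑ t x * (H t x / √ε + w t x / √ε * NSAC.divg (ξ t) x) * (√ε * gφ t x - w t x / √ε)
    let I₈ : ℝ → NSAC.Eu d → ℝ := fun t x =>
      ϑ t x * NSAC.divg (ξ t) x * |√ε * gφ t x - w t x / √ε| ^ 2
    let I₉ : ℝ → NSAC.Eu d → ℝ := fun t x =>
      ϑ t x * NSAC.divg (ξ t) x * (√ε * gφ t x) * (√ε * gφ t x - w t x / √ε)
    -- `ψ` lies in `L²(0,T₀;H¹(Ω))`, so that `∇ψ` makes sense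
    NSAC.MemL2H1 Ω T₀ ψ ∧
    MeasureTheory.IntegrableOn (NSAC.volDensity W φ₀ (χ 0) (ϑ 0)) Ω ∧
    ∀ᵐ T ∂MeasureTheory.volume.restrict (Set.Ioo 0 Ts),
      -- all integrals converge absolutely
      MeasureTheory.IntegrableOn (NSAC.volDensity W (φ T) (χ T) (ϑ T)) Ω ∧
      (∀ I ∈ [I₁, I₂, I₃, I₄, I₅, I₆, I₇, I₈, I₉],
        MeasureTheory.Integrable (Function.uncurry I) (NSAC.cyl Ω T)) ∧
      NSAC.Evol Ω W (φ T) (χ T) (ϑ T) =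
        NSAC.Evol Ω W φ₀ (χ 0) (ϑ 0)
          + NSAC.stInt Ω T I₁ + NSAC.stInt Ω T I₂ + NSAC.stInt Ω T I₃ - NSAC.stInt Ω T I₄
          + NSAC.stInt Ω T I₅ + NSAC.stInt Ω T I₆ + NSAC.stInt Ω T I₇ + NSAC.stInt Ω T I₈
          - NSAC.stInt Ω T I₉ := by

  intro c₀ ψ n H gφ gψ w I₁ I₂ I₃ I₄ I₅ I₆ I₇ I₈ I₉
  have hΩo := hΩ.isOpen
  have hΩb := hΩ.isBounded
  have hWc : Continuous W := hW.contDiff.continuous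
  have hT₀p : 0 < T₀ := hTs.trans_le hT₀
  have : IsFiniteMeasure (volume.restrict Ω) := ⟨by simpa using hΩb.measure_lt_top⟩
  have hψ : NSAC.MemL2H1 Ω T₀ ψ := ⟨_, hweak.isSpaceDeriv_psi hΩo hWc⟩
  have hφ := hweak.φ_L2H2.1
  have htd := hweak.φ_H1L2.isTimeDeriv
  have hsub : Ioo 0 Ts ⊆ Ioo 0 T₀ := Ioo_subset_Ioo_right hT₀
  refine ⟨hψ, ?_, ?_⟩
  -- Any time strictly between `0` and `Ts` would do; only the extended weight at time `0` is
  -- needed.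
  · have hT2 : 0 < Ts / 2 := half_pos hTs
    obtain ⟨Θ, K, C, hΘ⟩ := hϑ.exists_extension hT2 (half_lt_self hTs)
    exact NSAC.integrableOn_volDensity hΩo.measurableSet hWc hweak.init_φ.1.1 hweak.init_range
      (hstrong.ae_phase hΩo hΩb hϑ ⟨le_rfl, hTs⟩)
      (NSAC.LipschitzWith.uncurry_left hΘ.lipschitz 0).continuous (hΘ.bound 0)
      (hΘ.eq 0 ⟨le_rfl, hT2.le⟩)
  have hφm : ∀ᵐ T ∂volume.restrict (Ioo 0 T₀), AEStronglyMeasurable (φ T) (volume.restrict Ω) := by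
    have := hφ.isSpaceDeriv.memLp.1
    rw [NSAC.cyl_eq_prod] at this
    exact this.prodMk_left
  -- The values `φ T` belong to the absolutely continuous representative only for a.e. `T`, one
  -- reason why the identity holds for a.e. `T`.
  have hprim := (htd.ae_eq_primitive hT₀p hweak.init_φ.1.1 hweak.init_attained).2
  filter_upwards [ae_restrict_of_ae_restrict_of_subset hsub hφm,
    ae_restrict_of_ae_restrict_of_subset hsub hprim,
    ae_restrict_of_ae_restrict_of_subset hsub hweak.ae_range,
    ae_restrict_mem measurableSet_Ioo] with T hTm hTp hTr hT
  have hTI : T ∈ Ico 0 Ts := ⟨hT.1.le, hT.2⟩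
  have hle : NSAC.cyl Ω T ≤ NSAC.cyl Ω T₀ := NSAC.cyl_mono (hT.2.le.trans hT₀)
  have hsubT : Ioo 0 T ⊆ Ioo 0 T₀ := Ioo_subset_Ioo_right (hT.2.le.trans hT₀)
  have hsubTs : Ioo 0 T ⊆ Ioo 0 Ts := Ioo_subset_Ioo_right hT.2.le
  obtain ⟨Θ, K, C, hΘ⟩ := hϑ.exists_extension hT.1 hT.2
  obtain ⟨mϑ, mdϑ, mgϑ⟩ := hΘ.memLp hΩo
  obtain ⟨mB, mdB⟩ := hB.memLp hΩo hΩb hTI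
  obtain ⟨mξ, mdξ⟩ := hξ.memLp hΩo hΩb hT.1 hT.2
  have mψ : MemLp (fun p : ℝ × NSAC.Eu d => ψ p.1 p.2) ⊤ (NSAC.cyl Ω T) :=
    (hweak.memLp_comp (NSAC.continuous_primW hWc)).mono_measure hle
  have mw : MemLp (fun p : ℝ × NSAC.Eu d => w p.1 p.2) ⊤ (NSAC.cyl Ω T) :=
    (hweak.memLp_comp (f := fun r => √(2 * W r)) (by fun_prop)).mono_measure hle
  have ma : MemLp (fun p : ℝ × NSAC.Eu d => ψ p.1 p.2 - c₀ * χ p.1 p.2) ⊤ (NSAC.cyl Ω T) :=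
    mψ.sub ((hstrong.memLp_χ hΩo hTI).const_mul c₀)
  have mdt : MemLp (fun p : ℝ × NSAC.Eu d => NSAC.timeDeriv Ω T₀ φ p.1 p.2) 2 (NSAC.cyl Ω T) :=
    htd.memLp_deriv.mono_measure hle
  obtain ⟨i₁, i₂, i₃, i₄, i₅, i₆, i₇, i₈, i₉⟩ :=
    NSAC.integrable_integrands (√ε) ε ma mdϑ mϑ mdB mdξ mw (hφ.memLp_norm_spaceGrad.mono_measure hle)
      (hψ.memLp_norm_spaceGrad.mono_measure hle)
      ((hweak.memLp_curvEps hW.contDiff).mono_measure hle) mB (hstrong.memLp_v hΩo hTI)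
      (hweak.v_L2H1.isSpaceDeriv.memLp.mono_measure hle) mgϑ
      ((hφ.memLp_normalEps hs).mono_measure hle) mξ
  refine ⟨NSAC.integrableOn_volDensity hΩo.measurableSet hWc hTm hTr
      (hstrong.ae_phase hΩo hΩb hϑ hTI)
      (NSAC.LipschitzWith.uncurry_left hΘ.lipschitz T).continuous (hΘ.bound T)
      (hΘ.eq T ⟨hT.1.le, le_rfl⟩), ?_, ?_⟩
  · simp only [List.forall_mem_cons, List.not_mem_nil, false_imp_iff, implies_true, and_true]
    exact ⟨i₁, i₂, i₃, i₄, i₅, i₆, i₇, i₈, i₉⟩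
  obtain ⟨isum, hsum⟩ := NSAC.integral_sum_nine i₁ i₂ i₃ i₄ i₅ i₆ i₇ i₈ i₉
  have mT₂ : MemLp (fun p : ℝ × NSAC.Eu d => w p.1 p.2 * NSAC.timeDeriv Ω T₀ φ p.1 p.2) 2
      (NSAC.cyl Ω T) := NSAC.memLp_mul mw mdt
  have mT₃ : MemLp (fun p : ℝ × NSAC.Eu d =>
      ϑ p.1 p.2 * (w p.1 p.2 * NSAC.timeDeriv Ω T₀ φ p.1 p.2)) 2 (NSAC.cyl Ω T) :=
    NSAC.memLp_mul mϑ mT₂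
  have mT₁ : MemLp (fun p : ℝ × NSAC.Eu d => (ψ p.1 p.2 - c₀ * χ p.1 p.2)
      * deriv (fun r => ϑ r p.2) p.1) ⊤ (NSAC.cyl Ω T) := NSAC.memLp_mul ma mdϑ
  have iT := (NSAC.MemLp.integrable_of_top mT₁).add (mT₃.integrable one_le_two)
  have htime := NSAC.integral_time_flux hΩo hΩb hWc hweak hstrong hϑ hΘ hT.1 hT.2 hT₀ hTm hTr hTp iT
  -- Pointwise, the nine integrands add up to the time derivative part, plus the flux density along
  -- `B`, minus the one along `v - vε`. The unsimplified `0 - 0` is the divergence of `v - vε` in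
  -- the form delivered by `HasLipDiv.sub`.
  have hpt : ∀ᵐ p ∂NSAC.cyl Ω T,
      I₁ p.1 p.2 + I₂ p.1 p.2 + I₃ p.1 p.2 - I₄ p.1 p.2 + I₅ p.1 p.2 + I₆ p.1 p.2 + I₇ p.1 p.2
        + I₈ p.1 p.2 - I₉ p.1 p.2
      = ((ψ p.1 p.2 - c₀ * χ p.1 p.2) * deriv (fun r => ϑ r p.2) p.1
          + ϑ p.1 p.2 * (w p.1 p.2 * NSAC.timeDeriv Ω T₀ φ p.1 p.2))
        + ((ψ p.1 p.2 - c₀ * χ p.1 p.2) * (fderiv ℝ (ϑ p.1) p.2 (B p.1 p.2)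
            + ϑ p.1 p.2 * NSAC.divg (B p.1) p.2)
          + ϑ p.1 p.2 * (w p.1 p.2 * NSAC.spaceDeriv Ω T₀ φ p.1 p.2 (B p.1 p.2)))
        - ((ψ p.1 p.2 - c₀ * χ p.1 p.2) * (fderiv ℝ (ϑ p.1) p.2 (v p.1 p.2 - vε p.1 p.2)
            + ϑ p.1 p.2 * (0 - 0))
          + ϑ p.1 p.2 * (w p.1 p.2 * (NSAC.spaceDeriv Ω T₀ φ p.1 p.2 (v p.1 p.2)
            - NSAC.spaceDeriv Ω T₀ φ p.1 p.2 (vε p.1 p.2)))) := by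
    filter_upwards [ae_mono hle hweak.allen_cahn, ae_mono hle (hweak.spaceDeriv_psi hΩo hWc)]
      with ⟨t, x⟩ hac hsd
    have hnorm := NSAC.norm_smul_normalEps_of_eq (s := s) (Real.sqrt_nonneg _) hsd
    have hs2 : √ε ^ 2 = ε := Real.sq_sqrt hε.1.le
    have hε0 : ε ≠ 0 := hε.1.ne'
    have key := NSAC.sum_integrands_eq (s := √ε) (a := ψ t x - c₀ * χ t x)
      (dϑ := deriv (fun r => ϑ r x) t) (gB := fderiv ℝ (ϑ t) x (B t x))
      (gV := fderiv ℝ (ϑ t) x (v t x - vε t x)) (ϑ := ϑ t x) (divB := NSAC.divg (B t) x)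
      (divξ := NSAC.divg (ξ t) x) (q := inner ℝ (B t x - v t x) (ξ t x))
      (r := inner ℝ (B t x - v t x) (gψ t x • n t x)) (w := w t x)
      (L_v := NSAC.spaceDeriv Ω T₀ φ t x (v t x)) (L_B := NSAC.spaceDeriv Ω T₀ φ t x (B t x))
      (L_vε := NSAC.spaceDeriv Ω T₀ φ t x (vε t x)) (gφ := gφ t x) (gψ := gψ t x) (H := H t x)
      (dtφ := NSAC.timeDeriv Ω T₀ φ t x) (I₃ := I₃ t x) (Real.sqrt_pos.2 hε.1)
      (by simp only [I₃, inner_sub_right, inner_smul_right]; ring)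
      (by
        rw [hnorm, inner_smul_right, NSAC.spaceGrad, NSAC.inner_toVec, map_sub])
      (by
        rw [hs2, hac]
        simp only [H, NSAC.curvEps]
        field_simp
        ring)
    rw [hs2] at key
    simp only [I₁, I₂, I₄, I₅, I₆, I₇, I₈, I₉, NSAC.inner_gradient]
    exact key
  -- At a.e. time both flux densities integrate to zero over `Ω`, which leaves the time derivative
  -- part. This is done slice by slice because the `H¹₀` approximations of `ψ`, `v` and `vε` exist
  -- at individual times.
  have hslice : ∀ᵐ t ∂volume.restrict (Ioo 0 T),
      ∫ x in Ω, (I₁ t x + I₂ t x + I₃ t x - I₄ t x + I₅ t x + I₆ t x + I₇ t x + I₈ t x - I₉ t x)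
      = ∫ x in Ω, ((ψ t x - c₀ * χ t x) * deriv (fun r => ϑ r x) t
          + ϑ t x * (w t x * NSAC.timeDeriv Ω T₀ φ t x)) := by
    have iT' := iT
    rw [NSAC.cyl_eq_prod] at hpt iT'
    filter_upwards [Measure.ae_ae_of_ae_prod hpt, iT'.prod_right_ae,
      ae_restrict_of_ae_restrict_of_subset hsubT (hweak.isC1Approx_psi hΩo hWc),
      hB.hasLipDiv hΩo hΩb hTI,
      ae_restrict_of_ae_restrict_of_subset hsubTs hstrong.div_free,
      ae_restrict_of_ae_restrict_of_subset hsubTs hstrong.bdry_v,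
      ae_restrict_of_ae_restrict_of_subset hsubT hweak.div_free,
      ae_restrict_of_ae_restrict_of_subset hsubT hweak.bdry_v,
      ae_restrict_mem measurableSet_Ioo] with t h1 h2 ⟨q, hq⟩ h4 h5 h6 h7 h8 ht
    obtain ⟨j1, e1⟩ := hstrong.integral_flux hΩo hΩb hϑ hΘ ht hT.2 hq h4 c₀
    obtain ⟨j2, e2⟩ := hstrong.integral_flux hΩo hΩb hϑ hΘ ht hT.2 hq
      ((h5.hasLipDiv hΩo h6).sub (h7.hasLipDiv hΩo h8)) c₀
    have e3 := integral_sub (Integrable.add h2 j1) j2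
    have e4 := integral_add h2 j1
    simp only [Pi.add_apply] at e3 e4
    rw [e4, e1, e2, add_zero] at e3
    refine (integral_congr_ae ?_).trans (e3.trans (sub_zero _))
    filter_upwards [h1] with x hx
    rw [hx, ← map_sub]
    rfl
  have hmain : ∫ p, (I₁ p.1 p.2 + I₂ p.1 p.2 + I₃ p.1 p.2 - I₄ p.1 p.2 + I₅ p.1 p.2 + I₆ p.1 p.2
        + I₇ p.1 p.2 + I₈ p.1 p.2 - I₉ p.1 p.2) ∂NSAC.cyl Ω T
      = ∫ p, ((ψ p.1 p.2 - c₀ * χ p.1 p.2) * deriv (fun r => ϑ r p.2) p.1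
          + ϑ p.1 p.2 * (w p.1 p.2 * NSAC.timeDeriv Ω T₀ φ p.1 p.2)) ∂NSAC.cyl Ω T := by
    have isum' : Integrable (fun p : ℝ × NSAC.Eu d => I₁ p.1 p.2 + I₂ p.1 p.2 + I₃ p.1 p.2
      - I₄ p.1 p.2 + I₅ p.1 p.2 + I₆ p.1 p.2 + I₇ p.1 p.2 + I₈ p.1 p.2 - I₉ p.1 p.2)
      (NSAC.cyl Ω T) := isum
    have iT' := iT
    rw [NSAC.cyl_eq_prod] at isum' iT' ⊢
    rw [integral_prod _ isum']
    exact (integral_congr_ae hslice).trans (integral_prod _ iT').symm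
  have hevol := hmain.symm.trans hsum
  rw [NSAC.stInt_eq_integral (f := I₁) i₁, NSAC.stInt_eq_integral (f := I₂) i₂,
    NSAC.stInt_eq_integral (f := I₃) i₃, NSAC.stInt_eq_integral (f := I₄) i₄,
    NSAC.stInt_eq_integral (f := I₅) i₅, NSAC.stInt_eq_integral (f := I₆) i₆,
    NSAC.stInt_eq_integral (f := I₇) i₇, NSAC.stInt_eq_integral (f := I₈) i₈,
    NSAC.stInt_eq_integral (f := I₉) i₉]
  have htot := htime.symm.trans hevol
  rw [sub_eq_iff_eq_add'] at htot
  refine htot.trans ?_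
  simp only [Function.uncurry, I₁, I₂, I₃, I₄, I₅, I₆, I₇, I₈, I₉]
  ring
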